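/- A pinched ribbon graph $G$ is a finite ribbon graph (orientable or not, possibly disconnected), with vertex discs and ribbon edges, together with finitely many half-ribbons (ribbons glued to one vertex along one end, the other end being free and pinched by a $2$-valent vertex), considered up to equivalence. Cutting an edge $e$ gives $G\vee e$, in which $e$ is replaced by two half-ribbons at its ends; $G/e$ is the usual ribbon graph contraction. An edge is a bridge if removing it disconnects a component, a loop if its ends lie on the same vertex, and regular otherwise. A class of pinched ribbon graphs is minor closed if it is closed under cutting edges, contracting edges, and deleting a vertex incident with no edge (together with its half-ribbons). Put $$\mathcal R'(G;x,y,z,w,t)=\sum_{A}(x-1)^{r(G)-r(A)}(y-1)^{n(A)}z^{k(A)-F_{\rm int}(A)-C_\partial(A)+n(A)}w^{t(A)}t^{f(A)},$$ where $A$ runs over all graphs obtained from $G$ by cutting a set of edges, $k$ is the number of connected components, $r=|V|-k$, $n=|E|-r$, $f$ is the number of half-ribbons, $t(A)=0$ if $A$ is orientable and $1$ otherwise, and $F_{\rm int}$ (resp. $C_\partial$) is the number of boundary circles of the pinched graph that meet no (resp. at least one) half-ribbon. Let $D_{1000}$, $D_{1010}$, $D_{2100}$, $D_{0001}$ be the one-vertex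 graphs with, respectively, one untwisted loop, one twisted loop, two interlaced untwisted loops, and one half-ribbon (and nothing else). **Theorem.** Let $\mathcal M$ be a minor closed class of pinched ribbon graphs containing all pinched ribbon graphs with two vertices, and let $F$ be a map from $\mathcal M$ to a commutative ring $\mathfrak R$ with unity. Let $s=F(D_{2100})$, $q=F(D_{1000})$, $r=F(D_{1010})$, $s_1=F(D_{0001})$, and suppose there are elements $\alpha,x,u,v,t\in\mathfrak R$, with $\alpha$ a unit, such that: 1. $F(G)=F(G\vee e)+F(G/e)$ if $e$ is a regular edge of $G\in\mathcal M$, and $F(G)=\big((x-1)(\alpha^{-1}s_1)^2+1\big)F(G/e)$ if $e$ is a bridge of $G\in\mathcal M$; 2. $F(G\sqcup H)=F(G)F(H)$ whenever $G,H,G\sqcup H\in\mathcal M$, and $\alpha F(G\cdot H)=F(G)F(H)$ for every one-point joint $G\cdot H$ of two one-vertex graphs $G,H$; 3. $F(E)=\alpha^n t^m$ if $E\in\mathcal M$ has no edges, $n$ vertices and $m$ half-ribbons; 4. $(q-\alpha^{-1}s_1^2)^2u^2=\alpha\big[s-2\alpha^{-2}(q-\alpha^{-1}s_1^2)s_1^2-\alpha^{-3}s_1^4\big]$,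 $(q-\alpha^{-1}s_1^2)uv=r-\alpha^{-1}s_1^2$, and $v=v^2$. Then for every $G\in\mathcal M$, with $k(G)$ its number of connected components, $$F(G)=\alpha^{k(G)}\,\mathcal R'\big(G;\,x,\ \alpha^{-1}(q-\alpha^{-1}s_1^2+\alpha),\ u,\ v,\ \alpha^{-1}s_1\big).$$ -/

import Mathlib

/-- A pinched ribbon graph (a ribbon graph with half-ribbons), orientable or not, encoded by its flags.
Every end of a ribbon edge, and every half-ribbon, is glued to the boundary circle of a vertex disc
along an arc; the flags are the two end points of all these arcs.
* `arc` exchanges the two end points of one arc.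
* `corner` follows the boundary circle of the vertex, outside the arcs, to the next flag.
* `side` follows the boundary line of the ribbon that starts at a flag.
For a ribbon edge the four flags `a`, `arc a`, `side a`, `arc (side a)` are distinct.  For a
half-ribbon the two boundary lines are joined at the two-valent vertex inserted (the pinching)
at its free segment, so that `side = arc` on its two flags.
Vertex discs to which nothing is attached carry no flag; they are counted by `isolated`. -/
structure PinchedRibbonGraph where
  Flag : Type
  finite : Finite Flag
  isolated : ℕ
  arc : Flag → Flag
  corner : Flag → Flag
  side : Flag → Flag
  arc_arc : ∀ a, arc (arc a) = a
  corner_corner : ∀ a, corner (corner a) = a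
  side_side : ∀ a, side (side a) = a
  arc_ne : ∀ a, arc a ≠ a
  corner_ne : ∀ a, corner a ≠ a
  side_ne : ∀ a, side a ≠ a
  arc_side : ∀ a, arc (side a) = side (arc a)

namespace PinchedRibbonGraph

/-- Equivalence of ribbon graphs: a bijection of the flags that respects the whole structure
(a homeomorphism of the ribbon surfaces preserving vertices, edges and half-ribbons). -/
structure Iso (G H : PinchedRibbonGraph) where
  toEquiv : G.Flag ≃ H.Flag
  map_arc : ∀ a, toEquiv (G.arc a) = H.arc (toEquiv a)
  map_corner : ∀ a, toEquiv (G.corner a) = H.corner (toEquiv a)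
  map_side : ∀ a, toEquiv (G.side a) = H.side (toEquiv a)
  isolated_eq : G.isolated = H.isolated

/-- Vertices that carry at least one flag.  (`Quot` divides by the generated equivalence.) -/
def AttachedVertex (G : PinchedRibbonGraph) : Type :=
  Quot fun a b : G.Flag => b = G.arc a ∨ b = G.corner a

/-- Ribbons, that is, ribbon edges together with half-ribbons. -/
def Ribbon (G : PinchedRibbonGraph) : Type :=
  Quot fun a b : G.Flag => b = G.arc a ∨ b = G.side a

/-- Boundary circles of the pinched ribbon graph that pass through at least one flag. -/
def Circle (G : PinchedRibbonGraph) : Type :=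
  Quot fun a b : G.Flag => b = G.corner a ∨ b = G.side a

/-- Connected components that carry at least one flag. -/
def AttachedComponent (G : PinchedRibbonGraph) : Type :=
  Quot fun a b : G.Flag => b = G.arc a ∨ b = G.corner a ∨ b = G.side a

/-- The vertex at which a flag lies. -/
def vertexOf (G : PinchedRibbonGraph) (a : G.Flag) : G.AttachedVertex := Quot.mk _ a

/-- The ribbon to which a flag belongs. -/
def ribbonOf (G : PinchedRibbonGraph) (a : G.Flag) : G.Ribbon := Quot.mk _ a

/-- The boundary circle through a flag. -/
def circleOf (G : PinchedRibbonGraph) (a : G.Flag) : G.Circle := Quot.mk _ a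

/-- The ribbon edges. -/
def Edge (G : PinchedRibbonGraph) : Type :=
  {e : G.Ribbon // ∃ a, G.ribbonOf a = e ∧ G.side a ≠ G.arc a}

/-- The half-ribbons (HRs). -/
def HalfRibbon (G : PinchedRibbonGraph) : Type :=
  {h : G.Ribbon // ∃ a, G.ribbonOf a = h ∧ G.side a = G.arc a}

/-- `|V|`. -/
noncomputable def numVertices (G : PinchedRibbonGraph) : ℕ :=
  Nat.card G.AttachedVertex + G.isolated

/-- `|E|`. -/
noncomputable def numEdges (G : PinchedRibbonGraph) : ℕ := Nat.card G.Edge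

/-- `f`, the number of half-ribbons. -/
noncomputable def numHalfRibbons (G : PinchedRibbonGraph) : ℕ := Nat.card G.HalfRibbon

/-- `k`, the number of connected components. -/
noncomputable def numComponents (G : PinchedRibbonGraph) : ℕ :=
  Nat.card G.AttachedComponent + G.isolated

/-- The rank `r = |V| - k` (always `k ≤ |V|`). -/
noncomputable def rank (G : PinchedRibbonGraph) : ℕ := G.numVertices - G.numComponents

/-- The nullity `n = |E| - r` (always `r ≤ |E|`). -/
noncomputable def nullity (G : PinchedRibbonGraph) : ℕ := G.numEdges - G.rank

/-- `F_int`, the number of closed faces: boundary circles that meet no half-ribbon,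
including the boundaries of isolated discs. -/
noncomputable def numClosedFaces (G : PinchedRibbonGraph) : ℕ :=
  Nat.card {c : G.Circle // ∀ a, G.circleOf a = c → G.side a ≠ G.arc a} + G.isolated

/-- `C_∂`, the number of connected components of the boundary graph, whose vertices are the
half-ribbons and whose edges are the open faces.  The open faces, joined at the half-ribbons,
make up exactly the boundary circles that meet some half-ribbon. -/
noncomputable def numBoundaryComponents (G : PinchedRibbonGraph) : ℕ :=
  Nat.card {c : G.Circle // ∃ a, G.circleOf a = c ∧ G.side a = G.arc a}

/-- Orientability as a surface: the flags have a 2-colouring that alternates along arcs, corners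
and ribbon sides. -/
def Orientable (G : PinchedRibbonGraph) : Prop :=
  ∃ o : G.Flag → Bool, ∀ a, o (G.arc a) = !o a ∧ o (G.corner a) = !o a ∧ o (G.side a) = !o a

open Classical in
/-- The parameter `t`: `0` if orientable and `1` otherwise. -/
noncomputable def orientParam (G : PinchedRibbonGraph) : ℕ := if G.Orientable then 0 else 1

/-! ### Cut and contraction -/

theorem ribbonOf_arc (G : PinchedRibbonGraph) (a : G.Flag) :
    G.ribbonOf (G.arc a) = G.ribbonOf a := by
  symm
  apply Quot.sound
  exact Or.inl rfl

theorem ribbonOf_side (G : PinchedRibbonGraph) (a : G.Flag) :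
    G.ribbonOf (G.side a) = G.ribbonOf a := by
  symm
  apply Quot.sound
  exact Or.inr rfl

theorem mem_of_ribbonOf_eq (G : PinchedRibbonGraph) {a b : G.Flag}
    (h : G.ribbonOf b = G.ribbonOf a) :
    b = a ∨ b = G.arc a ∨ b = G.side a ∨ b = G.arc (G.side a) := by
  let f : G.Ribbon → Set G.Flag :=
    Quot.lift (fun a => {x | x = a ∨ x = G.arc a ∨ x = G.side a ∨ x = G.arc (G.side a)}) (by
      rintro a _ (rfl | rfl) <;> ext x <;>
        simp only [Set.mem_ofPred_eq, G.arc_arc, G.side_side, ← G.arc_side] <;> tauto)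
  have h1 : f (G.ribbonOf b) = f (G.ribbonOf a) := by rw [h]
  have h2 : b ∈ f (G.ribbonOf b) := Or.inl rfl
  rw [h1] at h2
  exact h2

open Classical in
/-- Cutting all the edges in `S`: each of them is replaced by two half-ribbons. -/
noncomputable def cutSet (G : PinchedRibbonGraph) (S : Set G.Edge) : PinchedRibbonGraph where
  Flag := G.Flag
  finite := G.finite
  isolated := G.isolated
  arc := G.arc
  corner := G.corner
  side a := if ∃ e ∈ S, e.1 = G.ribbonOf a then G.arc a else G.side a
  arc_arc := G.arc_arc
  corner_corner := G.corner_corner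
  side_side a := by
    by_cases h : ∃ e ∈ S, e.1 = G.ribbonOf a <;>
      simp [h, G.ribbonOf_arc, G.ribbonOf_side, G.arc_arc, G.side_side]
  arc_ne := G.arc_ne
  corner_ne := G.corner_ne
  side_ne a := by
    split_ifs
    · exact G.arc_ne a
    · exact G.side_ne a
  arc_side a := by
    by_cases h : ∃ e ∈ S, e.1 = G.ribbonOf a <;>
      simp [h, G.ribbonOf_arc, G.arc_side]

/-- The cut graph `G ∨ e`. -/
noncomputable def cut (G : PinchedRibbonGraph) (e : G.Edge) : PinchedRibbonGraph := G.cutSet {e}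

/-- The spanning c-subgraph with edge set `A`: all other edges are cut. -/
noncomputable def spanning (G : PinchedRibbonGraph) (A : Set G.Edge) : PinchedRibbonGraph :=
  G.cutSet Aᶜ

open Classical in
/-- The flag that follows `a` on the boundary of the union of `e` with its end vertices. -/
noncomputable def next (G : PinchedRibbonGraph) (e : G.Edge) (a : G.Flag) : G.Flag :=
  if G.ribbonOf (G.corner a) = e.1 then
    if G.ribbonOf (G.corner (G.side (G.corner a))) = e.1 then
      G.corner (G.side (G.corner (G.side (G.corner a))))
    else G.corner (G.side (G.corner a))
  else G.corner a

theorem edge_side_ne_arc (G : PinchedRibbonGraph) (e : G.Edge) {a : G.Flag}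
    (h : G.ribbonOf a = e.1) : G.side a ≠ G.arc a := by
  obtain ⟨b, hb, hne⟩ := e.2
  have := G.arc_arc; have := G.side_side; have := G.arc_side
  rcases G.mem_of_ribbonOf_eq (h.trans hb.symm) with rfl | rfl | rfl | rfl <;> grind

theorem next_notMem (G : PinchedRibbonGraph) (e : G.Edge) {a : G.Flag}
    (ha : G.ribbonOf a ≠ e.1) : G.ribbonOf (G.next e a) ≠ e.1 := by
  unfold next
  split_ifs with h1 h2
  · intro h3
    have hb := G.mem_of_ribbonOf_eq (h2.trans h1.symm)
    have hc := G.mem_of_ribbonOf_eq (h3.trans h1.symm)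
    have hs := G.edge_side_ne_arc e h1
    have c1 := G.corner_corner; have c2 := G.side_side; have c3 := G.arc_arc
    have c4 := G.corner_ne; have c5 := G.side_ne; have c6 := G.arc_ne; have c7 := G.arc_side
    have c8 := G.ribbonOf_side; have c9 := G.ribbonOf_arc
    grind
  · exact h2
  · exact h1

theorem next_next (G : PinchedRibbonGraph) (e : G.Edge) {a : G.Flag}
    (ha : G.ribbonOf a ≠ e.1) : G.next e (G.next e a) = a := by
  have hn := G.next_notMem e ha
  have c1 := G.corner_corner; have c2 := G.side_side
  have c3 := G.ribbonOf_side
  unfold next at hn ⊢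
  grind

theorem next_ne (G : PinchedRibbonGraph) (e : G.Edge) (a : G.Flag) :
    G.next e a ≠ a := by
  have c1 := G.corner_corner; have c2 := G.side_side
  have c4 := G.corner_ne; have c5 := G.side_ne
  unfold next
  grind

/-- The contraction `G / e`, for an arbitrary edge (also a loop): `e` and its end vertices are
replaced by vertex discs glued along the boundary circles of their union.  A boundary circle that
meets only flags of `e` bounds a new isolated vertex. -/
noncomputable def contract (G : PinchedRibbonGraph) (e : G.Edge) : PinchedRibbonGraph where
  Flag := {a : G.Flag // G.ribbonOf a ≠ e.1}
  finite := haveI := G.finite; inferInstance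
  isolated := G.isolated +
    Nat.card {c : G.Circle // ∀ a, G.circleOf a = c → G.ribbonOf a = e.1}
  arc a := ⟨G.arc a.1, by rw [G.ribbonOf_arc]; exact a.2⟩
  corner a := ⟨G.next e a.1, G.next_notMem e a.2⟩
  side a := ⟨G.side a.1, by rw [G.ribbonOf_side]; exact a.2⟩
  arc_arc a := Subtype.ext (G.arc_arc a.1)
  corner_corner a := Subtype.ext (G.next_next e a.2)
  side_side a := Subtype.ext (G.side_side a.1)
  arc_ne a h := G.arc_ne a.1 (congrArg Subtype.val h)
  corner_ne a h := G.next_ne e a.1 (congrArg Subtype.val h)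
  side_ne a h := G.side_ne a.1 (congrArg Subtype.val h)
  arc_side a := Subtype.ext (G.arc_side a.1)

/-- `e` is a bridge: its removal disconnects a component.  (The two half-ribbons left by the cut
do not affect connectedness.) -/
def IsBridge (G : PinchedRibbonGraph) (e : G.Edge) : Prop :=
  G.numComponents < (G.cut e).numComponents

/-- `e` is a loop: both its ends lie on the same vertex. -/
def IsLoop (G : PinchedRibbonGraph) (e : G.Edge) : Prop :=
  ∀ a b, G.ribbonOf a = e.1 → G.ribbonOf b = e.1 → G.vertexOf a = G.vertexOf b

/-- `e` is regular: neither a bridge nor a loop. -/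
def IsRegularEdge (G : PinchedRibbonGraph) (e : G.Edge) : Prop :=
  ¬ G.IsBridge e ∧ ¬ G.IsLoop e

/-- A bouquet: a ribbon graph with exactly one vertex. -/
def IsBouquet (G : PinchedRibbonGraph) : Prop := G.numVertices = 1

/-- A graph without ribbon edges (half-ribbons are allowed). -/
def IsEdgeless (G : PinchedRibbonGraph) : Prop := IsEmpty G.Edge

/-! ### Disjoint union and one-point joint -/

/-- The disjoint union `G ⊔ H`. -/
def disjointUnion (G H : PinchedRibbonGraph) : PinchedRibbonGraph where
  Flag := G.Flag ⊕ H.Flag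
  finite := haveI := G.finite; haveI := H.finite; inferInstance
  isolated := G.isolated + H.isolated
  arc := Sum.map G.arc H.arc
  corner := Sum.map G.corner H.corner
  side := Sum.map G.side H.side
  arc_arc := by rintro (a | a) <;> simp [G.arc_arc, H.arc_arc]
  corner_corner := by rintro (a | a) <;> simp [G.corner_corner, H.corner_corner]
  side_side := by rintro (a | a) <;> simp [G.side_side, H.side_side]
  arc_ne := by rintro (a | a) <;> simp [G.arc_ne, H.arc_ne]
  corner_ne := by rintro (a | a) <;> simp [G.corner_ne, H.corner_ne]
  side_ne := by rintro (a | a) <;> simp [G.side_ne, H.side_ne]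
  arc_side := by rintro (a | a) <;> simp [G.arc_side, H.arc_side]

open Classical in
/-- The one-point joint `G · H`: the vertex of `G` carrying the flag `c` and the vertex of `H`
carrying the flag `d` are merged into one, by gluing the two discs along the corners
`{c, corner c}` and `{d, corner d}`; the cyclic orders on both vertices are kept.
(The joint with a vertex to which nothing is attached changes nothing and is not covered.) -/
noncomputable def joint (G H : PinchedRibbonGraph) (c : G.Flag) (d : H.Flag) :
    PinchedRibbonGraph where
  Flag := G.Flag ⊕ H.Flag
  finite := haveI := G.finite; haveI := H.finite; inferInstance
  isolated := G.isolated + H.isolated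
  arc := Sum.map G.arc H.arc
  corner := Sum.elim
    (fun a => if a = c then Sum.inr d
      else if a = G.corner c then Sum.inr (H.corner d) else Sum.inl (G.corner a))
    (fun b => if b = d then Sum.inl c
      else if b = H.corner d then Sum.inl (G.corner c) else Sum.inr (H.corner b))
  side := Sum.map G.side H.side
  arc_arc := by rintro (a | a) <;> simp [G.arc_arc, H.arc_arc]
  corner_corner := by
    have := G.corner_corner; have := H.corner_corner
    have := G.corner_ne; have := H.corner_ne
    rintro (a | a) <;> simp only [Sum.elim_inl, Sum.elim_inr] <;> split_ifs <;>
      simp only [Sum.elim_inl, Sum.elim_inr] <;> grind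
  side_side := by rintro (a | a) <;> simp [G.side_side, H.side_side]
  arc_ne := by rintro (a | a) <;> simp [G.arc_ne, H.arc_ne]
  corner_ne := by
    have := G.corner_ne; have := H.corner_ne
    rintro (a | a) <;> simp only [Sum.elim_inl, Sum.elim_inr] <;> split_ifs <;> simp_all
  side_ne := by rintro (a | a) <;> simp [G.side_ne, H.side_ne]
  arc_side := by rintro (a | a) <;> simp [G.arc_side, H.arc_side]

/-! ### Chord diagrams -/

/-- The bouquet of a signed chord diagram with half-chords.  The `m` ends of chords and half-chords
are placed in cyclic order on a circle and numbered by `Fin m`; `p` and `μ p` are the two ends of a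
chord, or `p` is the end of a half-chord if `μ p = p`; `tw p` says that the chord at `p` is
twisted.  The flags `(p, false)` and `(p, true)` are the two sides of the end `p`. -/
def chordDiagram (m : ℕ) [NeZero m] (μ : Fin m → Fin m) (tw : Fin m → Bool)
    (hμ : ∀ p, μ (μ p) = p) (htw : ∀ p, tw (μ p) = tw p)
    (hfix : ∀ p, μ p = p → tw p = false) : PinchedRibbonGraph where
  Flag := Fin m × Bool
  finite := inferInstance
  isolated := 0
  arc a := (a.1, !a.2)
  corner a := if a.2 then (a.1 + 1, false) else (a.1 - 1, true)
  side a := (μ a.1, if tw a.1 then a.2 else !a.2)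
  arc_arc := by simp
  corner_corner := by rintro ⟨p, _ | _⟩ <;> simp
  side_side := by rintro ⟨p, b⟩; by_cases h : tw p <;> simp [hμ, htw, h]
  arc_ne := by rintro ⟨p, _ | _⟩ <;> simp
  corner_ne := by rintro ⟨p, _ | _⟩ <;> simp
  side_ne := by
    rintro ⟨p, b⟩ h
    have h1 := hfix p (congrArg Prod.fst h)
    have h2 := congrArg Prod.snd h
    simp [h1] at h2
  arc_side := by rintro ⟨p, b⟩; by_cases h : tw p <;> simp [h]

/-- `D_{1000}`: a single untwisted chord. -/
def D1000 : PinchedRibbonGraph :=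
  chordDiagram 2 (fun p => p + 1) (fun _ => false) (by decide) (by decide) (by decide)

/-- `D_{1010}`: a single twisted chord. -/
def D1010 : PinchedRibbonGraph :=
  chordDiagram 2 (fun p => p + 1) (fun _ => true) (by decide) (by decide) (by decide)

/-- `D_{2100}`: two untwisted chords that intersect each other. -/
def D2100 : PinchedRibbonGraph :=
  chordDiagram 4 (fun p => p + 2) (fun _ => false) (by decide) (by decide) (by decide)

/-- `D_{0001}`: a single half-chord. -/
def D0001 : PinchedRibbonGraph :=
  chordDiagram 1 (fun p => p) (fun _ => false) (by decide) (by decide) (by decide)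

/-! ### Minor-closed classes and the polynomial -/

/-- A class of pinched ribbon graphs (up to equivalence) is minor closed if it is closed under
cutting an edge, contracting an edge, and deleting a vertex not incident with any edge (together
with its half-ribbons). -/
structure MinorClosed (M : Set PinchedRibbonGraph) : Prop where
  iso : ∀ {G H : PinchedRibbonGraph}, Nonempty (G.Iso H) → G ∈ M → H ∈ M
  cut : ∀ {G : PinchedRibbonGraph}, G ∈ M → ∀ e : G.Edge, G.cut e ∈ M
  contract : ∀ {G : PinchedRibbonGraph}, G ∈ M → ∀ e : G.Edge, G.contract e ∈ M
  deleteVertex : ∀ {G V : PinchedRibbonGraph}, V.numVertices = 1 → V.IsEdgeless →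
    G.disjointUnion V ∈ M → G ∈ M

open Classical in
/-- The polynomial `R'(G; x, y, z, w, t)`, obtained from
`R(G; x, y, z, s, w, t) = ∑_A (x-1)^(r(G)-r(A)) (y-1)^(n(A)) z^(k(A)-F_int(A)+n(A)) s^(C_∂(A))
w^(t(A)) t^(f(A))` (sum over all spanning c-subgraphs `A`) by the substitution `s = z⁻¹`, evaluated
at elements of a commutative ring.  The exponents `r(G) - r(A)` and
`k(A) + n(A) - (F_int(A) + C_∂(A))` are never negative: the first is `k(A) - k(G)`, the second is
the Euler genus of `A`. -/
noncomputable def polyR' {R : Type*} [CommRing R] (G : PinchedRibbonGraph) (x y z w t : R) : R :=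
  haveI : Finite G.Edge :=
    haveI := G.finite
    haveI : Finite G.Ribbon := Quot.finite _
    Subtype.finite
  haveI : Fintype G.Edge := Fintype.ofFinite _
  ∑ A : Finset G.Edge,
    (x - 1) ^ (G.rank - (G.spanning A).rank) * (y - 1) ^ (G.spanning A).nullity *
      z ^ ((G.spanning A).numComponents + (G.spanning A).nullity -
        ((G.spanning A).numClosedFaces + (G.spanning A).numBoundaryComponents)) *
      w ^ (G.spanning A).orientParam * t ^ (G.spanning A).numHalfRibbons

end PinchedRibbonGraph

/-! ### Counting classes of generated equivalences; cycles traced by two involutions -/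

namespace QuotCount

variable {X Y : Type*}

/-! The theorem is a uniqueness statement. The rules imposed on `F` are collected in `Recursive`.
Two functions on `M` that obey them and agree on `D1000`, `D1010` and `D2100` coincide
(`Recursive.eq_of_eq`). The function `α ^ k(G) * R'(G)` obeys them too (`recursive_polyR'`), and
condition 4 is what makes it agree with `F` on these three graphs.

For the polynomial, the states are split according to whether a given edge is kept or cut. A
non-loop edge that is kept may be contracted: the rank drops by one, while nullity, components,
boundary circles, orientability and half-ribbons are unaffected. Cutting a bridge that is kept
multiplies the weight by `(x - 1) t²`. Disjoint unions and one-point joints multiply weights, and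
here `v = v²` is needed because the orientability parameter is not additive. Only the sum of `F_int`
and `C_∂` enters, that is, the number of all boundary circles. Vertices, circles and components are
orbits of involutions on the flags, so most of these facts reduce to `QuotCount.Switch`, the
exchange of partners between two pairs of an involution.

Uniqueness is proved by induction on the number of edges and, inside it, on the number of vertices.
A non-loop edge is a bridge or regular, so a rule leads to fewer edges. If all edges are loops,
every vertex is a component and multiplicativity leads to one bouquet.

For a bouquet `G` the decisive tool is the handle slide. Two neighbouring ends of ribbons are moved
to a new vertex joined to the old one by a new edge. The resulting graph `X` has two vertices, hence
lies in `M`, and two regular edges `e`, `e'` such that `X/e` is `G` and `X/e'` is `G` after the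
slide. Writing `F X` in both ways gives `F (X ∨ e) + F (X/e) = F (X ∨ e') + F (X/e')`. The cut
graphs have as many edges as `G` but retain a non-loop edge, so they are already settled; hence
agreement at `G` follows from agreement at its slide (`Recursive.eq_of_slide`).

As in the classification of surfaces, slides rearrange the cyclic word of ribbon ends until a
twisted chord, an isolated untwisted chord or a pair of interlaced chords occupies a consecutive
stretch (`Reduction.of_isBouquet`). Then the bouquet is one of the three diagrams or a one-point
joint of two bouquets with fewer flags. In the latter case the joint rule applies, since `α` is a
unit. -/

theorem card_congr {r : X → X → Prop} {s : Y → Y → Prop} (f : X → Y) (g : Y → X)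
    (hf : ∀ a b, r a b → Quot.mk s (f a) = Quot.mk s (f b))
    (hg : ∀ a b, s a b → Quot.mk r (g a) = Quot.mk r (g b))
    (hgf : ∀ a, Quot.mk r (g (f a)) = Quot.mk r a)
    (hfg : ∀ b, Quot.mk s (f (g b)) = Quot.mk s b) :
    Nat.card (Quot r) = Nat.card (Quot s) := by
  refine Nat.card_congr ⟨Quot.lift (fun a => Quot.mk s (f a)) hf,
    Quot.lift (fun a => Quot.mk r (g a)) hg, ?_, ?_⟩
  · rintro ⟨a⟩; exact hgf a
  · rintro ⟨a⟩; exact hfg a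

theorem card_eq_of_mutual {r s : X → X → Prop}
    (h : ∀ a b, r a b → Quot.mk s a = Quot.mk s b)
    (h' : ∀ a b, s a b → Quot.mk r a = Quot.mk r b) :
    Nat.card (Quot r) = Nat.card (Quot s) :=
  card_congr id id h h' (fun _ => rfl) (fun _ => rfl)

theorem mk_eq_of_imp {r s : X → X → Prop} (h : ∀ a b, r a b → Quot.mk s a = Quot.mk s b)
    {a b : X} (hab : Quot.mk r a = Quot.mk r b) : Quot.mk s a = Quot.mk s b :=
  congrArg (Quot.lift (Quot.mk s) h) hab

theorem card_le_of_imp [Finite X] {r s : X → X → Prop}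
    (h : ∀ a b, r a b → Quot.mk s a = Quot.mk s b) :
    Nat.card (Quot s) ≤ Nat.card (Quot r) := by
  have : Finite (Quot r) := Quot.finite _
  refine Nat.card_le_card_of_surjective (Quot.lift (Quot.mk s) h) ?_
  rintro ⟨a⟩
  exact ⟨Quot.mk r a, rfl⟩

theorem card_addPair_of_eq {r : X → X → Prop} {p q : X} (h : Quot.mk r p = Quot.mk r q) :
    Nat.card (Quot fun a b => r a b ∨ a = p ∧ b = q) = Nat.card (Quot r) := by
  refine card_eq_of_mutual ?_ ?_
  · rintro a b (h1 | ⟨rfl, rfl⟩)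
    · exact Quot.sound h1
    · exact h
  · intro a b h1
    exact Quot.sound (Or.inl h1)

-- The class of `q` disappears into that of `p`, so the new quotient is the old one with one class
-- removed.
open Classical in
theorem card_addPair_of_ne [Finite X] {r : X → X → Prop} {p q : X}
    (h : Quot.mk r p ≠ Quot.mk r q) :
    Nat.card (Quot fun a b => r a b ∨ a = p ∧ b = q) + 1 = Nat.card (Quot r) := by
  have : Finite (Quot r) := Quot.finite _
  have : Fintype (Quot r) := Fintype.ofFinite _
  have e : (Quot fun a b => r a b ∨ a = p ∧ b = q) ≃ {c : Quot r // c ≠ Quot.mk r q} :=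
    { toFun := Quot.lift (fun a => if h' : Quot.mk r a = Quot.mk r q then ⟨Quot.mk r p, h⟩
          else ⟨Quot.mk r a, h'⟩) (by
        rintro a b (h1 | ⟨rfl, rfl⟩)
        · have := Quot.sound h1
          simp only [this]
        · simp [h])
      invFun := fun c => Quot.map id (fun a b h => Or.inl h) c.1
      left_inv := by
        rintro ⟨a⟩
        by_cases h' : Quot.mk r a = Quot.mk r q
        · simp only [h', dite_true]
          have h1 : (Quot.mk (fun a b => r a b ∨ a = p ∧ b = q) a) = Quot.mk _ q :=
            mk_eq_of_imp (r := r) (fun a b h => Quot.sound (Or.inl h)) h'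
          refine Eq.trans ?_ h1.symm
          exact Quot.sound (Or.inr ⟨rfl, rfl⟩)
        · simp only [h', dite_false]
          rfl
      right_inv := by
        rintro ⟨⟨a⟩, ha⟩
        exact dif_neg ha }
  rw [Nat.card_congr e, Nat.card_eq_fintype_card, Nat.card_eq_fintype_card,
    Fintype.card_subtype_compl, Fintype.card_subtype_eq]
  have : 0 < Fintype.card (Quot r) := Fintype.card_pos_iff.2 ⟨Quot.mk r q⟩
  omega

/-- `κ'` is obtained from the involution `κ` by replacing the pairs `{p, κ p}`, `{q, κ q}` by
`{p, q}`, `{κ p, κ q}`. -/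
structure Switch (κ κ' : X → X) (p q : X) : Prop where
  invol : ∀ a, κ (κ a) = a
  invol' : ∀ a, κ' (κ' a) = a
  left : κ' p = q
  right : κ' (κ p) = κ q
  off : ∀ a, a ≠ p → a ≠ q → a ≠ κ p → a ≠ κ q → κ' a = κ a

variable {κ κ' : X → X} {p q : X} (ρ : X → X → Prop)

/-- Both relations put all four of `p`, `q`, `κ p`, `κ q` into one class and agree elsewhere. This
common coarsening is the pivot for comparing the cycles of `κ` with those of `κ'`. -/
theorem Switch.card_addPair (h : Switch κ κ' p q) :
    Nat.card (Quot fun a b => (ρ a b ∨ b = κ a) ∨ a = p ∧ b = q) =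
      Nat.card (Quot fun a b => (ρ a b ∨ b = κ' a) ∨ a = p ∧ b = κ p) := by
  have h1 := h.invol; have h2 := h.invol'; have h3 := h.left; have h4 := h.right
  have h5 : κ' q = p := by rw [← h3, h2]
  have h6 : κ' (κ q) = κ p := by rw [← h4, h2]
  refine card_eq_of_mutual ?_ ?_
  · set s := fun a b => (ρ a b ∨ b = κ' a) ∨ a = p ∧ b = κ p with hs
    have c1 : Quot.mk s p = Quot.mk s (κ p) := Quot.sound (Or.inr ⟨rfl, rfl⟩)
    have c2 : ∀ a, Quot.mk s a = Quot.mk s (κ' a) := fun a => Quot.sound (Or.inl (Or.inr rfl))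
    have c3 : Quot.mk s p = Quot.mk s q := (c2 p).trans (by rw [h3])
    have c4 : Quot.mk s (κ p) = Quot.mk s (κ q) := (c2 _).trans (by rw [h4])
    rintro a b ((h | rfl) | ⟨rfl, rfl⟩)
    · exact Quot.sound (Or.inl (Or.inl h))
    · by_cases e1 : a = p
      · rw [e1, c1]
      by_cases e2 : a = q
      · rw [e2, ← c3, c1, c4]
      by_cases e3 : a = κ p
      · rw [e3, h1, c1]
      by_cases e4 : a = κ q
      · rw [e4, h1, ← c3, c1, c4]
      rw [← h.off a e1 e2 e3 e4, ← c2]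
    · exact c3
  · set s := fun a b => (ρ a b ∨ b = κ a) ∨ a = p ∧ b = q with hs
    have c1 : Quot.mk s p = Quot.mk s q := Quot.sound (Or.inr ⟨rfl, rfl⟩)
    have c2 : ∀ a, Quot.mk s a = Quot.mk s (κ a) := fun a => Quot.sound (Or.inl (Or.inr rfl))
    have c3 : Quot.mk s (κ p) = Quot.mk s (κ q) := by rw [← c2, ← c2, c1]
    rintro a b ((h | rfl) | ⟨rfl, rfl⟩)
    · exact Quot.sound (Or.inl (Or.inl h))
    · by_cases e1 : a = p
      · rw [e1, h3, c1]
      by_cases e2 : a = q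
      · rw [e2, h5, c1]
      by_cases e3 : a = κ p
      · rw [e3, h4, c3]
      by_cases e4 : a = κ q
      · rw [e4, h6, c3]
      rw [h.off a e1 e2 e3 e4, ← c2]
    · exact c2 _

theorem card_addPair_le [Finite X] (r : X → X → Prop) (p q : X) :
    Nat.card (Quot fun a b => r a b ∨ a = p ∧ b = q) ≤ Nat.card (Quot r) ∧
    Nat.card (Quot r) ≤ Nat.card (Quot fun a b => r a b ∨ a = p ∧ b = q) + 1 := by
  by_cases h : Quot.mk r p = Quot.mk r q
  · have := card_addPair_of_eq h
    omega
  · have := card_addPair_of_ne h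
    omega

theorem Switch.card_le [Finite X] (h : Switch κ κ' p q) :
    Nat.card (Quot fun a b => ρ a b ∨ b = κ' a) ≤
      Nat.card (Quot fun a b => ρ a b ∨ b = κ a) + 1 := by
  have h1 := h.card_addPair ρ
  have h2 := card_addPair_le (fun a b => ρ a b ∨ b = κ a) p q
  have h3 := card_addPair_le (fun a b => ρ a b ∨ b = κ' a) p (κ p)
  omega

/-- Adding the link `p`–`q` to the old classes costs one class; adding `p`–`κ p` to the new ones
costs none; the two results have equally many classes. -/
theorem Switch.card_merge [Finite X] (h : Switch κ κ' p q)
    (hne : Quot.mk (fun a b => ρ a b ∨ b = κ a) p ≠ Quot.mk (fun a b => ρ a b ∨ b = κ a) q)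
    (heq : Quot.mk (fun a b => ρ a b ∨ b = κ' a) p =
      Quot.mk (fun a b => ρ a b ∨ b = κ' a) (κ p)) :
    Nat.card (Quot fun a b => ρ a b ∨ b = κ' a) + 1 =
      Nat.card (Quot fun a b => ρ a b ∨ b = κ a) := by
  rw [← card_addPair_of_ne hne, ← card_addPair_of_eq heq, h.card_addPair ρ]

theorem sum_eq_zero_of_involution {s : Finset X} {f : X → X} (g : X → ℤ) (hf : ∀ a ∈ s, f a ∈ s)
    (hff : ∀ a, f (f a) = a) (hne : ∀ a, f a ≠ a) (hg : ∀ a ∈ s, g (f a) = - g a) :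
    ∑ a ∈ s, g a = 0 :=
  Finset.sum_involution (fun a _ => f a) (fun a ha => by rw [hg a ha]; ring)
    (fun a _ _ => hne a) hf (fun a _ => hff a)

theorem even_card_of_involution {s : Finset X} {f : X → X} (hf : ∀ a ∈ s, f a ∈ s)
    (hff : ∀ a, f (f a) = a) (hne : ∀ a, f a ≠ a) : Even s.card := by
  have h : ∑ a ∈ s, (1 : ZMod 2) = 0 :=
    Finset.sum_involution (fun a _ => f a) (fun a ha => by decide)
      (fun a _ _ => hne a) hf (fun a _ => hff a)
  rw [Finset.sum_const, nsmul_eq_mul, mul_one] at h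
  exact (ZMod.natCast_eq_zero_iff_even).1 h

/-- In a cycle traced by two involutions, a pair that is opened stays connected by the rest of the
cycle. -/
theorem Switch.mk_eq [Finite X] {σ : X → X} (h : Switch κ κ' p q) (hσ : ∀ a, σ (σ a) = a)
    (hσne : ∀ a, σ a ≠ a) (hκne : ∀ a, κ a ≠ a)
    (hne : Quot.mk (fun a b => b = σ a ∨ b = κ a) p ≠ Quot.mk (fun a b => b = σ a ∨ b = κ a) q) :
    Quot.mk (fun a b => b = σ a ∨ b = κ' a) p = Quot.mk (fun a b => b = σ a ∨ b = κ' a) (κ p) := by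
  classical
  have := Fintype.ofFinite X
  set r := fun a b => b = σ a ∨ b = κ a with hr
  set s := fun a b => b = σ a ∨ b = κ' a with hs
  by_contra hcon
  -- Parity: `σ` preserves `W` without fixed points, so its size is even. If `p` and `κ p` were
  -- separated, `κ` would do the same on `W` without `p`, because the other three switched elements
  -- lie outside `W`.
  let W : Finset X := Finset.univ.filter fun a => Quot.mk s a = Quot.mk s p ∧ Quot.mk r a = Quot.mk r p
  have r1 : ∀ a, Quot.mk r (σ a) = Quot.mk r a := fun a => by symm; exact Quot.sound (Or.inl rfl)
  have r2 : ∀ a, Quot.mk r (κ a) = Quot.mk r a := fun a => by symm; exact Quot.sound (Or.inr rfl)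
  have s1 : ∀ a, Quot.mk s (σ a) = Quot.mk s a := fun a => by symm; exact Quot.sound (Or.inl rfl)
  have s2 : ∀ a, Quot.mk s (κ' a) = Quot.mk s a := fun a => by symm; exact Quot.sound (Or.inr rfl)
  have hW : ∀ a, a ∈ W ↔ Quot.mk s a = Quot.mk s p ∧ Quot.mk r a = Quot.mk r p := by simp [W]
  have e1 : Even W.card := even_card_of_involution (f := σ)
    (fun a ha => by rw [hW] at *; rwa [s1, r1]) hσ hσne
  have e2 : Even (W.erase p).card := by
    refine even_card_of_involution (f := κ) ?_ h.invol hκne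
    intro a ha
    rw [Finset.mem_erase, hW] at *
    obtain ⟨hap, ha1, ha2⟩ := ha
    have n1 : a ≠ κ p := by rintro rfl; exact hcon ha1.symm
    have n2 : a ≠ q := by rintro rfl; exact hne ha2.symm
    have n3 : a ≠ κ q := by rintro rfl; rw [r2] at ha2; exact hne ha2.symm
    refine ⟨?_, ?_, ?_⟩
    · intro h'
      exact n1 (by rw [← h', h.invol])
    · rw [← h.off a hap n2 n1 n3, s2, ha1]
    · rw [r2, ha2]
  have hp : p ∈ W := by rw [hW]; exact ⟨rfl, rfl⟩
  rw [Finset.card_erase_of_mem hp] at e2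
  have := Finset.card_pos.2 ⟨p, hp⟩
  grind

/-- If a colouring alternates along `σ` and, except possibly at one pair, along `κ`, then it
alternates at this pair too. -/
theorem alternates_of_alternates {S : Finset X} {σ κ : X → X} (o : X → Bool) (p : X) (hp : p ∈ S)
    (hσS : ∀ a ∈ S, σ a ∈ S) (hκS : ∀ a ∈ S, κ a ∈ S)
    (hσ : ∀ a, σ (σ a) = a) (hσne : ∀ a, σ a ≠ a) (hκ : ∀ a, κ (κ a) = a) (hκne : ∀ a, κ a ≠ a)
    (hoσ : ∀ a ∈ S, o (σ a) = !o a) (hoκ : ∀ a ∈ S, a ≠ p → a ≠ κ p → o (κ a) = !o a) :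
    o (κ p) = !o p := by
  classical
  -- With signs for colours, the sum over `S` vanishes by pairing along `σ`, and the sum off `{p, κ
  -- p}` vanishes by pairing along `κ`. Hence the signs at `p` and `κ p` cancel.
  let g : X → ℤ := fun a => if o a then 1 else -1
  have hg : ∀ a b, o b = !o a → g b = - g a := by
    intro a b h
    cases h' : o a <;> simp [g, h, h']
  have e1 : ∑ a ∈ S, g a = 0 :=
    sum_eq_zero_of_involution g hσS hσ hσne fun a ha => hg _ _ (hoσ a ha)
  have e2 : ∑ a ∈ (S.erase p).erase (κ p), g a = 0 := by
    refine sum_eq_zero_of_involution (f := κ) g ?_ hκ hκne ?_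
    · intro a ha
      simp only [Finset.mem_erase] at *
      refine ⟨?_, ?_, hκS a ha.2.2⟩
      · intro h; exact ha.2.1 (by rw [← hκ a, h, hκ])
      · intro h; exact ha.1 (by rw [← h, hκ])
    · intro a ha
      simp only [Finset.mem_erase] at ha
      exact hg _ _ (hoκ a ha.2.2 ha.2.1 ha.1)
  have hm : κ p ∈ S.erase p := Finset.mem_erase.2 ⟨hκne p, hκS p hp⟩
  have e3 := Finset.add_sum_erase _ g hm
  have e4 := Finset.add_sum_erase _ g hp
  rw [e2] at e3
  rw [← e3, e1] at e4
  cases h1 : o p <;> cases h2 : o (κ p) <;> simp [g, h1, h2] at e4 ⊢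

end QuotCount


namespace PinchedRibbonGraph

variable {G H : PinchedRibbonGraph}

instance (G : PinchedRibbonGraph) : Finite G.Flag := G.finite
instance (G : PinchedRibbonGraph) : Finite G.AttachedVertex := Quot.finite _
instance (G : PinchedRibbonGraph) : Finite G.AttachedComponent := Quot.finite _
instance (G : PinchedRibbonGraph) : Finite G.Ribbon := Quot.finite _
instance (G : PinchedRibbonGraph) : Finite G.Circle := Quot.finite _
instance (G : PinchedRibbonGraph) : Finite G.Edge := Subtype.finite
instance (G : PinchedRibbonGraph) : Finite G.HalfRibbon := Subtype.finite

/-! ### Ribbons and the number of edges -/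

theorem ribbonOf_eq_iff (G : PinchedRibbonGraph) {a b : G.Flag} :
    G.ribbonOf b = G.ribbonOf a ↔ b = a ∨ b = G.arc a ∨ b = G.side a ∨ b = G.arc (G.side a) := by
  refine ⟨G.mem_of_ribbonOf_eq, ?_⟩
  rintro (rfl | rfl | rfl | rfl) <;> simp only [G.ribbonOf_arc, G.ribbonOf_side]

/-- The edge through a flag that is not on a half-ribbon. -/
def edgeOf (G : PinchedRibbonGraph) (b : G.Flag) (hb : G.side b ≠ G.arc b) : G.Edge :=
  ⟨G.ribbonOf b, b, rfl, hb⟩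

theorem exists_edgeOf (e : G.Edge) : ∃ b hb, e = G.edgeOf b hb := by
  obtain ⟨_, b, rfl, hb⟩ := e
  exact ⟨b, hb, rfl⟩

/-- Edges of different graphs live in unrelated quotients, but their flags can be compared directly.
Edge numbers are therefore always computed by counting flags, four to an edge. -/
theorem four_mul_numEdges (G : PinchedRibbonGraph) :
    4 * G.numEdges = Nat.card {a : G.Flag // G.side a ≠ G.arc a} := by
  choose b hb using fun e : G.Edge => e.2
  have aa := G.arc_arc; have ss := G.side_side; have an := G.arc_ne; have sn := G.side_ne
  have as := G.arc_side; have ra := G.ribbonOf_arc; have rs := G.ribbonOf_side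
  let f : G.Edge × Bool × Bool → {a : G.Flag // G.side a ≠ G.arc a} := fun x =>
    ⟨if x.2.1 then G.arc (if x.2.2 then G.side (b x.1) else b x.1)
      else (if x.2.2 then G.side (b x.1) else b x.1), by have := hb x.1; grind⟩
  have hf : Function.Bijective f := by
    constructor
    · rintro ⟨e, i, j⟩ ⟨e', i', j'⟩ h
      have h1 := congrArg Subtype.val h
      have h2 : e = e' := by
        have := congrArg G.ribbonOf h1
        apply Subtype.ext
        rw [← (hb e).1, ← (hb e').1]
        simp only [f] at this
        split_ifs at this <;> simpa only [ra, rs] using this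
      subst h2
      have := (hb e).2
      simp only [f] at h1
      cases i <;> cases j <;> cases i' <;> cases j' <;> grind
    · rintro ⟨a, ha⟩
      have := hb (G.edgeOf a ha)
      have h1 : G.ribbonOf a = G.ribbonOf (b (G.edgeOf a ha)) := this.1.symm
      rcases G.ribbonOf_eq_iff.1 h1 with h | h | h | h
      · exact ⟨(_, false, false), Subtype.ext h.symm⟩
      · exact ⟨(_, true, false), Subtype.ext h.symm⟩
      · exact ⟨(_, false, true), Subtype.ext h.symm⟩
      · exact ⟨(_, true, true), Subtype.ext h.symm⟩
  rw [← Nat.card_eq_of_bijective f hf]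
  simp only [Nat.card_prod, Nat.card_eq_fintype_card (α := Bool), Fintype.card_bool, numEdges]
  ring

theorem two_mul_numHalfRibbons (G : PinchedRibbonGraph) :
    2 * G.numHalfRibbons = Nat.card {a : G.Flag // G.side a = G.arc a} := by
  choose b hb using fun e : G.HalfRibbon => e.2
  have aa := G.arc_arc; have ss := G.side_side; have an := G.arc_ne; have sn := G.side_ne
  have as := G.arc_side; have ra := G.ribbonOf_arc
  let f : G.HalfRibbon × Bool → {a : G.Flag // G.side a = G.arc a} := fun x =>
    ⟨if x.2 then G.arc (b x.1) else b x.1, by have := hb x.1; grind⟩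
  have hf : Function.Bijective f := by
    constructor
    · rintro ⟨e, i⟩ ⟨e', i'⟩ h
      have h1 := congrArg Subtype.val h
      have h2 : e = e' := by
        have := congrArg G.ribbonOf h1
        apply Subtype.ext
        rw [← (hb e).1, ← (hb e').1]
        simp only [f] at this
        split_ifs at this <;> simpa only [ra] using this
      subst h2
      have := (hb e).2
      simp only [f] at h1
      cases i <;> cases i' <;> grind
    · rintro ⟨a, ha⟩
      have := hb ⟨G.ribbonOf a, a, rfl, ha⟩
      have h1 := this.1.symm
      simp only at h1
      rcases G.ribbonOf_eq_iff.1 h1 with h | h | h | h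
      · exact ⟨(_, false), Subtype.ext h.symm⟩
      · exact ⟨(_, true), Subtype.ext h.symm⟩
      · exact ⟨(_, true), Subtype.ext (this.2.symm.trans h.symm)⟩
      · exact ⟨(_, false), Subtype.ext (by refine Eq.trans ?_ h.symm; rw [this.2, aa]; rfl)⟩
  rw [← Nat.card_eq_of_bijective f hf]
  simp only [Nat.card_prod, Nat.card_eq_fintype_card (α := Bool), Fintype.card_bool, numHalfRibbons]
  ring

theorem isEdgeless_iff (G : PinchedRibbonGraph) : G.IsEdgeless ↔ ∀ a, G.side a = G.arc a := by
  constructor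
  · intro h a
    by_contra ha
    exact h.elim (G.edgeOf a ha)
  · intro h
    refine ⟨fun e => ?_⟩
    obtain ⟨b, hb, -⟩ := exists_edgeOf e
    exact hb (h b)

theorem isEdgeless_iff_numEdges (G : PinchedRibbonGraph) : G.IsEdgeless ↔ G.numEdges = 0 := by
  rw [IsEdgeless, numEdges, Finite.card_eq_zero_iff]

/-! ### Boundary circles -/

/-- The number of all boundary circles. -/
noncomputable def numCircles (G : PinchedRibbonGraph) : ℕ := Nat.card G.Circle + G.isolated

/-- In `polyR'` the two kinds of boundary circles occur only through their sum, so they need not be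
told apart from here on. -/
theorem numClosedFaces_add_numBoundaryComponents (G : PinchedRibbonGraph) :
    G.numClosedFaces + G.numBoundaryComponents = G.numCircles := by
  classical
  have h := Nat.card_congr (Equiv.sumCompl fun c : G.Circle =>
    ∃ a, G.circleOf a = c ∧ G.side a = G.arc a)
  rw [Nat.card_sum] at h
  have h2 : Nat.card {c : G.Circle // ¬ ∃ a, G.circleOf a = c ∧ G.side a = G.arc a} =
      Nat.card {c : G.Circle // ∀ a, G.circleOf a = c → G.side a ≠ G.arc a} :=
    Nat.card_congr (Equiv.subtypeEquivRight fun c => by simp)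
  rw [numClosedFaces, numBoundaryComponents, numCircles, ← h, ← h2]
  ring

/-! ### Invariance under equivalence -/

namespace Iso

/-- The inverse equivalence. -/
def symm (f : G.Iso H) : H.Iso G where
  toEquiv := f.toEquiv.symm
  map_arc a := by rw [Equiv.symm_apply_eq, f.map_arc, Equiv.apply_symm_apply]
  map_corner a := by rw [Equiv.symm_apply_eq, f.map_corner, Equiv.apply_symm_apply]
  map_side a := by rw [Equiv.symm_apply_eq, f.map_side, Equiv.apply_symm_apply]
  isolated_eq := f.isolated_eq.symm

theorem numVertices_eq (f : G.Iso H) : G.numVertices = H.numVertices := by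
  rw [numVertices, numVertices, f.isolated_eq]
  congr 1
  exact Nat.card_congr (Quot.congr f.toEquiv fun a b => by
    simp only [← f.map_arc, ← f.map_corner, f.toEquiv.apply_eq_iff_eq])

theorem numComponents_eq (f : G.Iso H) : G.numComponents = H.numComponents := by
  rw [numComponents, numComponents, f.isolated_eq]
  congr 1
  exact Nat.card_congr (Quot.congr f.toEquiv fun a b => by
    simp only [← f.map_arc, ← f.map_corner, ← f.map_side, f.toEquiv.apply_eq_iff_eq])

theorem numCircles_eq (f : G.Iso H) : G.numCircles = H.numCircles := by
  rw [numCircles, numCircles, f.isolated_eq]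
  congr 1
  exact Nat.card_congr (Quot.congr f.toEquiv fun a b => by
    simp only [← f.map_side, ← f.map_corner, f.toEquiv.apply_eq_iff_eq])

theorem numEdges_eq (f : G.Iso H) : G.numEdges = H.numEdges := by
  have h : Nat.card {a : G.Flag // G.side a ≠ G.arc a} = Nat.card {a : H.Flag // H.side a ≠ H.arc a} :=
    Nat.card_congr (f.toEquiv.subtypeEquiv fun a => by
      rw [← f.map_side, ← f.map_arc, Ne, Ne, f.toEquiv.apply_eq_iff_eq])
  rw [← four_mul_numEdges, ← four_mul_numEdges] at h
  omega

theorem numHalfRibbons_eq (f : G.Iso H) : G.numHalfRibbons = H.numHalfRibbons := by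
  have h : Nat.card {a : G.Flag // G.side a = G.arc a} = Nat.card {a : H.Flag // H.side a = H.arc a} :=
    Nat.card_congr (f.toEquiv.subtypeEquiv fun a => by
      rw [← f.map_side, ← f.map_arc, f.toEquiv.apply_eq_iff_eq])
  rw [← two_mul_numHalfRibbons, ← two_mul_numHalfRibbons] at h
  omega

theorem orientable_imp (f : G.Iso H) (h : H.Orientable) : G.Orientable := by
  obtain ⟨o, ho⟩ := h
  exact ⟨fun a => o (f.toEquiv a), fun a => by
    simp only [f.map_arc, f.map_corner, f.map_side]; exact ho _⟩

theorem orientParam_eq (f : G.Iso H) : G.orientParam = H.orientParam := by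
  have : G.Orientable ↔ H.Orientable := ⟨f.symm.orientable_imp, f.orientable_imp⟩
  unfold orientParam
  by_cases h : G.Orientable
  · rw [if_pos h, if_pos (this.1 h)]
  · rw [if_neg h, if_neg (mt this.2 h)]

theorem rank_eq (f : G.Iso H) : G.rank = H.rank := by
  rw [rank, rank, f.numVertices_eq, f.numComponents_eq]

theorem nullity_eq (f : G.Iso H) : G.nullity = H.nullity := by
  rw [nullity, nullity, f.numEdges_eq, f.rank_eq]

end Iso

/-! ### Cutting along sets of flags -/

/-- The sets of edges, given by their flags. -/
@[ext] structure CutSet (G : PinchedRibbonGraph) where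
  carrier : Set G.Flag
  arc_mem : ∀ a ∈ carrier, G.arc a ∈ carrier
  side_mem : ∀ a ∈ carrier, G.side a ∈ carrier
  edge : ∀ a ∈ carrier, G.side a ≠ G.arc a

instance : Finite G.CutSet :=
  Finite.of_injective CutSet.carrier fun _ _ h => CutSet.ext h

noncomputable instance : Fintype G.CutSet := Fintype.ofFinite _

theorem CutSet.arc_mem_iff (C : G.CutSet) {a : G.Flag} : G.arc a ∈ C.carrier ↔ a ∈ C.carrier :=
  ⟨fun h => by simpa only [G.arc_arc] using C.arc_mem _ h, C.arc_mem a⟩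

theorem CutSet.side_mem_iff (C : G.CutSet) {a : G.Flag} : G.side a ∈ C.carrier ↔ a ∈ C.carrier :=
  ⟨fun h => by simpa only [G.side_side] using C.side_mem _ h, C.side_mem a⟩

open Classical in
/-- Cutting the edges with flags in `C`. -/
noncomputable abbrev cutOn (G : PinchedRibbonGraph) (C : G.CutSet) : PinchedRibbonGraph where
  Flag := G.Flag
  finite := G.finite
  isolated := G.isolated
  arc := G.arc
  corner := G.corner
  side a := if a ∈ C.carrier then G.arc a else G.side a
  arc_arc := G.arc_arc
  corner_corner := G.corner_corner
  side_side a := by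
    by_cases h : a ∈ C.carrier <;> simp [h, C.arc_mem_iff, C.side_mem_iff, G.arc_arc, G.side_side]
  arc_ne := G.arc_ne
  corner_ne := G.corner_ne
  side_ne a := by
    split_ifs
    · exact G.arc_ne a
    · exact G.side_ne a
  arc_side a := by
    by_cases h : a ∈ C.carrier <;> simp [h, C.arc_mem_iff, G.arc_side]

theorem cutOn_side_of_mem {C : G.CutSet} {a : G.Flag} (h : a ∈ C.carrier) :
    (G.cutOn C).side a = G.arc a := if_pos h

theorem cutOn_side_of_notMem {C : G.CutSet} {a : G.Flag} (h : a ∉ C.carrier) :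
    (G.cutOn C).side a = G.side a := if_neg h

/-- The flags of a set of edges. -/
def flagsOf (G : PinchedRibbonGraph) (S : Set G.Edge) : G.CutSet where
  carrier := {a | ∃ e ∈ S, e.1 = G.ribbonOf a}
  arc_mem a h := by simpa only [Set.mem_ofPred_eq, G.ribbonOf_arc] using h
  side_mem a h := by simpa only [Set.mem_ofPred_eq, G.ribbonOf_side] using h
  edge a := by
    rintro ⟨e, -, he⟩
    exact G.edge_side_ne_arc e he.symm

/-- This reindexes sums over edge sets by sets of flags, which are easier to carry over to a graph
after a cut or a contraction. -/
theorem flagsOf_bijective (G : PinchedRibbonGraph) : Function.Bijective G.flagsOf := by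
  constructor
  · intro S T h
    have h1 : ∀ a, a ∈ (G.flagsOf S).carrier ↔ a ∈ (G.flagsOf T).carrier := fun a => by rw [h]
    ext e
    obtain ⟨b, hb, rfl⟩ := exists_edgeOf e
    have key : ∀ S : Set G.Edge, b ∈ (G.flagsOf S).carrier ↔ G.edgeOf b hb ∈ S := by
      intro S
      constructor
      · rintro ⟨e, he, h⟩
        rwa [← show e = G.edgeOf b hb from Subtype.ext h]
      · intro h
        exact ⟨_, h, rfl⟩
    rw [← key, ← key, h1]
  · intro C
    refine ⟨{e | ∃ a ∈ C.carrier, G.ribbonOf a = e.1}, ?_⟩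
    ext a
    constructor
    · rintro ⟨e, ⟨b, hb, h1⟩, h2⟩
      rcases G.ribbonOf_eq_iff.1 (h1.trans h2) with rfl | rfl | rfl | rfl
      · exact hb
      · exact C.arc_mem_iff.1 hb
      · exact C.side_mem_iff.1 hb
      · exact C.side_mem_iff.1 (C.arc_mem_iff.1 hb)
    · intro h
      exact ⟨G.edgeOf a (C.edge a h), ⟨a, h, rfl⟩, rfl⟩

variable {R : Type*} [CommRing R]

/-- The sum of `φ` over all spanning c-subgraphs. -/
noncomputable def stateSum (φ : PinchedRibbonGraph → R) (G : PinchedRibbonGraph) : R :=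
  ∑ C : G.CutSet, φ (G.cutOn C)

/-- The summand of `polyR'`; `r₀` is the rank of the ambient graph. -/
noncomputable def weight (x y z w t : R) (r₀ : ℕ) (H : PinchedRibbonGraph) : R :=
  (x - 1) ^ (r₀ - H.rank) * (y - 1) ^ H.nullity *
    z ^ (H.numComponents + H.nullity - H.numCircles) * w ^ H.orientParam * t ^ H.numHalfRibbons

theorem Iso.weight_eq (f : G.Iso H) (x y z w t : R) (r₀ : ℕ) :
    weight x y z w t r₀ G = weight x y z w t r₀ H := by
  rw [weight, weight, f.rank_eq, f.nullity_eq, f.numComponents_eq, f.numCircles_eq,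
    f.orientParam_eq, f.numHalfRibbons_eq]

theorem polyR'_eq_stateSum (G : PinchedRibbonGraph) (x y z w t : R) :
    G.polyR' x y z w t = stateSum (weight x y z w t G.rank) G := by
  classical
  let _ : Fintype G.Edge := Fintype.ofFinite _
  rw [polyR', stateSum]
  -- The complement appears because `A` lists the edges that are kept and a `CutSet` those that are
  -- cut.
  refine Fintype.sum_bijective (fun A : Finset G.Edge => G.flagsOf ((A : Set G.Edge)ᶜ)) ?_ _ _ ?_
  · refine G.flagsOf_bijective.comp ((compl_involutive (α := Set G.Edge)).bijective.comp ?_)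
    exact ⟨fun A B h => Finset.coe_injective h, fun S => ⟨S.toFinite.toFinset, by simp⟩⟩
  · intro A
    rw [weight, ← numClosedFaces_add_numBoundaryComponents]
    rfl

/-- The bijection between edge sets induced by an equivalence. -/
def Iso.cutSetEquiv (f : G.Iso H) : G.CutSet ≃ H.CutSet where
  toFun C := ⟨f.toEquiv.symm ⁻¹' C.carrier,
    fun a h => by
      have := f.symm.map_arc a
      simp only [Iso.symm] at this
      simpa only [Set.mem_preimage, this, C.arc_mem_iff] using h,
    fun a h => by
      have := f.symm.map_side a
      simp only [Iso.symm] at this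
      simpa only [Set.mem_preimage, this, C.side_mem_iff] using h,
    fun a h h' => by
      refine C.edge _ h ?_
      have h1 := f.symm.map_arc a
      have h2 := f.symm.map_side a
      simp only [Iso.symm] at h1 h2
      rw [← h1, ← h2, h']⟩
  invFun C := ⟨f.toEquiv ⁻¹' C.carrier,
    fun a h => by simpa only [Set.mem_preimage, f.map_arc, C.arc_mem_iff] using h,
    fun a h => by simpa only [Set.mem_preimage, f.map_side, C.side_mem_iff] using h,
    fun a h h' => by
      refine C.edge _ h ?_
      rw [← f.map_arc, ← f.map_side, h']⟩
  left_inv C := by ext; simp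
  right_inv C := by ext; simp

/-- An equivalence remains one after cutting. -/
noncomputable def Iso.cutOn (f : G.Iso H) (C : G.CutSet) :
    (G.cutOn C).Iso (H.cutOn (f.cutSetEquiv C)) where
  toEquiv := f.toEquiv
  map_arc := f.map_arc
  map_corner := f.map_corner
  map_side a := by
    have h : f.toEquiv a ∈ (f.cutSetEquiv C).carrier ↔ a ∈ C.carrier := by
      change f.toEquiv.symm (f.toEquiv a) ∈ C.carrier ↔ _
      rw [f.toEquiv.symm_apply_apply]
    by_cases ha : a ∈ C.carrier
    · simp [h, ha, f.map_arc]
    · simp [h, ha, f.map_side]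
  isolated_eq := f.isolated_eq

theorem Iso.stateSum_eq (f : G.Iso H) {φ : PinchedRibbonGraph → R}
    (hφ : ∀ G H : PinchedRibbonGraph, Nonempty (G.Iso H) → φ G = φ H) :
    stateSum φ G = stateSum φ H :=
  Fintype.sum_equiv f.cutSetEquiv _ _ fun C => hφ _ _ ⟨f.cutOn C⟩

theorem Iso.polyR'_eq (f : G.Iso H) (x y z w t : R) :
    G.polyR' x y z w t = H.polyR' x y z w t := by
  rw [polyR'_eq_stateSum, polyR'_eq_stateSum, f.rank_eq]
  exact f.stateSum_eq fun _ _ ⟨g⟩ => g.weight_eq _ _ _ _ _ _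

end PinchedRibbonGraph


/-! ### Vertex, circle and component of a flag; passing around a contracted edge -/

namespace PinchedRibbonGraph

variable {G H : PinchedRibbonGraph}

theorem vertexOf_arc (a : G.Flag) : G.vertexOf (G.arc a) = G.vertexOf a := by
  symm; exact Quot.sound (Or.inl rfl)

theorem vertexOf_corner (a : G.Flag) : G.vertexOf (G.corner a) = G.vertexOf a := by
  symm; exact Quot.sound (Or.inr rfl)

theorem circleOf_side (a : G.Flag) : G.circleOf (G.side a) = G.circleOf a := by
  symm; exact Quot.sound (Or.inr rfl)

theorem circleOf_corner (a : G.Flag) : G.circleOf (G.corner a) = G.circleOf a := by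
  symm; exact Quot.sound (Or.inl rfl)

/-- The component of a flag. -/
def componentOf (G : PinchedRibbonGraph) (a : G.Flag) : G.AttachedComponent := Quot.mk _ a

theorem componentOf_arc (a : G.Flag) : G.componentOf (G.arc a) = G.componentOf a := by
  symm; exact Quot.sound (Or.inl rfl)

theorem componentOf_corner (a : G.Flag) : G.componentOf (G.corner a) = G.componentOf a := by
  symm; exact Quot.sound (Or.inr (Or.inl rfl))

theorem componentOf_side (a : G.Flag) : G.componentOf (G.side a) = G.componentOf a := by
  symm; exact Quot.sound (Or.inr (Or.inr rfl))

theorem componentOf_eq_of_vertexOf {a b : G.Flag} (h : G.vertexOf a = G.vertexOf b) :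
    G.componentOf a = G.componentOf b := by
  refine QuotCount.mk_eq_of_imp ?_ h
  rintro a b (rfl | rfl)
  · exact (componentOf_arc a).symm
  · exact (componentOf_corner a).symm

theorem isLoop_edgeOf_iff {b : G.Flag} {hb : G.side b ≠ G.arc b} :
    G.IsLoop (G.edgeOf b hb) ↔ G.vertexOf b = G.vertexOf (G.side b) := by
  constructor
  · intro h
    exact h _ _ rfl (G.ribbonOf_side b)
  · intro h x y hx hy
    have key : ∀ x, G.ribbonOf x = G.ribbonOf b → G.vertexOf x = G.vertexOf b := by
      intro x hx
      rcases G.ribbonOf_eq_iff.1 hx with rfl | rfl | rfl | rfl <;> simp only [vertexOf_arc, h]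
    exact (key x hx).trans (key y hy).symm

/-! ### Contraction of an edge that is not a loop -/

section Contract

variable {b : G.Flag} {hb : G.side b ≠ G.arc b}

/-- A corner stays on its vertex, and at that vertex a non-loop edge has only the flags `x` and `arc
x`; a corner never fixes a flag. -/
theorem corner_of_ribbonOf_corner (hnl : G.vertexOf b ≠ G.vertexOf (G.side b)) {x : G.Flag}
    (hx : G.ribbonOf x = G.ribbonOf b) (hc : G.ribbonOf (G.corner x) = G.ribbonOf b) :
    G.corner x = G.arc x := by
  have h1 := vertexOf_corner x
  have va := vertexOf_arc (G := G)
  have aa := G.arc_arc; have ss := G.side_side; have as := G.arc_side; have cn := G.corner_ne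
  rw [ribbonOf_eq_iff] at hx hc
  grind

/-- Both ends of the edge through `b` are the only ribbon ends at their vertices. -/
def IsIsolatedEdge (G : PinchedRibbonGraph) (b : G.Flag) : Prop :=
  G.corner b = G.arc b ∧ G.corner (G.side b) = G.arc (G.side b)

-- Along a circle inside the edge every corner coincides with the arc, which forces both end
-- vertices to carry nothing else. Then all four flags lie on that single circle, which contraction
-- turns into an isolated disc.
open Classical in
theorem card_circles_within (hnl : G.vertexOf b ≠ G.vertexOf (G.side b)) :
    Nat.card {c : G.Circle // ∀ a, G.circleOf a = c → G.ribbonOf a = G.ribbonOf b} =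
      if G.IsIsolatedEdge b then 1 else 0 := by
  have aa := G.arc_arc; have ss := G.side_side; have as := G.arc_side
  have cc := G.corner_corner
  split_ifs with hT
  · obtain ⟨hT1, hT2⟩ := hT
    have hcl : ∀ x, G.ribbonOf x = G.ribbonOf b → G.circleOf x = G.circleOf b := by
      intro x hx
      rcases G.ribbonOf_eq_iff.1 hx with rfl | rfl | rfl | rfl
      · rfl
      · rw [← hT1, circleOf_corner]
      · rw [circleOf_side]
      · rw [as, circleOf_side, ← hT1, circleOf_corner]
    let P : G.Circle → Prop := Quot.lift (fun x => G.ribbonOf x = G.ribbonOf b) (by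
      rintro x y (rfl | rfl)
      · simp only [ribbonOf_eq_iff, eq_iff_iff]
        grind
      · rw [G.ribbonOf_side])
    rw [Nat.card_eq_one_iff_unique]
    refine ⟨⟨?_⟩, ⟨⟨G.circleOf b, fun a ha => ?_⟩⟩⟩
    · rintro ⟨⟨x⟩, hx⟩ ⟨⟨y⟩, hy⟩
      exact Subtype.ext ((hcl x (hx x rfl)).trans (hcl y (hy y rfl)).symm)
    · have h1 : P (G.circleOf a) = P (G.circleOf b) := by rw [ha]
      exact h1.mpr rfl
  · rw [Finite.card_eq_zero_iff]
    refine ⟨?_⟩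
    rintro ⟨⟨x⟩, hx⟩
    apply hT
    have h1 : G.ribbonOf x = G.ribbonOf b := hx x rfl
    have c1 : ∀ y, G.circleOf y = G.circleOf x → G.corner y = G.arc y := fun y hy =>
      corner_of_ribbonOf_corner hnl (hx _ hy) (hx _ ((circleOf_corner y).trans hy))
    have c2 := c1 x rfl
    have c3 := c1 (G.side x) (circleOf_side x)
    rw [IsIsolatedEdge]
    rcases G.ribbonOf_eq_iff.1 h1 with rfl | rfl | rfl | rfl <;> grind

theorem contract_isolated (hnl : G.vertexOf b ≠ G.vertexOf (G.side b)) [Decidable (G.IsIsolatedEdge b)] :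
    (G.contract (G.edgeOf b hb)).isolated =
      G.isolated + if G.IsIsolatedEdge b then 1 else 0 := by
  refine congrArg (G.isolated + ·) ((card_circles_within hnl).trans ?_)
  split_ifs <;> rfl

open Classical in
/-- Removing the flags of an edge from the cycles that pass over it along its sides. -/
theorem card_splice (hnl : G.vertexOf b ≠ G.vertexOf (G.side b)) (ρ : G.Flag → G.Flag → Prop) :
    Nat.card (Quot fun x y : G.Flag => y = G.corner x ∨
        (G.ribbonOf x = G.ribbonOf b ∧ y = G.side x) ∨
        (G.ribbonOf x ≠ G.ribbonOf b ∧ G.ribbonOf y ≠ G.ribbonOf b ∧ ρ x y)) =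
      Nat.card (Quot fun x y : {a : G.Flag // G.ribbonOf a ≠ G.ribbonOf b} =>
        y.1 = G.next (G.edgeOf b hb) x.1 ∨ ρ x.1 y.1) + if G.IsIsolatedEdge b then 1 else 0 := by
  have aa := G.arc_arc; have ss := G.side_side; have as := G.arc_side
  have cc := G.corner_corner
  have ra := G.ribbonOf_arc; have rs := G.ribbonOf_side
  have hco := fun x => corner_of_ribbonOf_corner (x := x) hnl
  have hnx : ∀ x, G.next (G.edgeOf b hb) x =
    if G.ribbonOf (G.corner x) = G.ribbonOf b then
      if G.ribbonOf (G.corner (G.side (G.corner x))) = G.ribbonOf b then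
        G.corner (G.side (G.corner (G.side (G.corner x))))
      else G.corner (G.side (G.corner x))
    else G.corner x := fun x => rfl
  set RX := fun x y : G.Flag => y = G.corner x ∨
        (G.ribbonOf x = G.ribbonOf b ∧ y = G.side x) ∨
        (G.ribbonOf x ≠ G.ribbonOf b ∧ G.ribbonOf y ≠ G.ribbonOf b ∧ ρ x y) with hRX
  set RY := fun x y : {a : G.Flag // G.ribbonOf a ≠ G.ribbonOf b} =>
        y.1 = G.next (G.edgeOf b hb) x.1 ∨ ρ x.1 y.1 with hRY
  have m1 : ∀ x, Quot.mk RX (G.corner x) = Quot.mk RX x := fun x => by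
    symm; exact Quot.sound (Or.inl rfl)
  have m2 : ∀ x, G.ribbonOf x = G.ribbonOf b → Quot.mk RX (G.side x) = Quot.mk RX x := fun x hx => by
    symm; exact Quot.sound (Or.inr (Or.inl ⟨hx, rfl⟩))
  have m3 : ∀ x, Quot.mk RX (G.next (G.edgeOf b hb) x) = Quot.mk RX x := by
    intro x
    rw [hnx]
    split_ifs with h1 h2
    · rw [m1, m2 _ h2, m1, m2 _ h1, m1]
    · rw [m1, m2 _ h1, m1]
    · rw [m1]
  have hYX : ∀ x y, RY x y → Quot.mk RX x.1 = Quot.mk RX y.1 := by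
    rintro x y (h | h)
    · rw [h, m3]
    · exact Quot.sound (Or.inr (Or.inr ⟨x.2, y.2, h⟩))
  by_cases hT : G.IsIsolatedEdge b
  · rw [if_pos hT]
    obtain ⟨hT1, hT2⟩ := hT
    have hcl : ∀ x, G.ribbonOf (G.corner x) = G.ribbonOf b ↔ G.ribbonOf x = G.ribbonOf b := by
      simp only [ribbonOf_eq_iff]
      grind
    have hb' : ∀ x, G.ribbonOf x = G.ribbonOf b → Quot.mk RX x = Quot.mk RX b := by
      intro x hx
      rcases G.ribbonOf_eq_iff.1 hx with rfl | rfl | rfl | rfl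
      · rfl
      · rw [← hT1, m1]
      · rw [m2 _ rfl]
      · rw [← hT2, m1, m2 _ rfl]
    -- Here the four flags of the edge form a class of their own, represented by `none`.
    rw [← Finite.card_option]
    refine Nat.card_congr ⟨Quot.lift (fun x => if h : G.ribbonOf x = G.ribbonOf b then none
        else some (Quot.mk RY ⟨x, h⟩)) ?_,
      fun c => c.elim (Quot.mk RX b) (Quot.lift (fun y => Quot.mk RX y.1) hYX), ?_, ?_⟩
    · rintro x y (rfl | ⟨hx, rfl⟩ | ⟨hx, hy, h⟩)
      · by_cases h : G.ribbonOf x = G.ribbonOf b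
        · simp [h, hcl]
        · simp only [h, hcl, dite_false]
          congr 1
          refine Quot.sound (Or.inl ?_)
          simp only [hnx, hcl, h, if_false]
      · simp [hx, rs]
      · simp only [hx, hy, dite_false]
        congr 1
        exact Quot.sound (Or.inr h)
    · rintro ⟨x⟩
      by_cases h : G.ribbonOf x = G.ribbonOf b
      · simp [h, hb']
      · simp [h]
    · rintro (_ | ⟨⟨y, hy⟩⟩)
      · simp
      · simp [hy]
  · rw [if_neg hT, add_zero]
    have hn : ∀ x, G.ribbonOf x = G.ribbonOf b →
        G.ribbonOf (G.next (G.edgeOf b hb) x) ≠ G.ribbonOf b := by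
      intro x hx h
      rw [hnx] at h
      apply hT
      rw [IsIsolatedEdge]
      rcases G.ribbonOf_eq_iff.1 hx with rfl | rfl | rfl | rfl <;> grind
    have key : ∀ x y : {a : G.Flag // G.ribbonOf a ≠ G.ribbonOf b},
        y.1 = G.next (G.edgeOf b hb) x.1 → Quot.mk RY x = Quot.mk RY y :=
      fun x y h => Quot.sound (Or.inl h)
    -- A flag of the edge is pushed along the boundary to a surviving flag. `hn` guarantees that
    -- `next` has left the edge when the edge is not isolated.
    let f : G.Flag → {a : G.Flag // G.ribbonOf a ≠ G.ribbonOf b} := fun x =>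
      if h : G.ribbonOf x = G.ribbonOf b then ⟨_, hn x h⟩ else ⟨x, h⟩
    have f1 : ∀ x, G.ribbonOf x = G.ribbonOf b → (f x).1 = G.next (G.edgeOf b hb) x := by
      intro x h; simp [f, h]
    have f2 : ∀ x (h : G.ribbonOf x ≠ G.ribbonOf b), f x = ⟨x, h⟩ := by
      intro x h; simp [f, h]
    refine QuotCount.card_congr f Subtype.val ?_ hYX ?_ ?_
    · rintro x y (rfl | ⟨hx, rfl⟩ | ⟨hx, hy, h⟩)
      · by_cases h : G.ribbonOf x = G.ribbonOf b
        · by_cases h2 : G.ribbonOf (G.corner x) = G.ribbonOf b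
          · symm
            apply key
            have := hco x h h2
            have := f1 x h
            have := f1 _ h2
            have := (f (G.corner x)).2
            grind
          · congr 1
            apply Subtype.ext
            rw [f1 x h, f2 _ h2, hnx]
            simp [h2]
        · by_cases h2 : G.ribbonOf (G.corner x) = G.ribbonOf b
          · congr 1
            apply Subtype.ext
            rw [f1 _ h2, f2 _ h, hnx]
            simp [h, cc]
          · apply key
            rw [f2 _ h2, f2 _ h, hnx]
            simp [h2]
      · apply key
        have h2 : G.ribbonOf (G.side x) = G.ribbonOf b := by rw [rs, hx]
        rw [f1 x hx, f1 _ h2]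
        have c1 := hco x hx
        have c2 := hco _ h2
        have c3 := hn x hx
        have c4 := hn _ h2
        grind
      · rw [f2 _ hx, f2 _ hy]
        exact Quot.sound (Or.inr h)
    · intro x
      by_cases h : G.ribbonOf x = G.ribbonOf b
      · rw [f1 x h, m3]
      · rw [f2 x h]
    · intro y
      rw [f2 _ y.2]

end Contract

end PinchedRibbonGraph


/-! ### Effect of contraction on the numerical invariants and on orientability -/

namespace PinchedRibbonGraph

variable {G H : PinchedRibbonGraph}

theorem card_subtype_split {X : Type*} [Finite X] (p Z : X → Prop) :
    Nat.card {a // p a} = Nat.card {a // p a ∧ Z a} + Nat.card {a // p a ∧ ¬ Z a} := by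
  classical
  have := Fintype.ofFinite X
  simp only [Nat.card_eq_fintype_card, Fintype.card_subtype, ← Finset.filter_filter]
  exact (Finset.card_filter_add_card_filter_not _).symm

theorem card_ribbonOf_eq {b : G.Flag} (hb : G.side b ≠ G.arc b) :
    Nat.card {a // G.ribbonOf a = G.ribbonOf b} = 4 := by
  classical
  have aa := G.arc_arc; have ss := G.side_side; have as := G.arc_side
  have an := G.arc_ne; have sn := G.side_ne
  rw [Nat.subtype_card ({b, G.arc b, G.side b, G.arc (G.side b)} : Finset G.Flag)
    (fun x => by rw [ribbonOf_eq_iff]; simp)]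
  rw [Finset.card_insert_of_notMem, Finset.card_insert_of_notMem, Finset.card_insert_of_notMem,
    Finset.card_singleton]
  all_goals simp only [Finset.mem_insert, Finset.mem_singleton]
  all_goals grind

theorem side_ne_arc_of_ribbonOf {b : G.Flag} (hb : G.side b ≠ G.arc b) {a : G.Flag}
    (h : G.ribbonOf a = G.ribbonOf b) : G.side a ≠ G.arc a :=
  G.edge_side_ne_arc (G.edgeOf b hb) h

theorem card_edge_off {b : G.Flag} (hb : G.side b ≠ G.arc b) :
    Nat.card {a // G.side a ≠ G.arc a} =
      Nat.card {a // G.side a ≠ G.arc a ∧ G.ribbonOf a ≠ G.ribbonOf b} + 4 := by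
  rw [card_subtype_split _ fun a => G.ribbonOf a = G.ribbonOf b, add_comm, ← card_ribbonOf_eq hb]
  congr 1
  exact Nat.card_congr (Equiv.subtypeEquivRight fun a =>
    ⟨fun h => h.2, fun h => ⟨side_ne_arc_of_ribbonOf hb h, h⟩⟩)

section Contract

variable {b : G.Flag} {hb : G.side b ≠ G.arc b}

theorem contract_numEdges : (G.contract (G.edgeOf b hb)).numEdges + 1 = G.numEdges := by
  have h1 := four_mul_numEdges (G.contract (G.edgeOf b hb))
  have h2 := four_mul_numEdges G
  rw [card_edge_off hb] at h2
  have h3 : Nat.card {a : (G.contract (G.edgeOf b hb)).Flag //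
      (G.contract (G.edgeOf b hb)).side a ≠ (G.contract (G.edgeOf b hb)).arc a} =
      Nat.card {a // G.side a ≠ G.arc a ∧ G.ribbonOf a ≠ G.ribbonOf b} := by
    refine Nat.card_congr ⟨fun a => ⟨a.1.1, fun h => a.2 (Subtype.ext h), a.1.2⟩,
      fun a => ⟨⟨a.1, a.2.2⟩, fun h => a.2.1 (congrArg Subtype.val h)⟩, fun _ => rfl, fun _ => rfl⟩
  omega

theorem contract_numHalfRibbons :
    (G.contract (G.edgeOf b hb)).numHalfRibbons = G.numHalfRibbons := by
  have h1 := two_mul_numHalfRibbons (G.contract (G.edgeOf b hb))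
  have h2 := two_mul_numHalfRibbons G
  have h3 : Nat.card {a : (G.contract (G.edgeOf b hb)).Flag //
      (G.contract (G.edgeOf b hb)).side a = (G.contract (G.edgeOf b hb)).arc a} =
      Nat.card {a // G.side a = G.arc a} := by
    refine Nat.card_congr ⟨fun a => ⟨a.1.1, congrArg Subtype.val a.2⟩,
      fun a => ⟨⟨a.1, fun h => side_ne_arc_of_ribbonOf hb h a.2⟩, Subtype.ext a.2⟩,
      fun _ => rfl, fun _ => rfl⟩
  omega

/-- Boundary circles follow sides on the edge as well as off it, so they are merely spliced. A
circle lost with all its flags comes back as an isolated vertex. -/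
theorem contract_numCircles (hnl : G.vertexOf b ≠ G.vertexOf (G.side b)) :
    (G.contract (G.edgeOf b hb)).numCircles = G.numCircles := by
  classical
  rw [numCircles, numCircles, contract_isolated hnl]
  have h := card_splice (hb := hb) hnl (fun x y => y = G.side x)
  have h1 : Nat.card G.Circle = Nat.card (Quot fun x y : G.Flag => y = G.corner x ∨
        (G.ribbonOf x = G.ribbonOf b ∧ y = G.side x) ∨
        (G.ribbonOf x ≠ G.ribbonOf b ∧ G.ribbonOf y ≠ G.ribbonOf b ∧ y = G.side x)) := by
    refine QuotCount.card_eq_of_mutual ?_ ?_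
    · rintro x y (h | rfl)
      · exact Quot.sound (Or.inl h)
      · by_cases hx : G.ribbonOf x = G.ribbonOf b
        · exact Quot.sound (Or.inr (Or.inl ⟨hx, rfl⟩))
        · exact Quot.sound (Or.inr (Or.inr ⟨hx, by rwa [G.ribbonOf_side], rfl⟩))
    · rintro x y (h | ⟨-, h⟩ | ⟨-, -, h⟩)
      · exact Quot.sound (Or.inl h)
      · exact Quot.sound (Or.inr h)
      · exact Quot.sound (Or.inr h)
  have h2 : Nat.card (G.contract (G.edgeOf b hb)).Circle =
      Nat.card (Quot fun x y : {a : G.Flag // G.ribbonOf a ≠ G.ribbonOf b} =>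
        y.1 = G.next (G.edgeOf b hb) x.1 ∨ y.1 = G.side x.1) := by
    refine QuotCount.card_eq_of_mutual ?_ ?_
    · rintro x y (rfl | rfl)
      · exact Quot.sound (Or.inl rfl)
      · exact Quot.sound (Or.inr rfl)
    · rintro x y (h | h)
      · exact Quot.sound (Or.inl (Subtype.ext h))
      · exact Quot.sound (Or.inr (Subtype.ext h))
  omega

open Classical in
/-- The two ends of an edge exchange partners. -/
theorem switch_arc : QuotCount.Switch G.arc
    (fun x => if G.ribbonOf x = G.ribbonOf b then G.side x else G.arc x) b (G.side b) where
  invol := G.arc_arc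
  invol' x := by
    by_cases h : G.ribbonOf x = G.ribbonOf b <;>
      simp [h, G.ribbonOf_side, G.ribbonOf_arc, G.side_side, G.arc_arc]
  left := by simp
  right := by simp [G.ribbonOf_arc, G.arc_side]
  off x h1 h2 h3 h4 := by
    rw [if_neg]
    rw [ribbonOf_eq_iff]
    tauto

-- Replacing the arcs at both ends of a non-loop edge by its sides switches partners between two
-- different vertex circles, so `QuotCount.Switch.mk_eq` applies: what is left of the circle of `b`
-- still leads to `arc b`.
open Classical in
theorem mk_corner_arcδ_eq (hnl : G.vertexOf b ≠ G.vertexOf (G.side b)) :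
    Quot.mk (fun x y : G.Flag => y = G.corner x ∨
      y = if G.ribbonOf x = G.ribbonOf b then G.side x else G.arc x) b =
    Quot.mk (fun x y : G.Flag => y = G.corner x ∨
      y = if G.ribbonOf x = G.ribbonOf b then G.side x else G.arc x) (G.arc b) := by
  refine (switch_arc (b := b)).mk_eq G.corner_corner G.corner_ne G.arc_ne ?_
  intro h
  apply hnl
  exact QuotCount.mk_eq_of_imp (fun x y h => Quot.sound h.symm) h

/-- The vertex circles of the contraction arise in two moves: the circles at the two ends merge into
the boundary of their union with the edge (`switch_arc`), and then the flags of the edge are spliced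
out. -/
theorem contract_numVertices (hnl : G.vertexOf b ≠ G.vertexOf (G.side b)) :
    (G.contract (G.edgeOf b hb)).numVertices + 1 = G.numVertices := by
  classical
  rw [numVertices, numVertices, contract_isolated hnl]
  have h := card_splice (hb := hb) hnl (fun x y => y = G.arc x)
  have h1 : Nat.card (Quot fun x y : G.Flag => y = G.corner x ∨
      y = if G.ribbonOf x = G.ribbonOf b then G.side x else G.arc x) =
      Nat.card (Quot fun x y : G.Flag => y = G.corner x ∨
        (G.ribbonOf x = G.ribbonOf b ∧ y = G.side x) ∨
        (G.ribbonOf x ≠ G.ribbonOf b ∧ G.ribbonOf y ≠ G.ribbonOf b ∧ y = G.arc x)) := by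
    refine QuotCount.card_eq_of_mutual ?_ ?_
    · rintro x y (h | h)
      · exact Quot.sound (Or.inl h)
      · split_ifs at h with hx
        · exact Quot.sound (Or.inr (Or.inl ⟨hx, h⟩))
        · exact Quot.sound (Or.inr (Or.inr ⟨hx, by rwa [h, G.ribbonOf_arc], h⟩))
    · rintro x y (h | ⟨h1, h⟩ | ⟨h1, -, h⟩)
      · exact Quot.sound (Or.inl h)
      · exact Quot.sound (Or.inr (by rw [if_pos h1, h]))
      · exact Quot.sound (Or.inr (by rw [if_neg h1, h]))
  have h2 : Nat.card (G.contract (G.edgeOf b hb)).AttachedVertex =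
      Nat.card (Quot fun x y : {a : G.Flag // G.ribbonOf a ≠ G.ribbonOf b} =>
        y.1 = G.next (G.edgeOf b hb) x.1 ∨ y.1 = G.arc x.1) := by
    refine QuotCount.card_eq_of_mutual ?_ ?_
    · rintro x y (rfl | rfl)
      · exact Quot.sound (Or.inr rfl)
      · exact Quot.sound (Or.inl rfl)
    · rintro x y (h | h)
      · exact Quot.sound (Or.inr (Subtype.ext h))
      · exact Quot.sound (Or.inl (Subtype.ext h))
  have h3 : Nat.card G.AttachedVertex = Nat.card (Quot fun x y : G.Flag => y = G.corner x ∨ y = G.arc x) :=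
    QuotCount.card_eq_of_mutual (fun x y h => Quot.sound h.symm) (fun x y h => Quot.sound h.symm)
  have h4 := (switch_arc (b := b)).card_merge (fun x y => y = G.corner x) (fun h => hnl
    (QuotCount.mk_eq_of_imp (fun x y h => Quot.sound h.symm) h)) (mk_corner_arcδ_eq hnl)
  omega

/-- The arcs of the edge are not needed for connectedness: `b` and `arc b` stay joined by the merged
vertex circle. With them dropped, `card_splice` applies. -/
theorem contract_numComponents (hnl : G.vertexOf b ≠ G.vertexOf (G.side b)) :
    (G.contract (G.edgeOf b hb)).numComponents = G.numComponents := by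
  classical
  rw [numComponents, numComponents, contract_isolated hnl]
  have h := card_splice (hb := hb) hnl (fun x y => y = G.arc x ∨ y = G.side x)
  have h1 : Nat.card G.AttachedComponent = Nat.card (Quot fun x y : G.Flag => y = G.corner x ∨
        (G.ribbonOf x = G.ribbonOf b ∧ y = G.side x) ∨
        (G.ribbonOf x ≠ G.ribbonOf b ∧ G.ribbonOf y ≠ G.ribbonOf b ∧ (y = G.arc x ∨ y = G.side x))) := by
    set s := fun x y : G.Flag => y = G.corner x ∨
        (G.ribbonOf x = G.ribbonOf b ∧ y = G.side x) ∨
        (G.ribbonOf x ≠ G.ribbonOf b ∧ G.ribbonOf y ≠ G.ribbonOf b ∧ (y = G.arc x ∨ y = G.side x))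
    have hs : ∀ x, Quot.mk s x = Quot.mk s (G.side x) := by
      intro x
      by_cases hx : G.ribbonOf x = G.ribbonOf b
      · exact Quot.sound (Or.inr (Or.inl ⟨hx, rfl⟩))
      · exact Quot.sound (Or.inr (Or.inr ⟨hx, by rwa [G.ribbonOf_side], Or.inr rfl⟩))
    have hba : Quot.mk s b = Quot.mk s (G.arc b) := by
      refine QuotCount.mk_eq_of_imp ?_ (mk_corner_arcδ_eq hnl)
      rintro x y (h | h)
      · exact Quot.sound (Or.inl h)
      · split_ifs at h with hx
        · rw [h]; exact hs x
        · exact Quot.sound (Or.inr (Or.inr ⟨hx, by rwa [h, G.ribbonOf_arc], Or.inl h⟩))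
    refine QuotCount.card_eq_of_mutual ?_ ?_
    · rintro x y (rfl | h | rfl)
      · by_cases hx : G.ribbonOf x = G.ribbonOf b
        · rcases G.ribbonOf_eq_iff.1 hx with rfl | rfl | rfl | rfl
          · exact hba
          · rw [G.arc_arc, hba]
          · rw [← hs, G.arc_side, ← hs, hba]
          · rw [G.arc_arc, G.arc_side, ← hs, ← hs, hba]
        · exact Quot.sound (Or.inr (Or.inr ⟨hx, by rwa [G.ribbonOf_arc], Or.inl rfl⟩))
      · exact Quot.sound (Or.inl h)
      · exact hs x
    · rintro x y (h | ⟨-, h⟩ | ⟨-, -, h | h⟩)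
      · exact Quot.sound (Or.inr (Or.inl h))
      · exact Quot.sound (Or.inr (Or.inr h))
      · exact Quot.sound (Or.inl h)
      · exact Quot.sound (Or.inr (Or.inr h))
  have h2 : Nat.card (G.contract (G.edgeOf b hb)).AttachedComponent =
      Nat.card (Quot fun x y : {a : G.Flag // G.ribbonOf a ≠ G.ribbonOf b} =>
        y.1 = G.next (G.edgeOf b hb) x.1 ∨ y.1 = G.arc x.1 ∨ y.1 = G.side x.1) := by
    refine QuotCount.card_eq_of_mutual ?_ ?_
    · rintro x y (rfl | rfl | rfl)
      · exact Quot.sound (Or.inr (Or.inl rfl))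
      · exact Quot.sound (Or.inl rfl)
      · exact Quot.sound (Or.inr (Or.inr rfl))
    · rintro x y (h | h | h)
      · exact Quot.sound (Or.inr (Or.inl (Subtype.ext h)))
      · exact Quot.sound (Or.inl (Subtype.ext h))
      · exact Quot.sound (Or.inr (Or.inr (Subtype.ext h)))
  omega

/-- A colouring of the contraction extends over the edge so that it alternates along corners and
sides. At the arcs of the edge alternation is automatic, by counting signs on the vertex circle of
`b`, to which only one end of the edge belongs. -/
theorem contract_orientable (hnl : G.vertexOf b ≠ G.vertexOf (G.side b)) :
    (G.contract (G.edgeOf b hb)).Orientable ↔ G.Orientable := by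
  classical
  have aa := G.arc_arc; have ss := G.side_side; have as := G.arc_side
  have cc := G.corner_corner
  have ra := G.ribbonOf_arc; have rs := G.ribbonOf_side
  have hco := fun x => corner_of_ribbonOf_corner (x := x) hnl
  have hnx : ∀ x, G.next (G.edgeOf b hb) x =
    if G.ribbonOf (G.corner x) = G.ribbonOf b then
      if G.ribbonOf (G.corner (G.side (G.corner x))) = G.ribbonOf b then
        G.corner (G.side (G.corner (G.side (G.corner x))))
      else G.corner (G.side (G.corner x))
    else G.corner x := fun x => rfl
  have nn1 : (∀ x, G.ribbonOf x = G.ribbonOf b →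
      G.ribbonOf (G.next (G.edgeOf b hb) x) ≠ G.ribbonOf b) → ∀ x, G.ribbonOf x = G.ribbonOf b →
      G.ribbonOf (G.corner x) = G.ribbonOf b →
      G.next (G.edgeOf b hb) x = G.next (G.edgeOf b hb) (G.next (G.edgeOf b hb) (G.corner x)) := by
    intro hn x h h2
    have := hco x h h2
    have := hn x h
    have := hn _ h2
    clear hn
    grind
  have nn2 : (∀ x, G.ribbonOf x = G.ribbonOf b →
      G.ribbonOf (G.next (G.edgeOf b hb) x) ≠ G.ribbonOf b) → ∀ x, G.ribbonOf x = G.ribbonOf b →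
      G.next (G.edgeOf b hb) x = G.next (G.edgeOf b hb) (G.next (G.edgeOf b hb) (G.side x)) := by
    intro hn x h
    have h2 : G.ribbonOf (G.side x) = G.ribbonOf b := by rw [rs, h]
    have c1 := hco x h
    have c2 := hco _ h2
    have c3 := hn x h
    have c4 := hn _ h2
    clear hn nn1
    grind
  constructor
  · rintro ⟨o, ho⟩
    have ho1 : ∀ a : {a // G.ribbonOf a ≠ G.ribbonOf b},
      o ⟨G.arc a.1, (ra a.1).trans_ne a.2⟩ = !o a := fun a => (ho a).1
    have ho2 : ∀ a : {a // G.ribbonOf a ≠ G.ribbonOf b},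
      o ⟨G.next (G.edgeOf b hb) a.1, G.next_notMem _ a.2⟩ = !o a := fun a => (ho a).2.1
    have ho3 : ∀ a : {a // G.ribbonOf a ≠ G.ribbonOf b},
      o ⟨G.side a.1, (rs a.1).trans_ne a.2⟩ = !o a := fun a => (ho a).2.2
    clear ho
    let e : G.Flag → Bool := fun x => if h : G.ribbonOf x ≠ G.ribbonOf b then o ⟨x, h⟩ else false
    have he0 : ∀ x h, e x = o ⟨x, h⟩ := fun x h => dif_pos h
    have he1 : ∀ x, G.ribbonOf x ≠ G.ribbonOf b → e (G.arc x) = !e x := by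
      intro x h
      have h2 : G.ribbonOf (G.arc x) ≠ G.ribbonOf b := by rwa [ra]
      exact (he0 _ h2).trans ((ho1 ⟨x, h⟩).trans (congrArg (!·) (he0 x h).symm))
    have he2 : ∀ x, G.ribbonOf x ≠ G.ribbonOf b → e (G.next (G.edgeOf b hb) x) = !e x := by
      intro x h
      have h2 : G.ribbonOf (G.next (G.edgeOf b hb) x) ≠ G.ribbonOf b := G.next_notMem _ h
      exact (he0 _ h2).trans ((ho2 ⟨x, h⟩).trans (congrArg (!·) (he0 x h).symm))
    have he3 : ∀ x, G.ribbonOf x ≠ G.ribbonOf b → e (G.side x) = !e x := by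
      intro x h
      have h2 : G.ribbonOf (G.side x) ≠ G.ribbonOf b := by rwa [rs]
      exact (he0 _ h2).trans ((ho3 ⟨x, h⟩).trans (congrArg (!·) (he0 x h).symm))
    clear he0
    clear_value e
    clear ho1 ho2 ho3
    obtain ⟨o', k1, k2, k3⟩ : ∃ o' : G.Flag → Bool,
        (∀ x, G.ribbonOf x ≠ G.ribbonOf b → o' (G.arc x) = !o' x) ∧
        (∀ x, o' (G.corner x) = !o' x) ∧ (∀ x, o' (G.side x) = !o' x) := by
      by_cases hT : G.IsIsolatedEdge b
      · obtain ⟨hT1, hT2⟩ := hT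
        have sn := G.side_ne; have an := G.arc_ne
        have hcl : ∀ x, G.ribbonOf (G.corner x) = G.ribbonOf b ↔ G.ribbonOf x = G.ribbonOf b := by
          simp only [ribbonOf_eq_iff]
          grind
        -- The isolated edge with its two discs is a component of its own and is coloured by hand.
        refine ⟨fun x => if G.ribbonOf x = G.ribbonOf b then
          decide (x = b ∨ x = G.arc (G.side b)) else e x, ?_, ?_, ?_⟩
        · intro x h
          simp [h, ra, he1]
        · intro x
          by_cases h : G.ribbonOf x = G.ribbonOf b
          · simp only [h, hcl, if_true]
            rw [ribbonOf_eq_iff] at h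
            grind
          · have := he2 x h
            rw [hnx] at this
            simp only [hcl, h, if_false] at this ⊢
            exact this
        · intro x
          by_cases h : G.ribbonOf x = G.ribbonOf b
          · simp only [h, rs, if_true]
            rw [ribbonOf_eq_iff] at h
            grind
          · simp [h, rs, he3]
      · have hn : ∀ x, G.ribbonOf x = G.ribbonOf b →
            G.ribbonOf (G.next (G.edgeOf b hb) x) ≠ G.ribbonOf b := by
          intro x hx h
          rw [hnx] at h
          apply hT
          rw [IsIsolatedEdge]
          rcases G.ribbonOf_eq_iff.1 hx with rfl | rfl | rfl | rfl <;> grind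
        have key : ∀ x y, G.ribbonOf x ≠ G.ribbonOf b →
            y = G.next (G.edgeOf b hb) x → e y = !e x := by
          rintro x y h rfl
          exact he2 x h
        -- A flag of the edge gets the colour opposite to that of the surviving flag that follows it
        -- on the boundary.
        refine ⟨fun x => if G.ribbonOf x = G.ribbonOf b then
          !e (G.next (G.edgeOf b hb) x) else e x, ?_, ?_, ?_⟩
        · intro x h
          simp [h, ra, he1]
        · intro x
          by_cases h : G.ribbonOf x = G.ribbonOf b
          · by_cases h2 : G.ribbonOf (G.corner x) = G.ribbonOf b
            · simp only [h, h2, if_true, Bool.not_not]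
              have c1 := key (G.next (G.edgeOf b hb) (G.corner x)) (G.next (G.edgeOf b hb) x)
                (hn _ h2) (nn1 hn x h h2)
              rw [c1]
            · simp only [h, h2, if_true, if_false, Bool.not_not]
              rw [hnx, if_neg h2]
          · by_cases h2 : G.ribbonOf (G.corner x) = G.ribbonOf b
            · simp only [h, h2, if_true, if_false]
              rw [hnx, cc, if_neg h]
            · simp only [h, h2, if_false]
              exact key _ _ h (by rw [hnx, if_neg h2])
        · intro x
          by_cases h : G.ribbonOf x = G.ribbonOf b
          · have h2 : G.ribbonOf (G.side x) = G.ribbonOf b := by rw [rs, h]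
            simp only [h, h2, if_true, Bool.not_not]
            have c1 := key (G.next (G.edgeOf b hb) (G.side x)) (G.next (G.edgeOf b hb) x)
              (hn _ h2) (nn2 hn x h)
            rw [c1]
          · simp [h, rs, he3]
    have := Fintype.ofFinite G.Flag
    have hkey : o' (G.arc b) = !o' b := by
      refine QuotCount.alternates_of_alternates
        (S := Finset.univ.filter fun x => G.vertexOf x = G.vertexOf b) (σ := G.corner) (κ := G.arc)
        o' b (by simp) ?_ ?_ cc G.corner_ne aa G.arc_ne (fun a _ => k2 a) ?_
      · intro a; simp [vertexOf_corner]
      · intro a; simp [vertexOf_arc]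
      · intro a ha h1 h2
        apply k1
        rw [Ne, ribbonOf_eq_iff]
        rintro (h | h | h | h)
        · exact h1 h
        · exact h2 h
        · apply hnl; simpa [h, eq_comm] using ha
        · apply hnl; simpa [h, vertexOf_arc, eq_comm] using ha
    refine ⟨o', fun x => ⟨?_, k2 x, k3 x⟩⟩
    by_cases h : G.ribbonOf x = G.ribbonOf b
    · rcases G.ribbonOf_eq_iff.1 h with rfl | rfl | rfl | rfl
      · exact hkey
      · rw [aa, hkey, Bool.not_not]
      · rw [as, k3, k3, hkey]
      · rw [aa, as, k3, k3, hkey, Bool.not_not]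
    · exact k1 x h
  · rintro ⟨o, ho⟩
    refine ⟨fun x => o x.1, fun x => ⟨(ho _).1, ?_, (ho _).2.2⟩⟩
    change o (G.next (G.edgeOf b hb) x.1) = _
    rw [hnx]
    split_ifs <;> simp [ho]

theorem contract_orientParam (hnl : G.vertexOf b ≠ G.vertexOf (G.side b)) :
    (G.contract (G.edgeOf b hb)).orientParam = G.orientParam := by
  unfold orientParam
  by_cases h : G.Orientable
  · rw [if_pos h, if_pos ((contract_orientable hnl).2 h)]
  · rw [if_neg h, if_neg (mt (contract_orientable hnl).1 h)]

end Contract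

end PinchedRibbonGraph


namespace PinchedRibbonGraph

variable {G H : PinchedRibbonGraph}

/-! ### Cutting one edge -/

theorem cut_side_of_eq {b : G.Flag} (hb : G.side b ≠ G.arc b) {a : G.Flag}
    (h : G.ribbonOf a = G.ribbonOf b) : (G.cut (G.edgeOf b hb)).side a = G.arc a :=
  if_pos ⟨G.edgeOf b hb, rfl, h.symm⟩

theorem cut_side_of_ne {b : G.Flag} (hb : G.side b ≠ G.arc b) {a : G.Flag}
    (h : G.ribbonOf a ≠ G.ribbonOf b) : (G.cut (G.edgeOf b hb)).side a = G.side a :=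
  if_neg (by rintro ⟨_, rfl, h'⟩; exact h h'.symm)

theorem numComponents_le_cutOn (C : G.CutSet) : G.numComponents ≤ (G.cutOn C).numComponents := by
  refine Nat.add_le_add_right (QuotCount.card_le_of_imp ?_) _
  rintro a b (h | h | h)
  · exact Quot.sound (Or.inl h)
  · exact Quot.sound (Or.inr (Or.inl h))
  · by_cases ha : a ∈ C.carrier
    · rw [cutOn_side_of_mem ha] at h
      exact Quot.sound (Or.inl h)
    · rw [cutOn_side_of_notMem ha] at h
      exact Quot.sound (Or.inr (Or.inr h))

theorem numComponents_le_numVertices (G : PinchedRibbonGraph) : G.numComponents ≤ G.numVertices := by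
  refine Nat.add_le_add_right (QuotCount.card_le_of_imp ?_) _
  rintro a b (h | h)
  · exact Quot.sound (Or.inl h)
  · exact Quot.sound (Or.inr (Or.inl h))

section Cut

variable {b : G.Flag} {hb : G.side b ≠ G.arc b}

theorem cut_numVertices (e : G.Edge) : (G.cut e).numVertices = G.numVertices := rfl

theorem cut_numEdges : (G.cut (G.edgeOf b hb)).numEdges + 1 = G.numEdges := by
  have h1 := four_mul_numEdges (G.cut (G.edgeOf b hb))
  have h2 := four_mul_numEdges G
  rw [card_edge_off hb] at h2
  have h3 : Nat.card {a : (G.cut (G.edgeOf b hb)).Flag //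
      (G.cut (G.edgeOf b hb)).side a ≠ (G.cut (G.edgeOf b hb)).arc a} =
      Nat.card {a // G.side a ≠ G.arc a ∧ G.ribbonOf a ≠ G.ribbonOf b} := by
    refine Nat.card_congr (Equiv.subtypeEquiv (Equiv.refl G.Flag) fun a : G.Flag => ?_)
    by_cases h : G.ribbonOf a = G.ribbonOf b
    · exact ⟨fun h' => (h' (cut_side_of_eq hb h)).elim, fun h' => (h'.2 h).elim⟩
    · exact ⟨fun h' => ⟨fun h2 => h' ((cut_side_of_ne hb h).trans h2), h⟩,
        fun h' h2 => h'.1 ((cut_side_of_ne hb h).symm.trans h2)⟩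
  omega

theorem cut_numHalfRibbons :
    (G.cut (G.edgeOf b hb)).numHalfRibbons = G.numHalfRibbons + 2 := by
  have h1 := two_mul_numHalfRibbons (G.cut (G.edgeOf b hb))
  have h2 := two_mul_numHalfRibbons G
  have h4 := card_ribbonOf_eq hb
  have h7 := card_subtype_split (fun a : G.Flag => (G.cut (G.edgeOf b hb)).side a = G.arc a)
    fun a => G.ribbonOf a = G.ribbonOf b
  have h5 : Nat.card {a : G.Flag // (G.cut (G.edgeOf b hb)).side a = G.arc a ∧
      G.ribbonOf a = G.ribbonOf b} = Nat.card {a // G.ribbonOf a = G.ribbonOf b} := by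
    refine Nat.card_congr (Equiv.subtypeEquivRight fun a : G.Flag => ?_)
    exact ⟨fun h => h.2, fun h => ⟨cut_side_of_eq hb h, h⟩⟩
  have h6 : Nat.card {a : G.Flag // (G.cut (G.edgeOf b hb)).side a = G.arc a ∧
      ¬ G.ribbonOf a = G.ribbonOf b} = Nat.card {a // G.side a = G.arc a} := by
    refine Nat.card_congr (Equiv.subtypeEquivRight fun a : G.Flag => ?_)
    constructor
    · rintro ⟨h, h'⟩
      exact (cut_side_of_ne hb h').symm.trans h
    · intro h
      have h' : ¬ G.ribbonOf a = G.ribbonOf b := fun h' => side_ne_arc_of_ribbonOf hb h' h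
      exact ⟨(cut_side_of_ne hb h').trans h, h'⟩
  change 2 * _ = Nat.card {a : G.Flag // (G.cut (G.edgeOf b hb)).side a = G.arc a} at h1
  omega

/-- Restoring a cut edge exchanges partners between its two half-ribbons: each of these pairs its
two flags with each other, whereas the edge pairs flags of opposite ends. -/
theorem switch_side : QuotCount.Switch (X := G.Flag) (G.cut (G.edgeOf b hb)).side G.side b (G.side b) where
  invol := (G.cut (G.edgeOf b hb)).side_side
  invol' := G.side_side
  left := rfl
  right := by
    rw [cut_side_of_eq hb rfl, cut_side_of_eq hb (G.ribbonOf_side b), G.arc_side]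
  off x h1 h2 h3 h4 := by
    rw [cut_side_of_eq hb rfl] at h3
    rw [cut_side_of_eq hb (G.ribbonOf_side b)] at h4
    refine (cut_side_of_ne hb fun h => ?_).symm
    rcases G.ribbonOf_eq_iff.1 h with h | h | h | h <;> contradiction

theorem numCircles_le_cut : G.numCircles ≤ (G.cut (G.edgeOf b hb)).numCircles + 1 := by
  have h : Nat.card G.Circle ≤ Nat.card (G.cut (G.edgeOf b hb)).Circle + 1 :=
    (switch_side (hb := hb)).card_le (fun x y => y = G.corner x)
  have h2 : (G.cut (G.edgeOf b hb)).isolated = G.isolated := rfl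
  unfold numCircles
  omega

/-- The circles through the two half-ribbons lie in different components, hence are distinct, and
restoring the edge merges them. -/
theorem cut_numCircles (h : (G.cut (G.edgeOf b hb)).componentOf b ≠
    (G.cut (G.edgeOf b hb)).componentOf (G.side b)) :
    (G.cut (G.edgeOf b hb)).numCircles = G.numCircles + 1 := by
  have h0 : Quot.mk (fun x y : G.Flag => y = G.corner x ∨ y = (G.cut (G.edgeOf b hb)).side x) b ≠
      Quot.mk _ (G.side b) := by
    intro h'
    refine h (QuotCount.mk_eq_of_imp ?_ h')
    rintro x y (h | h)
    · exact Quot.sound (Or.inr (Or.inl h))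
    · exact Quot.sound (Or.inr (Or.inr h))
  have h1 := (switch_side (hb := hb)).mk_eq (σ := G.corner) G.corner_corner G.corner_ne
    (G.cut (G.edgeOf b hb)).side_ne h0
  have h3 : Nat.card G.Circle + 1 = Nat.card (G.cut (G.edgeOf b hb)).Circle :=
    (switch_side (hb := hb)).card_merge (fun x y => y = G.corner x) h0 h1
  have h2 : (G.cut (G.edgeOf b hb)).isolated = G.isolated := rfl
  unfold numCircles
  omega

theorem card_component_eq (G : PinchedRibbonGraph) : Nat.card G.AttachedComponent =
    Nat.card (Quot fun x y : G.Flag => (y = G.arc x ∨ y = G.corner x) ∨ y = G.side x) :=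
  QuotCount.card_eq_of_mutual (fun _ _ h => Quot.sound (or_assoc.2 h))
    (fun _ _ h => Quot.sound (or_assoc.1 h))

theorem cut_numComponents_of_ne (h : (G.cut (G.edgeOf b hb)).componentOf b ≠
    (G.cut (G.edgeOf b hb)).componentOf (G.side b)) :
    (G.cut (G.edgeOf b hb)).numComponents = G.numComponents + 1 := by
  have h3 : Nat.card (Quot fun x y : G.Flag => (y = G.arc x ∨ y = G.corner x) ∨ y = G.side x) + 1 =
      Nat.card (Quot fun x y : G.Flag => (y = G.arc x ∨ y = G.corner x) ∨
        y = (G.cut (G.edgeOf b hb)).side x) := by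
    refine (switch_side (hb := hb)).card_merge (fun x y => y = G.arc x ∨ y = G.corner x) ?_ ?_
    · intro h'
      exact h (QuotCount.mk_eq_of_imp (fun _ _ h => Quot.sound (or_assoc.1 h)) h')
    · rw [cut_side_of_eq hb rfl]
      exact Quot.sound (Or.inl (Or.inl rfl))
  have h4 := card_component_eq G
  have h5 : Nat.card (G.cut (G.edgeOf b hb)).AttachedComponent =
    Nat.card (Quot fun x y : G.Flag => (y = G.arc x ∨ y = G.corner x) ∨
        y = (G.cut (G.edgeOf b hb)).side x) := card_component_eq _
  have h2 : (G.cut (G.edgeOf b hb)).isolated = G.isolated := rfl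
  unfold numComponents
  omega

theorem cut_numComponents_of_eq (h : (G.cut (G.edgeOf b hb)).componentOf b =
    (G.cut (G.edgeOf b hb)).componentOf (G.side b)) :
    (G.cut (G.edgeOf b hb)).numComponents = G.numComponents := by
  have ca := componentOf_arc (G := G.cut (G.edgeOf b hb))
  have cs := componentOf_side (G := G.cut (G.edgeOf b hb))
  refine congrArg (· + G.isolated) (QuotCount.card_eq_of_mutual ?_ ?_)
  · intro (x : G.Flag) (y : G.Flag)
    rintro (h' | h' | h')
    · exact Quot.sound (Or.inl h')
    · exact Quot.sound (Or.inr (Or.inl h'))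
    · by_cases hx : G.ribbonOf x = G.ribbonOf b
      · exact Quot.sound (Or.inl (h'.trans (cut_side_of_eq hb hx)))
      · exact Quot.sound (Or.inr (Or.inr (h'.trans (cut_side_of_ne hb hx))))
  · intro (x : G.Flag) (y : G.Flag)
    rintro (h' | h' | h')
    · exact Quot.sound (Or.inl h')
    · exact Quot.sound (Or.inr (Or.inl h'))
    · by_cases hx : G.ribbonOf x = G.ribbonOf b
      · have key : ∀ x, G.ribbonOf x = G.ribbonOf b → (G.cut (G.edgeOf b hb)).componentOf x =
            (G.cut (G.edgeOf b hb)).componentOf b := by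
          intro x hx
          rcases G.ribbonOf_eq_iff.1 hx with rfl | rfl | rfl | rfl
          · rfl
          · exact ca b
          · exact h.symm
          · exact (ca (G.side b)).trans h.symm
        have hy : G.ribbonOf y = G.ribbonOf b := by rw [h', G.ribbonOf_side, hx]
        exact (key x hx).trans (key y hy).symm
      · exact Quot.sound (Or.inr (Or.inr (h'.trans (cut_side_of_ne hb hx).symm)))

theorem isBridge_edgeOf_iff : G.IsBridge (G.edgeOf b hb) ↔
    (G.cut (G.edgeOf b hb)).componentOf b ≠ (G.cut (G.edgeOf b hb)).componentOf (G.side b) := by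
  constructor
  · intro h h'
    rw [IsBridge, cut_numComponents_of_eq h'] at h
    exact h.false
  · intro h
    rw [IsBridge, cut_numComponents_of_ne h]
    omega

theorem not_isLoop_of_isBridge {e : G.Edge} (h : G.IsBridge e) : ¬ G.IsLoop e := by
  obtain ⟨b, hb, rfl⟩ := exists_edgeOf e
  rw [isBridge_edgeOf_iff] at h
  rw [isLoop_edgeOf_iff]
  intro h'
  exact h (componentOf_eq_of_vertexOf (G := G.cut (G.edgeOf b hb)) h')

theorem cutOn_orientable (C : G.CutSet) (h : G.Orientable) : (G.cutOn C).Orientable := by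
  obtain ⟨o, ho⟩ := h
  refine ⟨o, fun a => ⟨(ho a).1, (ho a).2.1, ?_⟩⟩
  by_cases ha : a ∈ C.carrier
  · rw [cutOn_side_of_mem ha]; exact (ho a).1
  · rw [cutOn_side_of_notMem ha]; exact (ho a).2.2

-- When the cut separates the ends, the colouring may be reversed on the component of one end only,
-- and this freedom suffices to make it alternate along the restored edge.
open Classical in
theorem cut_orientable (h : (G.cut (G.edgeOf b hb)).componentOf b ≠
    (G.cut (G.edgeOf b hb)).componentOf (G.side b)) :
    (G.cut (G.edgeOf b hb)).Orientable ↔ G.Orientable := by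
  constructor
  · rintro ⟨o, ho⟩
    let K := G.cut (G.edgeOf b hb)
    have ca := componentOf_arc (G := K)
    have cc := componentOf_corner (G := K)
    have cs := componentOf_side (G := K)
    have ho1 : ∀ x : G.Flag, o (G.arc x) = !o x := fun x => (ho x).1
    have ho2 : ∀ x : G.Flag, o (G.corner x) = !o x := fun x => (ho x).2.1
    have ho3 : ∀ x : G.Flag, G.ribbonOf x ≠ G.ribbonOf b → o (G.side x) = !o x := fun x hx =>
      (congrArg o (cut_side_of_ne hb hx)).symm.trans (ho x).2.2
    have hne : K.componentOf (G.side b) ≠ K.componentOf b := fun h' => h h'.symm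
    -- `c` records whether a reversal is needed at `side b`; it is applied outside the component of
    -- `b`.
    let c : Bool := xor (o (G.side b)) (!o b)
    have hc : xor (o (G.side b)) c = !o b := by
      simp only [c]; cases o (G.side b) <;> cases o b <;> rfl
    have hc' : xor (o b) c = !(o (G.side b)) := by
      simp only [c]; cases o (G.side b) <;> cases o b <;> rfl
    let o' : G.Flag → Bool := fun x => if K.componentOf x = K.componentOf b then o x else xor (o x) c
    have hb1 : o' b = o b := if_pos rfl
    have hb2 : o' (G.side b) = xor (o (G.side b)) c := if_neg hne
    have h1 : ∀ x, o' (G.arc x) = !o' x := by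
      intro x
      have : K.componentOf (G.arc x) = K.componentOf x := ca x
      simp only [o', this, ho1]
      split_ifs <;> simp
    have h2 : ∀ x, o' (G.corner x) = !o' x := by
      intro x
      have : K.componentOf (G.corner x) = K.componentOf x := cc x
      simp only [o', this, ho2]
      split_ifs <;> simp
    have h3 : ∀ x, G.ribbonOf x ≠ G.ribbonOf b → o' (G.side x) = !o' x := by
      intro x hx
      have : K.componentOf (G.side x) = K.componentOf x :=
        (congrArg K.componentOf (cut_side_of_ne hb hx)).symm.trans (cs x)
      simp only [o', this, ho3 x hx]
      split_ifs <;> simp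
    refine ⟨o', fun x => ⟨h1 x, h2 x, ?_⟩⟩
    have h4 : o' (G.side b) = !o' b := by rw [hb1, hb2, hc]
    by_cases hx : G.ribbonOf x = G.ribbonOf b
    · rcases G.ribbonOf_eq_iff.1 hx with rfl | rfl | rfl | rfl
      · exact h4
      · rw [← G.arc_side, h1, h1, h4]
      · rw [G.side_side, h4, Bool.not_not]
      · rw [← G.arc_side, G.side_side, h1, h1, h4, Bool.not_not]
    · exact h3 x hx
  · exact cutOn_orientable (G.flagsOf {G.edgeOf b hb})

theorem cut_orientParam (h : (G.cut (G.edgeOf b hb)).componentOf b ≠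
    (G.cut (G.edgeOf b hb)).componentOf (G.side b)) :
    (G.cut (G.edgeOf b hb)).orientParam = G.orientParam := by
  unfold orientParam
  by_cases h' : G.Orientable
  · rw [if_pos h', if_pos ((cut_orientable h).2 h')]
  · rw [if_neg h', if_neg (mt (cut_orientable h).1 h')]

end Cut

/-! ### Inequalities between the invariants -/

/-- Induction on edges: a loop is cut, any other edge is contracted. The inequalities say that the
nullity and the Euler genus are not negative, so that the natural-number subtractions in the
exponents are exact. -/
theorem numVertices_le_and_numCircles_le (G : PinchedRibbonGraph) :
    G.numVertices ≤ G.numComponents + G.numEdges ∧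
      G.numCircles + G.numVertices ≤ 2 * G.numComponents + G.numEdges := by
  induction hn : G.numEdges generalizing G with
  | zero =>
    have h0 := (isEdgeless_iff G).1 ((isEdgeless_iff_numEdges G).2 hn)
    have h1 : G.numVertices = G.numComponents := by
      refine congrArg (· + G.isolated) (QuotCount.card_eq_of_mutual ?_ ?_)
      · rintro x y (h | h)
        · exact Quot.sound (Or.inl h)
        · exact Quot.sound (Or.inr (Or.inl h))
      · rintro x y (h | h | h)
        · exact Quot.sound (Or.inl h)
        · exact Quot.sound (Or.inr h)
        · exact Quot.sound (Or.inl (h.trans (h0 x)))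
    have h2 : G.numVertices = G.numCircles := by
      refine congrArg (· + G.isolated) (QuotCount.card_eq_of_mutual ?_ ?_)
      · rintro x y (h | h)
        · exact Quot.sound (Or.inr (h.trans (h0 x).symm))
        · exact Quot.sound (Or.inl h)
      · rintro x y (h | h)
        · exact Quot.sound (Or.inr h)
        · exact Quot.sound (Or.inl (h.trans (h0 x)))
    omega
  | succ n ih =>
    have : Nonempty G.Edge := by
      by_contra h
      rw [not_nonempty_iff] at h
      have := (isEdgeless_iff_numEdges G).1 h
      omega
    obtain ⟨b, hb, -⟩ := exists_edgeOf this.some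
    by_cases hl : G.vertexOf b = G.vertexOf (G.side b)
    · have h1 := ih (G.cut (G.edgeOf b hb)) (by have := cut_numEdges (hb := hb); omega)
      have h2 := cut_numComponents_of_eq (hb := hb)
        (componentOf_eq_of_vertexOf (G := G.cut (G.edgeOf b hb)) hl)
      have h3 := numCircles_le_cut (hb := hb)
      have h4 := cut_numVertices (G.edgeOf b hb)
      omega
    · have h1 := ih (G.contract (G.edgeOf b hb)) (by have := contract_numEdges (hb := hb); omega)
      have h2 := contract_numComponents (hb := hb) hl
      have h3 := contract_numCircles (hb := hb) hl
      have h4 := contract_numVertices (hb := hb) hl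
      omega

theorem rank_add (G : PinchedRibbonGraph) : G.rank + G.numComponents = G.numVertices := by
  have := numComponents_le_numVertices G
  unfold rank
  omega

theorem nullity_add (G : PinchedRibbonGraph) : G.nullity + G.rank = G.numEdges := by
  have h1 := numVertices_le_and_numCircles_le G
  have h2 := rank_add G
  unfold nullity
  omega

theorem numCircles_le (G : PinchedRibbonGraph) : G.numCircles ≤ G.numComponents + G.nullity := by
  have h1 := numVertices_le_and_numCircles_le G
  have h2 := rank_add G
  have h3 := nullity_add G
  omega

end PinchedRibbonGraph


namespace PinchedRibbonGraph

variable {G H : PinchedRibbonGraph} {R : Type*} [CommRing R]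

/-! ### Recursion for state sums -/

theorem CutSet.mem_iff_of_ribbonOf (C : G.CutSet) {a b : G.Flag} (h : G.ribbonOf a = G.ribbonOf b) :
    a ∈ C.carrier ↔ b ∈ C.carrier := by
  rcases G.ribbonOf_eq_iff.1 h with rfl | rfl | rfl | rfl <;>
    simp only [C.arc_mem_iff, C.side_mem_iff]

theorem cutOn_ribbonOf_iff {C : G.CutSet} {b : G.Flag} (hC : b ∉ C.carrier) {x : G.Flag} :
    (G.cutOn C).ribbonOf x = (G.cutOn C).ribbonOf b ↔ G.ribbonOf x = G.ribbonOf b := by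
  rw [ribbonOf_eq_iff, ribbonOf_eq_iff, cutOn_side_of_notMem hC]

variable {b : G.Flag} (hb : G.side b ≠ G.arc b)

noncomputable instance (p : G.CutSet → Prop) : Fintype {C : G.CutSet // p C} :=
  Fintype.ofFinite _

theorem cutOn_side_ne_arc {b : G.Flag} (hb : G.side b ≠ G.arc b)
    {C : G.CutSet} (hC : b ∉ C.carrier) :
    (G.cutOn C).side b ≠ (G.cutOn C).arc b := by
  rwa [cutOn_side_of_notMem hC]

/-- An edge that is not cut by `C`, as an edge of the spanning c-subgraph. -/
noncomputable def edgeOn {b : G.Flag} (hb : G.side b ≠ G.arc b)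
    (C : {C : G.CutSet // b ∉ C.carrier}) : (G.cutOn C.1).Edge :=
  (G.cutOn C.1).edgeOf b (cutOn_side_ne_arc hb C.2)

/-- Cutting the remaining edges after one edge has been cut. -/
noncomputable def cutSetCutEquiv :
    (G.cut (G.edgeOf b hb)).CutSet ≃ {C : G.CutSet // b ∉ C.carrier} where
  toFun C :=
    have hC : ∀ a : G.Flag, a ∈ C.carrier → G.ribbonOf a ≠ G.ribbonOf b :=
      fun a ha h => C.edge a ha (cut_side_of_eq hb h)
    ⟨⟨C.carrier, C.arc_mem,
      fun a ha => by
        have := C.side_mem a ha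
        rwa [cut_side_of_ne hb (hC a ha)] at this,
      fun a ha h => C.edge a ha ((cut_side_of_ne hb (hC a ha)).trans h)⟩, fun h => hC b h rfl⟩
  invFun C :=
    have hC : ∀ a : G.Flag, a ∈ C.1.carrier → G.ribbonOf a ≠ G.ribbonOf b :=
      fun a ha h => C.2 ((C.1.mem_iff_of_ribbonOf h).1 ha)
    ⟨C.1.carrier, C.1.arc_mem,
      fun a ha => by
        have := C.1.side_mem a ha
        rwa [← cut_side_of_ne hb (hC a ha)] at this,
      fun a ha h => C.1.edge a ha ((cut_side_of_ne hb (hC a ha)).symm.trans h)⟩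
  left_inv _ := rfl
  right_inv _ := rfl

/-- Cutting edges commutes. -/
noncomputable def cutCutIso (C : (G.cut (G.edgeOf b hb)).CutSet) :
    ((G.cut (G.edgeOf b hb)).cutOn C).Iso
      ((G.cutOn (cutSetCutEquiv hb C).1).cut (edgeOn hb (cutSetCutEquiv hb C))) where
  toEquiv := Equiv.refl G.Flag
  map_arc _ := rfl
  map_corner _ := rfl
  map_side := by
    intro (a : G.Flag)
    obtain ⟨C', hC'⟩ : ∃ C', C' = cutSetCutEquiv hb C := ⟨_, rfl⟩
    have hCC : ∀ a : G.Flag, a ∈ C.carrier ↔ a ∈ C'.1.carrier := fun a => by rw [hC']; rfl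
    rw [← hC']
    change ((G.cut (G.edgeOf b hb)).cutOn C).side a = ((G.cutOn C'.1).cut (edgeOn hb C')).side a
    by_cases ha : G.ribbonOf a = G.ribbonOf b
    · have h1 : a ∉ C.carrier := by rw [hCC, C'.1.mem_iff_of_ribbonOf ha]; exact C'.2
      refine (cutOn_side_of_notMem h1).trans ((cut_side_of_eq hb ha).trans ?_)
      exact (cut_side_of_eq (G := G.cutOn C'.1) _ ((cutOn_ribbonOf_iff C'.2).2 ha)).symm
    · have h2 : ((G.cutOn C'.1).cut (edgeOn hb C')).side a = (G.cutOn C'.1).side a :=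
        cut_side_of_ne (G := G.cutOn C'.1) _ (mt (cutOn_ribbonOf_iff C'.2).1 ha)
      refine Eq.trans ?_ h2.symm
      by_cases hac : a ∈ C.carrier
      · exact (cutOn_side_of_mem hac).trans (cutOn_side_of_mem ((hCC a).1 hac)).symm
      · exact (cutOn_side_of_notMem hac).trans ((cut_side_of_ne hb ha).trans
          (cutOn_side_of_notMem (mt (hCC a).2 hac)).symm)
  isolated_eq := rfl

/-- Removing an edge from a set of edges to be cut. -/
noncomputable def cutSetEraseEquiv :
    {C : G.CutSet // ¬ b ∉ C.carrier} ≃ {C : G.CutSet // b ∉ C.carrier} where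
  toFun C := ⟨⟨{a | a ∈ C.1.carrier ∧ G.ribbonOf a ≠ G.ribbonOf b},
      fun a ha => ⟨C.1.arc_mem a ha.1, by rw [G.ribbonOf_arc]; exact ha.2⟩,
      fun a ha => ⟨C.1.side_mem a ha.1, by rw [G.ribbonOf_side]; exact ha.2⟩,
      fun a ha => C.1.edge a ha.1⟩, fun h => h.2 rfl⟩
  invFun C := ⟨⟨{a | a ∈ C.1.carrier ∨ G.ribbonOf a = G.ribbonOf b},
      fun a ha => ha.imp (C.1.arc_mem a) fun h => by rw [G.ribbonOf_arc]; exact h,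
      fun a ha => ha.imp (C.1.side_mem a) fun h => by rw [G.ribbonOf_side]; exact h,
      fun a ha => ha.elim (C.1.edge a) fun h => side_ne_arc_of_ribbonOf hb h⟩,
    fun h => h (Or.inr rfl)⟩
  left_inv C := by
    apply Subtype.ext
    ext a
    have h1 := C.2
    have h2 := C.1.mem_iff_of_ribbonOf (a := a) (b := b)
    simp only [Set.mem_ofPred_eq]
    tauto
  right_inv C := by
    apply Subtype.ext
    ext a
    have h1 := C.2
    have h2 := C.1.mem_iff_of_ribbonOf (a := a) (b := b)
    simp only [Set.mem_ofPred_eq]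
    tauto

/-- Cutting an edge last. -/
noncomputable def cutEraseIso (C : {C : G.CutSet // ¬ b ∉ C.carrier}) :
    (G.cutOn C.1).Iso ((G.cutOn (cutSetEraseEquiv hb C).1).cut (edgeOn hb (cutSetEraseEquiv hb C))) where
  toEquiv := Equiv.refl G.Flag
  map_arc _ := rfl
  map_corner _ := rfl
  map_side := by
    intro (a : G.Flag)
    obtain ⟨C', hC'⟩ : ∃ C', C' = cutSetEraseEquiv hb C := ⟨_, rfl⟩
    have hCC : ∀ a : G.Flag, a ∈ C'.1.carrier ↔ a ∈ C.1.carrier ∧ G.ribbonOf a ≠ G.ribbonOf b :=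
      fun a => by rw [hC']; rfl
    rw [← hC']
    change (G.cutOn C.1).side a = ((G.cutOn C'.1).cut (edgeOn hb C')).side a
    by_cases ha : G.ribbonOf a = G.ribbonOf b
    · have h1 : a ∈ C.1.carrier := (C.1.mem_iff_of_ribbonOf ha).2 (not_not.1 C.2)
      refine (cutOn_side_of_mem h1).trans ?_
      exact (cut_side_of_eq (G := G.cutOn C'.1) _ ((cutOn_ribbonOf_iff C'.2).2 ha)).symm
    · have h2 : ((G.cutOn C'.1).cut (edgeOn hb C')).side a = (G.cutOn C'.1).side a :=
        cut_side_of_ne (G := G.cutOn C'.1) _ (mt (cutOn_ribbonOf_iff C'.2).1 ha)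
      refine Eq.trans ?_ h2.symm
      by_cases hac : a ∈ C.1.carrier
      · exact (cutOn_side_of_mem hac).trans (cutOn_side_of_mem ((hCC a).2 ⟨hac, ha⟩)).symm
      · exact (cutOn_side_of_notMem hac).trans
          (cutOn_side_of_notMem (mt (fun h => ((hCC a).1 h).1) hac)).symm
  isolated_eq := rfl

/-- Cutting edges of a contracted graph. -/
noncomputable def cutSetContractEquiv :
    (G.contract (G.edgeOf b hb)).CutSet ≃ {C : G.CutSet // b ∉ C.carrier} where
  toFun C := ⟨⟨{a | ∃ h : G.ribbonOf a ≠ G.ribbonOf b, C.carrier ⟨a, h⟩},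
      fun a ⟨h, ha⟩ => ⟨(G.ribbonOf_arc a).trans_ne h, C.arc_mem _ ha⟩,
      fun a ⟨h, ha⟩ => ⟨(G.ribbonOf_side a).trans_ne h, C.side_mem _ ha⟩,
      fun a ⟨h, ha⟩ h' => C.edge ⟨a, h⟩ ha (Subtype.ext h')⟩, fun ⟨h, _⟩ => h rfl⟩
  invFun C := ⟨{a | a.1 ∈ C.1.carrier}, fun a ha => C.1.arc_mem _ ha,
    fun a ha => C.1.side_mem _ ha, fun a ha h => C.1.edge _ ha (congrArg Subtype.val h)⟩
  left_inv C := by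
    ext a
    exact ⟨fun ⟨_, h⟩ => h, fun h => ⟨a.2, h⟩⟩
  right_inv C := by
    apply Subtype.ext
    ext a
    exact ⟨fun ⟨_, h⟩ => h, fun h => ⟨fun h' => C.2 ((C.1.mem_iff_of_ribbonOf h').1 h), h⟩⟩

/-- The walk around the edge uses no sides but its own, and these are untouched because `C` does not
contain the edge. -/
theorem cutOn_next {C : {C : G.CutSet // b ∉ C.carrier}} (a : G.Flag) :
    (G.cutOn C.1).next (edgeOn hb C) a = G.next (G.edgeOf b hb) a := by
  have h1 : ∀ x : G.Flag, (G.cutOn C.1).ribbonOf x = (edgeOn hb C).1 ↔ G.ribbonOf x = (G.edgeOf b hb).1 :=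
    fun x => cutOn_ribbonOf_iff C.2
  have h2 : ∀ x : G.Flag, G.ribbonOf x = (G.edgeOf b hb).1 → (G.cutOn C.1).side x = G.side x :=
    fun x hx => cutOn_side_of_notMem (mt (C.1.mem_iff_of_ribbonOf hx).1 C.2)
  by_cases e1 : G.ribbonOf (G.corner a) = (G.edgeOf b hb).1
  · have e1' := (h1 _).2 e1
    by_cases e2 : G.ribbonOf (G.corner (G.side (G.corner a))) = (G.edgeOf b hb).1
    · have e2' := (h1 _).2 e2
      rw [← h2 _ e1] at e2'
      unfold next
      rw [if_pos e1, if_pos e1', if_pos e2, if_pos e2', h2 _ e1, h2 _ e2]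
    · have e2' := mt (h1 _).1 e2
      rw [← h2 _ e1] at e2'
      unfold next
      rw [if_pos e1, if_pos e1', if_neg e2, if_neg e2', h2 _ e1]
  · have e1' := mt (h1 _).1 e1
    unfold next
    rw [if_neg e1, if_neg e1']

/-- Contraction commutes with cutting other edges. -/
noncomputable def cutContractIso (hnl : G.vertexOf b ≠ G.vertexOf (G.side b))
    (C : (G.contract (G.edgeOf b hb)).CutSet) :
    ((G.contract (G.edgeOf b hb)).cutOn C).Iso
      ((G.cutOn (cutSetContractEquiv hb C).1).contract (edgeOn hb (cutSetContractEquiv hb C))) where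
  toEquiv := Equiv.subtypeEquivRight (p := fun a => G.ribbonOf a ≠ G.ribbonOf b)
    fun _ => (cutOn_ribbonOf_iff (cutSetContractEquiv hb C).2).symm.not
  map_arc _ := rfl
  map_corner a := Subtype.ext (cutOn_next hb a.1).symm
  map_side := by
    intro (a : {a // G.ribbonOf a ≠ G.ribbonOf b})
    obtain ⟨C', hC'⟩ : ∃ C', C' = cutSetContractEquiv hb C := ⟨_, rfl⟩
    have hCC : a.1 ∈ (cutSetContractEquiv hb C).1.carrier ↔ a ∈ C.carrier :=
      ⟨fun h => h.elim fun _ h => h, fun h => Exists.intro a.2 h⟩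
    apply Subtype.ext
    by_cases ha : a ∈ C.carrier
    · exact (congrArg Subtype.val (cutOn_side_of_mem ha)).trans
        (cutOn_side_of_mem (hCC.2 ha)).symm
    · exact (congrArg Subtype.val (cutOn_side_of_notMem ha)).trans
        (cutOn_side_of_notMem (mt hCC.1 ha)).symm
  isolated_eq := by
    classical
    have hC := (cutSetContractEquiv hb C).2
    have h1 : (G.contract (G.edgeOf b hb)).isolated =
      G.isolated + if G.IsIsolatedEdge b then 1 else 0 := contract_isolated hnl
    have hs : (G.cutOn (cutSetContractEquiv hb C).1).side b = G.side b := cutOn_side_of_notMem hC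
    have h2 : ((G.cutOn (cutSetContractEquiv hb C).1).contract
        (edgeOn hb (cutSetContractEquiv hb C))).isolated =
        G.isolated + if (G.cutOn (cutSetContractEquiv hb C).1).IsIsolatedEdge b then 1 else 0 :=
      contract_isolated (by rw [hs]; exact hnl)
    refine h1.trans (Eq.trans ?_ h2.symm)
    have h3 : G.IsIsolatedEdge b ↔ (G.cutOn (cutSetContractEquiv hb C).1).IsIsolatedEdge b := by
      unfold IsIsolatedEdge
      rw [hs]
    simp only [h3]

variable {φ : PinchedRibbonGraph → R}

/-- Every state in which the edge is cut is the cut of a unique state in which it is kept. Thus the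
states of `G`, of the cut and of the contraction are all indexed by the sets `C` avoiding `b`. -/
theorem stateSum_eq_sum_add (hφ : ∀ G H : PinchedRibbonGraph, Nonempty (G.Iso H) → φ G = φ H) :
    stateSum φ G = ∑ C : {C : G.CutSet // b ∉ C.carrier}, φ (G.cutOn C.1) +
      ∑ C : {C : G.CutSet // b ∉ C.carrier}, φ ((G.cutOn C.1).cut (edgeOn hb C)) := by
  classical
  have h1 := Fintype.sum_equiv (Equiv.sumCompl fun C : G.CutSet => b ∉ C.carrier)
    (fun C => φ (G.cutOn (Equiv.sumCompl _ C))) (fun C => φ (G.cutOn C)) fun _ => rfl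
  rw [stateSum, ← h1, Fintype.sum_sum_type]
  refine congrArg₂ (· + ·) rfl (Fintype.sum_equiv (cutSetEraseEquiv hb) _ _ ?_)
  intro C
  exact hφ _ _ ⟨cutEraseIso hb C⟩

theorem stateSum_cut (hφ : ∀ G H : PinchedRibbonGraph, Nonempty (G.Iso H) → φ G = φ H) :
    stateSum φ (G.cut (G.edgeOf b hb)) =
      ∑ C : {C : G.CutSet // b ∉ C.carrier}, φ ((G.cutOn C.1).cut (edgeOn hb C)) :=
  Fintype.sum_equiv (cutSetCutEquiv hb) _ _ fun C => hφ _ _ ⟨cutCutIso hb C⟩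

theorem stateSum_contract (hφ : ∀ G H : PinchedRibbonGraph, Nonempty (G.Iso H) → φ G = φ H)
    (hnl : G.vertexOf b ≠ G.vertexOf (G.side b)) :
    stateSum φ (G.contract (G.edgeOf b hb)) =
      ∑ C : {C : G.CutSet // b ∉ C.carrier}, φ ((G.cutOn C.1).contract (edgeOn hb C)) :=
  Fintype.sum_equiv (cutSetContractEquiv hb) _ _ fun C => hφ _ _ ⟨cutContractIso hb hnl C⟩

/-! ### The polynomial under cut and contraction -/

/-- Only the rank changes, by one, and the shift of the reference rank compensates for it; the
nullity survives because one edge is lost as well. -/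
theorem weight_contract (x y z w t : R) (r₀ : ℕ) {b : G.Flag} {hb : G.side b ≠ G.arc b}
    (hnl : G.vertexOf b ≠ G.vertexOf (G.side b)) :
    weight x y z w t r₀ (G.contract (G.edgeOf b hb)) = weight x y z w t (r₀ + 1) G := by
  have h1 := contract_numVertices (hb := hb) hnl
  have h2 := contract_numComponents (hb := hb) hnl
  have h3 := contract_numCircles (hb := hb) hnl
  have h4 := contract_numEdges (hb := hb)
  have h5 := rank_add G
  have h6 := rank_add (G.contract (G.edgeOf b hb))
  have h7 := nullity_add G
  have h8 := nullity_add (G.contract (G.edgeOf b hb))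
  unfold weight
  rw [contract_orientParam hnl, contract_numHalfRibbons, h2, h3,
    show (G.contract (G.edgeOf b hb)).nullity = G.nullity by omega,
    show r₀ - (G.contract (G.edgeOf b hb)).rank = r₀ + 1 - G.rank by omega]

/-- The rank drops by one, which gives `x - 1`, and two half-ribbons appear, which gives `t ^ 2`.
Components and circles both increase by one, so the exponent of `z` is unchanged. The bound `hr`
makes the subtraction of ranks exact. -/
theorem weight_cut_bridge (x y z w t : R) (r₀ : ℕ) {b : G.Flag} {hb : G.side b ≠ G.arc b}
    (hr : G.rank ≤ r₀) (h : (G.cut (G.edgeOf b hb)).componentOf b ≠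
      (G.cut (G.edgeOf b hb)).componentOf (G.side b)) :
    weight x y z w t r₀ (G.cut (G.edgeOf b hb)) = (x - 1) * t ^ 2 * weight x y z w t r₀ G := by
  have h1 := cut_numVertices (G.edgeOf b hb)
  have h2 := cut_numComponents_of_ne h
  have h3 := cut_numCircles h
  have h4 := cut_numEdges (hb := hb)
  have h5 := rank_add G
  have h6 := rank_add (G.cut (G.edgeOf b hb))
  have h7 := nullity_add G
  have h8 := nullity_add (G.cut (G.edgeOf b hb))
  unfold weight
  rw [cut_orientParam h, cut_numHalfRibbons,
    show (G.cut (G.edgeOf b hb)).nullity = G.nullity by omega,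
    show (G.cut (G.edgeOf b hb)).numComponents + G.nullity - (G.cut (G.edgeOf b hb)).numCircles =
      G.numComponents + G.nullity - G.numCircles by omega,
    show r₀ - (G.cut (G.edgeOf b hb)).rank = r₀ - G.rank + 1 by omega]
  ring

theorem weight_congr (x y z w t : R) (r₀ : ℕ) (G H : PinchedRibbonGraph) (h : Nonempty (G.Iso H)) :
    weight x y z w t r₀ G = weight x y z w t r₀ H :=
  h.elim fun f => f.weight_eq _ _ _ _ _ _

theorem rank_cutOn_le (C : G.CutSet) : (G.cutOn C).rank ≤ G.rank :=
  Nat.sub_le_sub_left (numComponents_le_cutOn C) _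

variable (x y z w t : R)

theorem polyR'_contract (hnl : G.vertexOf b ≠ G.vertexOf (G.side b)) :
    (G.contract (G.edgeOf b hb)).polyR' x y z w t =
      ∑ C : {C : G.CutSet // b ∉ C.carrier}, weight x y z w t G.rank (G.cutOn C.1) := by
  have h1 := contract_numVertices (hb := hb) hnl
  have h2 := contract_numComponents (hb := hb) hnl
  have h5 := rank_add G
  have h6 := rank_add (G.contract (G.edgeOf b hb))
  rw [polyR'_eq_stateSum, stateSum_contract hb (weight_congr _ _ _ _ _ _) hnl,
    show G.rank = (G.contract (G.edgeOf b hb)).rank + 1 by omega]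
  refine Finset.sum_congr rfl fun C _ => weight_contract _ _ _ _ _ _ ?_
  rw [cutOn_side_of_notMem C.2]
  exact hnl

theorem polyR'_of_not_isBridge (hnl : G.vertexOf b ≠ G.vertexOf (G.side b))
    (h : ¬ G.IsBridge (G.edgeOf b hb)) : G.polyR' x y z w t =
      (G.cut (G.edgeOf b hb)).polyR' x y z w t + (G.contract (G.edgeOf b hb)).polyR' x y z w t := by
  rw [isBridge_edgeOf_iff, not_not] at h
  have h1 : (G.cut (G.edgeOf b hb)).rank = G.rank := by
    unfold rank
    rw [cut_numComponents_of_eq h]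
    rfl
  rw [polyR'_contract hb _ _ _ _ _ hnl, polyR'_eq_stateSum, polyR'_eq_stateSum, h1,
    stateSum_eq_sum_add hb (weight_congr _ _ _ _ _ _), stateSum_cut hb (weight_congr _ _ _ _ _ _),
    add_comm]

theorem polyR'_of_isBridge (h : G.IsBridge (G.edgeOf b hb)) : G.polyR' x y z w t =
    ((x - 1) * t ^ 2 + 1) * (G.contract (G.edgeOf b hb)).polyR' x y z w t := by
  have hnl := mt isLoop_edgeOf_iff.2 (not_isLoop_of_isBridge h)
  rw [isBridge_edgeOf_iff] at h
  rw [polyR'_contract hb _ _ _ _ _ hnl, polyR'_eq_stateSum,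
    stateSum_eq_sum_add hb (weight_congr _ _ _ _ _ _), add_mul, one_mul, add_comm, Finset.mul_sum]
  congr 1
  refine Finset.sum_congr rfl fun C _ => weight_cut_bridge _ _ _ _ _ _ (rank_cutOn_le _) ?_
  intro h'
  rw [cutOn_side_of_notMem C.2] at h'
  -- A bridge remains a bridge in every state that keeps it: cutting further edges only refines the
  -- components.
  refine h (QuotCount.mk_eq_of_imp ?_ h')
  intro (p : G.Flag) (q : G.Flag)
  rintro (h1 | h1 | h1)
  · exact Quot.sound (Or.inl h1)
  · exact Quot.sound (Or.inr (Or.inl h1))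
  · by_cases hp : G.ribbonOf p = G.ribbonOf b
    · exact Quot.sound (Or.inl
        (h1.trans (cut_side_of_eq (G := G.cutOn C.1) _ ((cutOn_ribbonOf_iff C.2).2 hp))))
    · have h2 := h1.trans (cut_side_of_ne (G := G.cutOn C.1) (cutOn_side_ne_arc hb C.2)
        (mt (cutOn_ribbonOf_iff C.2).1 hp))
      by_cases hpc : p ∈ C.1.carrier
      · exact Quot.sound (Or.inl (h2.trans (cutOn_side_of_mem hpc)))
      · exact Quot.sound (Or.inr (Or.inr
          ((h2.trans (cutOn_side_of_notMem hpc)).trans (cut_side_of_ne hb hp).symm)))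

end PinchedRibbonGraph


/-! ### Alternating colourings; disjoint unions, joints and multiplicativity -/

namespace QuotCount

theorem card_sum {X Y : Type*} [Finite X] [Finite Y] {r : X → X → Prop} {s : Y → Y → Prop}
    {t : X ⊕ Y → X ⊕ Y → Prop} (hr : ∀ a b, r a b → t (.inl a) (.inl b))
    (hs : ∀ a b, s a b → t (.inr a) (.inr b)) (hl : ∀ a q, t (.inl a) q → ∃ b, q = .inl b ∧ r a b)
    (hr' : ∀ a q, t (.inr a) q → ∃ b, q = .inr b ∧ s a b) :
    Nat.card (Quot t) = Nat.card (Quot r) + Nat.card (Quot s) := by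
  have : Finite (Quot r) := Quot.finite _
  have : Finite (Quot s) := Quot.finite _
  rw [← Nat.card_sum]
  refine Nat.card_congr ⟨Quot.lift (Sum.map (Quot.mk r) (Quot.mk s)) ?_,
    Sum.elim (Quot.map Sum.inl hr) (Quot.map Sum.inr hs), ?_, ?_⟩
  · rintro (a | a) q h
    · obtain ⟨b, rfl, h'⟩ := hl a q h
      exact congrArg Sum.inl (Quot.sound h')
    · obtain ⟨b, rfl, h'⟩ := hr' a q h
      exact congrArg Sum.inr (Quot.sound h')
  · rintro ⟨a | a⟩ <;> rfl
  · rintro (a | a) <;> induction a using Quot.ind <;> rfl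

/-- Each class splits into two cycles of `π = κ σ` exchanged by `σ`; one of them is coloured. They
are different because `σ` conjugates `π` to its inverse, so `σ a = π ^ n a` would produce a fixed
point of one of the two involutions. -/
theorem exists_alternating {X : Type*} {σ κ : X → X} (hσ : ∀ a, σ (σ a) = a) (hσne : ∀ a, σ a ≠ a)
    (hκ : ∀ a, κ (κ a) = a) (hκne : ∀ a, κ a ≠ a) :
    ∃ o : X → Bool, ∀ a, o (σ a) = !o a ∧ o (κ a) = !o a := by
  classical
  let s : Equiv.Perm X := Function.Involutive.toPerm σ hσ
  let k : Equiv.Perm X := Function.Involutive.toPerm κ hκ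
  have hs : ∀ a, s a = σ a := fun _ => rfl
  have hk : ∀ a, k a = κ a := fun _ => rfl
  have hss : s⁻¹ = s := rfl
  have hkk : k⁻¹ = k := rfl
  let π := k * s
  have hπ : ∀ a, π a = κ (σ a) := fun _ => rfl
  have hconj : ∀ n : ℤ, s * π ^ n = π ^ (-n) * s := by
    intro n
    have h1 : s * π * s⁻¹ = π⁻¹ := by
      simp only [π, mul_inv_rev, hss, hkk]
      ext a
      simp [hs, hσ]
    rw [← eq_mul_inv_iff_mul_eq.trans eq_comm, ← conj_zpow, h1]
    simp
  have hA : ∀ a, ¬ π.SameCycle a (σ a) := by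
    rintro a ⟨n, hn⟩
    -- For even `n = 2j` the involution `σ` would fix `π ^ j a`; for odd `n = 2j + 1` the involution
    -- `κ` would fix `σ (π ^ j a)`.
    rcases Int.even_or_odd' n with ⟨j, rfl | rfl⟩
    · apply hσne ((π ^ j) a)
      have h1 := congrArg (fun f : Equiv.Perm X => f a) (hconj j)
      simp only [Equiv.Perm.mul_apply, hs] at h1
      rw [h1, ← hn, ← Equiv.Perm.mul_apply, ← zpow_add]
      congr 2
      ring
    · apply hκne (σ ((π ^ j) a))
      have h1 := congrArg (fun f : Equiv.Perm X => f a) (hconj j)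
      simp only [Equiv.Perm.mul_apply, hs] at h1
      rw [← hπ, h1, ← hn, ← Equiv.Perm.mul_apply, ← Equiv.Perm.mul_apply, ← zpow_add,
        ← zpow_one_add]
      congr 2
      ring
  have hB : ∀ a, π.SameCycle a (κ (σ a)) := fun a => ⟨1, by rw [zpow_one, hπ]⟩
  let r : X → X → Prop := fun a b => b = σ a ∨ b = κ a
  let P : X → Quot r → Prop := fun p => Quot.lift (fun x => π.SameCycle p x ∨ π.SameCycle p (σ x)) (by
    have h1 : ∀ x, π.SameCycle p (κ x) ↔ π.SameCycle p (σ x) := by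
      intro x
      have := hB (σ x)
      rw [hσ] at this
      exact ⟨fun h => h.trans this.symm, fun h => h.trans this⟩
    have h2 : ∀ x, π.SameCycle p (σ (κ x)) ↔ π.SameCycle p x := by
      intro x
      rw [← h1, hκ]
    rintro x y (rfl | rfl)
    · rw [hσ, or_comm]
    · rw [h1, h2, or_comm])
  let rep : X → X := fun x => (Quot.mk r x).out
  have hrep : ∀ x, Quot.mk r (rep x) = Quot.mk r x := fun x => Quot.out_eq _
  have hC : ∀ x, π.SameCycle (rep x) x ∨ π.SameCycle (rep x) (σ x) := by
    intro x
    have h1 : P (rep x) (Quot.mk r (rep x)) := Or.inl (Equiv.Perm.SameCycle.refl _ _)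
    rw [hrep x] at h1
    exact h1
  have hσr : ∀ x, rep (σ x) = rep x := fun x => by
    refine congrArg Quot.out ?_
    symm
    exact Quot.sound (Or.inl rfl)
  have hκr : ∀ x, rep (κ x) = rep x := fun x => by
    refine congrArg Quot.out ?_
    symm
    exact Quot.sound (Or.inr rfl)
  have hD : ∀ x, π.SameCycle (rep x) (σ x) ↔ ¬ π.SameCycle (rep x) x := fun x =>
    ⟨fun h h' => hA x (h'.symm.trans h), fun h => (hC x).resolve_left h⟩
  refine ⟨fun x => decide (π.SameCycle (rep x) x), fun x => ⟨?_, ?_⟩⟩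
  · simp only [hσr, hD, decide_not]
  · have h1 : π.SameCycle (rep x) (κ x) ↔ π.SameCycle (rep x) (σ x) := by
      have := hB (σ x)
      rw [hσ] at this
      exact ⟨fun h => h.trans this.symm, fun h => h.trans this⟩
    simp only [hκr, h1, hD, decide_not]

end QuotCount

namespace PinchedRibbonGraph

variable {G H : PinchedRibbonGraph}

/-! ### Disjoint unions -/

theorem disjointUnion_numVertices (G H : PinchedRibbonGraph) :
    (G.disjointUnion H).numVertices = G.numVertices + H.numVertices := by
  have h : Nat.card (G.disjointUnion H).AttachedVertex =
      Nat.card G.AttachedVertex + Nat.card H.AttachedVertex := by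
    refine QuotCount.card_sum ?_ ?_ ?_ ?_
    · rintro a b (rfl | rfl)
      exacts [Or.inl rfl, Or.inr rfl]
    · rintro a b (rfl | rfl)
      exacts [Or.inl rfl, Or.inr rfl]
    · rintro a q (rfl | rfl)
      exacts [⟨_, rfl, Or.inl rfl⟩, ⟨_, rfl, Or.inr rfl⟩]
    · rintro a q (rfl | rfl)
      exacts [⟨_, rfl, Or.inl rfl⟩, ⟨_, rfl, Or.inr rfl⟩]
  have h' : (G.disjointUnion H).isolated = G.isolated + H.isolated := rfl
  unfold numVertices
  omega

theorem disjointUnion_numCircles (G H : PinchedRibbonGraph) :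
    (G.disjointUnion H).numCircles = G.numCircles + H.numCircles := by
  have h : Nat.card (G.disjointUnion H).Circle = Nat.card G.Circle + Nat.card H.Circle := by
    refine QuotCount.card_sum ?_ ?_ ?_ ?_
    · rintro a b (rfl | rfl)
      exacts [Or.inl rfl, Or.inr rfl]
    · rintro a b (rfl | rfl)
      exacts [Or.inl rfl, Or.inr rfl]
    · rintro a q (rfl | rfl)
      exacts [⟨_, rfl, Or.inl rfl⟩, ⟨_, rfl, Or.inr rfl⟩]
    · rintro a q (rfl | rfl)
      exacts [⟨_, rfl, Or.inl rfl⟩, ⟨_, rfl, Or.inr rfl⟩]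
  have h' : (G.disjointUnion H).isolated = G.isolated + H.isolated := rfl
  unfold numCircles
  omega

theorem disjointUnion_numComponents (G H : PinchedRibbonGraph) :
    (G.disjointUnion H).numComponents = G.numComponents + H.numComponents := by
  have h : Nat.card (G.disjointUnion H).AttachedComponent =
      Nat.card G.AttachedComponent + Nat.card H.AttachedComponent := by
    refine QuotCount.card_sum ?_ ?_ ?_ ?_
    · rintro a b (rfl | rfl | rfl)
      exacts [Or.inl rfl, Or.inr (Or.inl rfl), Or.inr (Or.inr rfl)]
    · rintro a b (rfl | rfl | rfl)
      exacts [Or.inl rfl, Or.inr (Or.inl rfl), Or.inr (Or.inr rfl)]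
    · rintro a q (rfl | rfl | rfl)
      exacts [⟨_, rfl, Or.inl rfl⟩, ⟨_, rfl, Or.inr (Or.inl rfl)⟩, ⟨_, rfl, Or.inr (Or.inr rfl)⟩]
    · rintro a q (rfl | rfl | rfl)
      exacts [⟨_, rfl, Or.inl rfl⟩, ⟨_, rfl, Or.inr (Or.inl rfl)⟩, ⟨_, rfl, Or.inr (Or.inr rfl)⟩]
  have h' : (G.disjointUnion H).isolated = G.isolated + H.isolated := rfl
  unfold numComponents
  omega

theorem disjointUnion_numEdges (G H : PinchedRibbonGraph) :
    (G.disjointUnion H).numEdges = G.numEdges + H.numEdges := by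
  have h1 := four_mul_numEdges (G.disjointUnion H)
  have h2 := four_mul_numEdges G
  have h3 := four_mul_numEdges H
  have h4 : Nat.card {a : (G.disjointUnion H).Flag //
      (G.disjointUnion H).side a ≠ (G.disjointUnion H).arc a} =
      Nat.card {a // G.side a ≠ G.arc a} + Nat.card {a // H.side a ≠ H.arc a} := by
    rw [← Nat.card_sum]
    refine Nat.card_congr (Equiv.subtypeSum.trans (Equiv.sumCongr ?_ ?_))
    · exact Equiv.subtypeEquivRight fun a => (Sum.inl_injective.eq_iff).not
    · exact Equiv.subtypeEquivRight fun a => (Sum.inr_injective.eq_iff).not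
  omega

theorem disjointUnion_numHalfRibbons (G H : PinchedRibbonGraph) :
    (G.disjointUnion H).numHalfRibbons = G.numHalfRibbons + H.numHalfRibbons := by
  have h1 := two_mul_numHalfRibbons (G.disjointUnion H)
  have h2 := two_mul_numHalfRibbons G
  have h3 := two_mul_numHalfRibbons H
  have h4 : Nat.card {a : (G.disjointUnion H).Flag //
      (G.disjointUnion H).side a = (G.disjointUnion H).arc a} =
      Nat.card {a // G.side a = G.arc a} + Nat.card {a // H.side a = H.arc a} := by
    rw [← Nat.card_sum]
    refine Nat.card_congr (Equiv.subtypeSum.trans (Equiv.sumCongr ?_ ?_))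
    · exact Equiv.subtypeEquivRight fun a => (Sum.inl_injective.eq_iff)
    · exact Equiv.subtypeEquivRight fun a => (Sum.inr_injective.eq_iff)
  omega

theorem disjointUnion_orientable (G H : PinchedRibbonGraph) :
    (G.disjointUnion H).Orientable ↔ G.Orientable ∧ H.Orientable := by
  constructor
  · rintro ⟨o, ho⟩
    exact ⟨⟨fun a => o (.inl a), fun a => ho (.inl a)⟩, ⟨fun a => o (.inr a), fun a => ho (.inr a)⟩⟩
  · rintro ⟨⟨o, ho⟩, ⟨o', ho'⟩⟩
    refine ⟨Sum.elim o o', ?_⟩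
    rintro (a | a)
    exacts [ho a, ho' a]

theorem disjointUnion_rank (G H : PinchedRibbonGraph) :
    (G.disjointUnion H).rank = G.rank + H.rank := by
  have h1 := rank_add (G.disjointUnion H)
  have h2 := rank_add G
  have h3 := rank_add H
  rw [disjointUnion_numVertices, disjointUnion_numComponents] at h1
  omega

/-! ### One-point joints -/

variable (c : G.Flag) (d : H.Flag)

/-- A one-point joint differs from the disjoint union by exchanging partners between two corners. As
these lie on different sides of the union, exactly two vertex circles and exactly two boundary
circles merge. -/
theorem switch_joint : QuotCount.Switch (X := G.Flag ⊕ H.Flag) (G.disjointUnion H).corner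
    (G.joint H c d).corner (.inl c) (.inr d) where
  invol := (G.disjointUnion H).corner_corner
  invol' := (G.joint H c d).corner_corner
  left := if_pos rfl
  right := (if_neg (G.corner_ne c)).trans (if_pos rfl)
  off := by
    have h1 : (G.disjointUnion H).corner (.inl c) = .inl (G.corner c) := rfl
    have h2 : (G.disjointUnion H).corner (.inr d) = .inr (H.corner d) := rfl
    rw [h1, h2]
    rintro (a | a) h1 h2 h3 h4
    · exact (if_neg fun h => h1 (congrArg _ h)).trans (if_neg fun h => h3 (congrArg _ h))
    · exact (if_neg fun h => h2 (congrArg _ h)).trans (if_neg fun h => h4 (congrArg _ h))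

theorem mk_inl_ne_mk_inr {X Y : Type*} {t : X ⊕ Y → X ⊕ Y → Prop}
    (ht : ∀ p q, t p q → p.isLeft = q.isLeft) (a : X) (b : Y) :
    Quot.mk t (.inl a) ≠ Quot.mk t (.inr b) := fun h =>
  Bool.noConfusion (congrArg (Quot.lift Sum.isLeft ht) h)

theorem joint_numVertices :
    (G.joint H c d).numVertices + 1 = G.numVertices + H.numVertices := by
  have h1 : Nat.card (G.joint H c d).AttachedVertex + 1 =
      Nat.card (G.disjointUnion H).AttachedVertex := by
    refine (switch_joint c d).card_merge (fun x y => y = (G.disjointUnion H).arc x) ?_ ?_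
    · refine mk_inl_ne_mk_inr ?_ c d
      rintro (p | p) _ (rfl | rfl) <;> rfl
    · refine (switch_joint c d).mk_eq (G.disjointUnion H).arc_arc (G.disjointUnion H).arc_ne
        (G.disjointUnion H).corner_ne (mk_inl_ne_mk_inr ?_ c d)
      rintro (p | p) _ (rfl | rfl) <;> rfl
  have h2 := disjointUnion_numVertices G H
  have h3 : (G.disjointUnion H).isolated = G.isolated + H.isolated := rfl
  have h4 : (G.joint H c d).isolated = G.isolated + H.isolated := rfl
  unfold numVertices at *
  omega

theorem card_circle_eq (G : PinchedRibbonGraph) : Nat.card G.Circle =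
    Nat.card (Quot fun x y : G.Flag => y = G.side x ∨ y = G.corner x) :=
  QuotCount.card_eq_of_mutual (fun _ _ h => Quot.sound h.symm) (fun _ _ h => Quot.sound h.symm)

theorem joint_numCircles :
    (G.joint H c d).numCircles + 1 = G.numCircles + H.numCircles := by
  have h1 : Nat.card (G.joint H c d).Circle + 1 = Nat.card (G.disjointUnion H).Circle := by
    rw [card_circle_eq, card_circle_eq]
    refine (switch_joint c d).card_merge (fun x y => y = (G.disjointUnion H).side x) ?_ ?_
    · refine mk_inl_ne_mk_inr ?_ c d
      rintro (p | p) _ (rfl | rfl) <;> rfl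
    · refine (switch_joint c d).mk_eq (G.disjointUnion H).side_side (G.disjointUnion H).side_ne
        (G.disjointUnion H).corner_ne (mk_inl_ne_mk_inr ?_ c d)
      rintro (p | p) _ (rfl | rfl) <;> rfl
  have h2 := disjointUnion_numCircles G H
  have h3 : (G.disjointUnion H).isolated = G.isolated + H.isolated := rfl
  have h4 : (G.joint H c d).isolated = G.isolated + H.isolated := rfl
  unfold numCircles at *
  omega

theorem joint_numEdges : (G.joint H c d).numEdges = G.numEdges + H.numEdges := by
  have h1 := four_mul_numEdges (G.disjointUnion H)
  have h2 := four_mul_numEdges (G.joint H c d)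
  have h3 := disjointUnion_numEdges G H
  have h4 : Nat.card {a : (G.joint H c d).Flag // (G.joint H c d).side a ≠ (G.joint H c d).arc a} =
    Nat.card {a : (G.disjointUnion H).Flag //
      (G.disjointUnion H).side a ≠ (G.disjointUnion H).arc a} := rfl
  omega

theorem joint_numHalfRibbons :
    (G.joint H c d).numHalfRibbons = G.numHalfRibbons + H.numHalfRibbons :=
  disjointUnion_numHalfRibbons G H

theorem corner_alternates {G : PinchedRibbonGraph} (o : G.Flag → Bool) (c : G.Flag)
    (ho : ∀ a, o (G.arc a) = !o a)
    (ho' : ∀ a, a ≠ c → a ≠ G.corner c → o (G.corner a) = !o a) (a : G.Flag) :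
    o (G.corner a) = !o a := by
  have := Fintype.ofFinite G.Flag
  have h : o (G.corner c) = !o c :=
    QuotCount.alternates_of_alternates (S := Finset.univ) o c (Finset.mem_univ _)
      (fun _ _ => Finset.mem_univ _) (fun _ _ => Finset.mem_univ _) G.arc_arc G.arc_ne
      G.corner_corner G.corner_ne (fun a _ => ho a) (fun a _ => ho' a)
  by_cases h1 : a = c
  · rw [h1, h]
  by_cases h2 : a = G.corner c
  · rw [h2, G.corner_corner, h, Bool.not_not]
  exact ho' a h1 h2

theorem joint_corner_inl {a : G.Flag} (h1 : a ≠ c) (h2 : a ≠ G.corner c) :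
    (G.joint H c d).corner (.inl a) = .inl (G.corner a) := (if_neg h1).trans (if_neg h2)

theorem joint_corner_inr {a : H.Flag} (h1 : a ≠ d) (h2 : a ≠ H.corner d) :
    (G.joint H c d).corner (.inr a) = .inr (H.corner a) := (if_neg h1).trans (if_neg h2)

/-- A colouring of the joint restricts to each part with at most one doubtful corner, and
`corner_alternates` repairs this corner. Conversely, the colours on `H` may be reversed as a whole
to match at the gluing. -/
theorem joint_orientable : (G.joint H c d).Orientable ↔ G.Orientable ∧ H.Orientable := by
  constructor
  · rintro ⟨o, ho⟩
    constructor
    · have h1 : ∀ a, o (.inl (G.arc a)) = !o (.inl a) := fun a => (ho (.inl a)).1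
      refine ⟨fun a => o (.inl a), fun a => ⟨h1 a, ?_, (ho (.inl a)).2.2⟩⟩
      refine corner_alternates (fun a => o (.inl a)) c h1 (fun a h2 h3 => ?_) a
      have := (ho (.inl a)).2.1
      rwa [joint_corner_inl c d h2 h3] at this
    · have h1 : ∀ a, o (.inr (H.arc a)) = !o (.inr a) := fun a => (ho (.inr a)).1
      refine ⟨fun a => o (.inr a), fun a => ⟨h1 a, ?_, (ho (.inr a)).2.2⟩⟩
      refine corner_alternates (fun a => o (.inr a)) d h1 (fun a h2 h3 => ?_) a
      have := (ho (.inr a)).2.1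
      rwa [joint_corner_inr c d h2 h3] at this
  · rintro ⟨⟨o, ho⟩, ⟨o', ho'⟩⟩
    let e : Bool := xor (o c) (!o' d)
    have he : xor (o' d) e = !o c := by
      simp only [e]; cases o c <;> cases o' d <;> rfl
    have he2 : o c = !xor (o' d) e := by rw [he, Bool.not_not]
    let o₂ : G.Flag ⊕ H.Flag → Bool := Sum.elim o fun b => xor (o' b) e
    have key : ∀ (b : H.Flag) (f : H.Flag → H.Flag), o' (f b) = !o' b → xor (o' (f b)) e = !xor (o' b) e := by
      intro b f h
      rw [h]; cases o' b <;> cases e <;> rfl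
    refine ⟨o₂, ?_⟩
    have k1 : ∀ x, o₂ ((G.joint H c d).corner x) = !o₂ x := by
      rintro (a | b)
      · by_cases h1 : a = c
        · subst h1
          exact (congrArg o₂ (if_pos rfl)).trans he
        by_cases h2 : a = G.corner c
        · have h3 : (G.joint H c d).corner (.inl a) = .inr (H.corner d) := (if_neg h1).trans (if_pos h2)
          rw [h3]
          change xor (o' (H.corner d)) e = !o a
          rw [key _ _ (ho' d).2.1, h2, (ho c).2.1, he]
        · rw [joint_corner_inl c d h1 h2]
          exact (ho a).2.1
      · by_cases h1 : b = d
        · subst h1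
          exact (congrArg o₂ (if_pos rfl)).trans he2
        by_cases h2 : b = H.corner d
        · have h3 : (G.joint H c d).corner (.inr b) = .inl (G.corner c) := (if_neg h1).trans (if_pos h2)
          rw [h3]
          change o (G.corner c) = !xor (o' b) e
          rw [h2, key _ _ (ho' d).2.1, (ho c).2.1, he2]
        · rw [joint_corner_inr c d h1 h2]
          exact key _ _ (ho' b).2.1
    rintro (a | b)
    · exact ⟨(ho a).1, k1 (.inl a), (ho a).2.2⟩
    · exact ⟨key _ _ (ho' b).1, k1 (.inr b), key _ _ (ho' b).2.2⟩

/-! ### Bouquets -/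

theorem IsBouquet.numComponents_eq (h : G.IsBouquet) : G.numComponents = 1 := by
  have h1 := numComponents_le_numVertices G
  have h2 : 0 < G.numComponents := by
    unfold numComponents
    by_cases h3 : G.isolated = 0
    · have h4 : Nat.card G.AttachedVertex ≠ 0 := by
        unfold IsBouquet numVertices at h
        omega
      obtain ⟨⟨a⟩⟩ := (Nat.card_ne_zero.1 h4).1
      have : 0 < Nat.card G.AttachedComponent := Nat.card_pos_iff.2 ⟨⟨G.componentOf a⟩, inferInstance⟩
      omega
    · omega
  unfold IsBouquet at h
  omega

theorem IsBouquet.rank_eq (h : G.IsBouquet) : G.rank = 0 := by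
  unfold rank
  rw [h.numComponents_eq, h]

theorem IsBouquet.nullity_eq (h : G.IsBouquet) : G.nullity = G.numEdges := by
  unfold nullity
  rw [h.rank_eq, Nat.sub_zero]

theorem isBouquet_joint (hG : G.IsBouquet) (hH : H.IsBouquet) : (G.joint H c d).IsBouquet := by
  have := joint_numVertices c d
  unfold IsBouquet at *
  omega

/-! ### Multiplicativity of the polynomial -/

variable {R : Type*} [CommRing R]

/-- If both parts are non-orientable, the whole contributes `w` once and the parts contribute it
twice. This is where idempotence is needed. -/
theorem pow_orientParam_mul {w : R} (hw : w = w ^ 2) {K : PinchedRibbonGraph}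
    (h : K.Orientable ↔ G.Orientable ∧ H.Orientable) :
    w ^ K.orientParam = w ^ G.orientParam * w ^ H.orientParam := by
  have hw' : w = w * w := hw.trans (sq w)
  unfold orientParam
  by_cases h1 : G.Orientable
  · by_cases h2 : H.Orientable
    · rw [if_pos h1, if_pos h2, if_pos (h.2 ⟨h1, h2⟩)]; simp
    · rw [if_pos h1, if_neg h2, if_neg fun h3 => h2 (h.1 h3).2]; simp
  · rw [if_neg h1, if_neg fun h3 => h1 (h.1 h3).1]
    by_cases h2 : H.Orientable
    · rw [if_pos h2]; simp
    · rw [if_neg h2]; simpa using hw'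

/-- All exponents except that of `w` are additive. The bounds on the ranks and on the circles are
there to rule out truncated subtraction. -/
theorem weight_disjointUnion (x y z : R) {w : R} (hw : w = w ^ 2) (t : R) {r₀ s₀ : ℕ}
    (hG : G.rank ≤ r₀) (hH : H.rank ≤ s₀) :
    weight x y z w t (r₀ + s₀) (G.disjointUnion H) =
      weight x y z w t r₀ G * weight x y z w t s₀ H := by
  have h1 := disjointUnion_rank G H
  have h2 := nullity_add (G.disjointUnion H)
  have h3 := nullity_add G
  have h4 := nullity_add H
  have h5 := disjointUnion_numEdges G H
  have h6 := numCircles_le G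
  have h7 := numCircles_le H
  unfold weight
  rw [pow_orientParam_mul hw (disjointUnion_orientable G H), disjointUnion_numHalfRibbons,
    disjointUnion_numCircles, disjointUnion_numComponents,
    show r₀ + s₀ - (G.disjointUnion H).rank = (r₀ - G.rank) + (s₀ - H.rank) by omega,
    show (G.disjointUnion H).nullity = G.nullity + H.nullity by omega,
    show G.numComponents + H.numComponents + (G.nullity + H.nullity) -
      (G.numCircles + H.numCircles) = (G.numComponents + G.nullity - G.numCircles) +
        (H.numComponents + H.nullity - H.numCircles) by omega]
  ring

/-- Bouquets have rank zero and one component. Both components and circles lose one under a joint,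
so the Euler genus is additive. -/
theorem weight_joint (x y z : R) {w : R} (hw : w = w ^ 2) (t : R)
    (hG : G.IsBouquet) (hH : H.IsBouquet) :
    weight x y z w t 0 (G.joint H c d) = weight x y z w t 0 G * weight x y z w t 0 H := by
  have hJ := isBouquet_joint c d hG hH
  have h6 := numCircles_le G
  have h7 := numCircles_le H
  have h8 := joint_numCircles c d
  rw [hG.numComponents_eq, hG.nullity_eq] at h6
  rw [hH.numComponents_eq, hH.nullity_eq] at h7
  unfold weight
  rw [pow_orientParam_mul hw (joint_orientable c d), joint_numHalfRibbons, hJ.numComponents_eq,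
    hJ.nullity_eq, hJ.rank_eq, hG.rank_eq, hH.rank_eq, hG.nullity_eq, hH.nullity_eq, joint_numEdges,
    hG.numComponents_eq, hH.numComponents_eq,
    show 1 + (G.numEdges + H.numEdges) - (G.joint H c d).numCircles =
      (1 + G.numEdges - G.numCircles) + (1 + H.numEdges - H.numCircles) by omega]
  ring

/-- Edge sets of a disjoint union. -/
def cutSetSumEquiv (G H : PinchedRibbonGraph) :
    (G.disjointUnion H).CutSet ≃ G.CutSet × H.CutSet where
  toFun C := (⟨Sum.inl ⁻¹' C.carrier, fun a h => C.arc_mem _ h, fun a h => C.side_mem _ h,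
      fun a h h' => C.edge _ h (congrArg Sum.inl h')⟩,
    ⟨Sum.inr ⁻¹' C.carrier, fun a h => C.arc_mem _ h, fun a h => C.side_mem _ h,
      fun a h h' => C.edge _ h (congrArg Sum.inr h')⟩)
  invFun C := ⟨{a | a.elim C.1.carrier C.2.carrier},
    by rintro (a | a) h; exacts [C.1.arc_mem _ h, C.2.arc_mem _ h],
    by rintro (a | a) h; exacts [C.1.side_mem _ h, C.2.side_mem _ h],
    by
      rintro (a | a) h h'
      exacts [C.1.edge _ h (Sum.inl_injective h'), C.2.edge _ h (Sum.inr_injective h')]⟩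
  left_inv C := by ext (a | a) <;> rfl
  right_inv C := rfl

/-- A joint has the same edge sets as a disjoint union. -/
def cutSetJointEquiv : (G.joint H c d).CutSet ≃ (G.disjointUnion H).CutSet where
  toFun C := ⟨C.carrier, C.arc_mem, C.side_mem, C.edge⟩
  invFun C := ⟨C.carrier, C.arc_mem, C.side_mem, C.edge⟩
  left_inv _ := rfl
  right_inv _ := rfl

theorem cutOn_side_disjointUnion (C : (G.disjointUnion H).CutSet) (a : G.Flag ⊕ H.Flag) :
    ((G.disjointUnion H).cutOn C).side a =
      ((G.cutOn (cutSetSumEquiv G H C).1).disjointUnion (H.cutOn (cutSetSumEquiv G H C).2)).side a := by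
  by_cases h : a ∈ C.carrier
  · refine (cutOn_side_of_mem h).trans ?_
    rcases a with a | a
    · exact congrArg Sum.inl (cutOn_side_of_mem (C := (cutSetSumEquiv G H C).1) h).symm
    · exact congrArg Sum.inr (cutOn_side_of_mem (C := (cutSetSumEquiv G H C).2) h).symm
  · refine (cutOn_side_of_notMem h).trans ?_
    rcases a with a | a
    · exact congrArg Sum.inl (cutOn_side_of_notMem (C := (cutSetSumEquiv G H C).1) h).symm
    · exact congrArg Sum.inr (cutOn_side_of_notMem (C := (cutSetSumEquiv G H C).2) h).symm

/-- Cutting the edges of a disjoint union. -/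
noncomputable def cutOnDisjointUnionIso (C : (G.disjointUnion H).CutSet) :
    ((G.disjointUnion H).cutOn C).Iso
      ((G.cutOn (cutSetSumEquiv G H C).1).disjointUnion (H.cutOn (cutSetSumEquiv G H C).2)) where
  toEquiv := Equiv.refl (G.Flag ⊕ H.Flag)
  map_arc _ := rfl
  map_corner _ := rfl
  map_side a := cutOn_side_disjointUnion C a
  isolated_eq := rfl

/-- Cutting the edges of a joint. -/
noncomputable def cutOnJointIso (C : (G.joint H c d).CutSet) :
    ((G.joint H c d).cutOn C).Iso
      ((G.cutOn (cutSetSumEquiv G H (cutSetJointEquiv c d C)).1).joint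
        (H.cutOn (cutSetSumEquiv G H (cutSetJointEquiv c d C)).2) c d) where
  toEquiv := Equiv.refl (G.Flag ⊕ H.Flag)
  map_arc _ := rfl
  map_corner _ := rfl
  map_side a := cutOn_side_disjointUnion (cutSetJointEquiv c d C) a
  isolated_eq := rfl

theorem polyR'_disjointUnion (x y z : R) {w : R} (hw : w = w ^ 2) (t : R) :
    (G.disjointUnion H).polyR' x y z w t = G.polyR' x y z w t * H.polyR' x y z w t := by
  rw [polyR'_eq_stateSum, polyR'_eq_stateSum, polyR'_eq_stateSum, disjointUnion_rank, stateSum,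
    stateSum, stateSum, Fintype.sum_mul_sum, ← Fintype.sum_prod_type']
  refine Fintype.sum_equiv (cutSetSumEquiv G H) _ _ fun C => ?_
  rw [(cutOnDisjointUnionIso C).weight_eq]
  exact weight_disjointUnion x y z hw t (rank_cutOn_le _) (rank_cutOn_le _)

theorem polyR'_joint (x y z : R) {w : R} (hw : w = w ^ 2) (t : R)
    (hG : G.IsBouquet) (hH : H.IsBouquet) :
    (G.joint H c d).polyR' x y z w t = G.polyR' x y z w t * H.polyR' x y z w t := by
  rw [polyR'_eq_stateSum, polyR'_eq_stateSum, polyR'_eq_stateSum, (isBouquet_joint c d hG hH).rank_eq,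
    hG.rank_eq, hH.rank_eq, stateSum, stateSum, stateSum, Fintype.sum_mul_sum,
    ← Fintype.sum_prod_type']
  refine Fintype.sum_equiv ((cutSetJointEquiv c d).trans (cutSetSumEquiv G H)) _ _ fun C => ?_
  rw [(cutOnJointIso c d C).weight_eq]
  exact weight_joint (G := G.cutOn (cutSetSumEquiv G H (cutSetJointEquiv c d C)).1)
    (H := H.cutOn (cutSetSumEquiv G H (cutSetJointEquiv c d C)).2) c d x y z hw t hG hH

/-- An edgeless graph is orientable. -/
theorem orientable_of_isEdgeless (h : G.IsEdgeless) : G.Orientable := by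
  obtain ⟨o, ho⟩ := QuotCount.exists_alternating G.arc_arc G.arc_ne G.corner_corner G.corner_ne
  refine ⟨o, fun a => ⟨(ho a).1, (ho a).2, ?_⟩⟩
  rw [(isEdgeless_iff G).1 h]
  exact (ho a).1

theorem weight_of_isEdgeless (h : G.IsEdgeless) (x y z w t : R) :
    weight x y z w t G.rank G = t ^ G.numHalfRibbons := by
  have h0 := (isEdgeless_iff G).1 h
  have hE := (isEdgeless_iff_numEdges G).1 h
  have h1 := numCircles_le G
  have h2 := nullity_add G
  have h3 : G.numCircles = G.numComponents := by
    refine congrArg (· + G.isolated) (QuotCount.card_eq_of_mutual ?_ ?_)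
    · rintro x y (h | h)
      · exact Quot.sound (Or.inr (Or.inl h))
      · exact Quot.sound (Or.inr (Or.inr h))
    · rintro x y (h | h | h)
      · exact Quot.sound (Or.inr (h.trans (h0 x).symm))
      · exact Quot.sound (Or.inl h)
      · exact Quot.sound (Or.inr h)
  unfold weight orientParam
  rw [if_pos (orientable_of_isEdgeless h), show G.nullity = 0 by omega, h3]
  simp

theorem polyR'_of_isEdgeless (h : G.IsEdgeless) (x y z w t : R) :
    G.polyR' x y z w t = t ^ G.numHalfRibbons := by
  let C₀ : G.CutSet := ⟨∅, fun _ h => h, fun _ h => h, fun _ h => h.elim⟩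
  have hC : ∀ C : G.CutSet, C = C₀ := by
    intro C
    ext a
    exact ⟨fun h' => C.edge a h' ((isEdgeless_iff G).1 h a), fun h => h.elim⟩
  have f : (G.cutOn C₀).Iso G := ⟨Equiv.refl G.Flag, fun _ => rfl, fun _ => rfl,
    fun a => cutOn_side_of_notMem (C := C₀) (a := a) (fun h => h.elim), rfl⟩
  rw [polyR'_eq_stateSum, stateSum, Fintype.sum_eq_single C₀ fun C h => (h (hC C)).elim,
    f.weight_eq, weight_of_isEdgeless h]

end PinchedRibbonGraph


/-! ### Evaluation of the polynomial on the three chord diagrams -/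

namespace QuotCount

/-- A certificate that `decide` can check: labels constant on the classes, and for each element an
alternating walk to the representative of its label. Fewer than eight double steps suffice for the
diagrams at hand, which have at most eight flags. -/
theorem card_eq_of_label {X : Type*} {f g : X → X} {n : ℕ} (L : X → Fin n) (rep : Fin n → X)
    (hf : ∀ a, L (f a) = L a) (hg : ∀ a, L (g a) = L a) (hrep : ∀ i, L (rep i) = i)
    (hconn : ∀ a, ∃ k : Fin 8, (f ∘ g)^[k] a = rep (L a) ∨ (f ∘ g)^[k] (g a) = rep (L a)) :
    Nat.card (Quot fun a b => b = f a ∨ b = g a) = n := by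
  set r := fun a b => b = f a ∨ b = g a
  have h1 : ∀ a, Quot.mk r (f a) = Quot.mk r a := fun a => by symm; exact Quot.sound (Or.inl rfl)
  have h2 : ∀ a, Quot.mk r (g a) = Quot.mk r a := fun a => by symm; exact Quot.sound (Or.inr rfl)
  have h3 : ∀ k a, Quot.mk r ((f ∘ g)^[k] a) = Quot.mk r a := by
    intro k
    induction k with
    | zero => intro a; rfl
    | succ k ih => intro a; rw [Function.iterate_succ_apply, ih, Function.comp, h1, h2]
  rw [← Nat.card_fin n]
  refine Nat.card_congr ⟨Quot.lift L ?_, fun i => Quot.mk r (rep i), ?_, hrep⟩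
  · rintro a b (rfl | rfl)
    exacts [(hf a).symm, (hg a).symm]
  · rintro ⟨a⟩
    obtain ⟨k, hk | hk⟩ := hconn a
    · exact (congrArg _ hk).symm.trans (h3 _ _)
    · exact (congrArg _ hk).symm.trans ((h3 _ _).trans (h2 a))

end QuotCount

namespace PinchedRibbonGraph

variable {R : Type*} [CommRing R]

theorem weight_of_isBouquet {G : PinchedRibbonGraph} (h : G.IsBouquet) {E c f : ℕ}
    (hE : Nat.card {a // G.side a ≠ G.arc a} = 4 * E) (hc : G.numCircles = c)
    (hf : Nat.card {a // G.side a = G.arc a} = 2 * f) (x y z w t : R) :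
    weight x y z w t 0 G =
      (y - 1) ^ E * z ^ (1 + E - c) * w ^ G.orientParam * t ^ f := by
  rw [← four_mul_numEdges] at hE
  rw [← two_mul_numHalfRibbons] at hf
  unfold weight
  rw [h.rank_eq, h.numComponents_eq, h.nullity_eq, hc, show G.numEdges = E by omega,
    show G.numHalfRibbons = f by omega]
  simp

section ChordDiagram

variable {m : ℕ} [NeZero m] {μ : Fin m → Fin m} {tw : Fin m → Bool} {hμ : ∀ p, μ (μ p) = p}
  {htw : ∀ p, tw (μ p) = tw p} {hfix : ∀ p, μ p = p → tw p = false}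

/-- An arc followed by a corner moves from the end `p` to the end `p + 1`, so one circle passes all
ends. -/
theorem isBouquet_chordDiagram : (chordDiagram m μ tw hμ htw hfix).IsBouquet := by
  set G := chordDiagram m μ tw hμ htw hfix
  let v : Fin m → G.AttachedVertex := fun p => G.vertexOf ((p, false) : Fin m × Bool)
  have h1 : ∀ p : Fin m, G.vertexOf ((p, true) : Fin m × Bool) = v p := fun p =>
    G.vertexOf_arc ((p, false) : Fin m × Bool)
  have h2 : ∀ p : Fin m, v (p + 1) = v p := fun p =>
    (G.vertexOf_corner ((p, true) : Fin m × Bool)).trans (h1 p)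
  have h3 : ∀ n : ℕ, v (Fin.ofNat m n) = v 0 := by
    intro n
    induction n with
    | zero => rfl
    | succ n ih =>
      rw [← ih, ← h2 (Fin.ofNat m n)]
      congr 1
      ext
      simp [Fin.val_add]
  have h4 : ∀ p, v p = v 0 := fun p => by
    rw [← h3 p.val, Fin.ofNat_val_eq_self]
  have : Nat.card G.AttachedVertex = 1 := by
    refine Nat.card_eq_one_iff_exists.2 ⟨v 0, ?_⟩
    rintro ⟨⟨p, _ | _⟩⟩
    exacts [h4 p, (h1 p).trans (h4 p)]
  exact congrArg (· + 0) this

variable (μ tw hμ htw hfix) in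
/-- A chord diagram with the chords marked by `b` cut. -/
def cutDiagram (b : Fin m → Bool) (hb : ∀ p, b (μ p) = b p) : PinchedRibbonGraph :=
  chordDiagram m (fun p => if b p then p else μ p) (fun p => !b p && tw p)
    (fun p => by by_cases h : b p <;> simp [h, hb, hμ])
    (fun p => by by_cases h : b p <;> simp [h, hb, htw])
    (fun p => by by_cases h : b p <;> simp [h]; exact hfix p)

/-- The edge sets of a diagram without half-chords are the `μ`-invariant markings of its ends. The
index type `S` is left free so that it can be `Bool` or `Bool × Bool`, over which the sum expands by
`simp` lemmas. -/
theorem stateSum_chordDiagram {S : Type*} [Fintype S] (b : S → Fin m → Bool)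
    (hb : ∀ i p, b i (μ p) = b i p) (hne : ∀ p, μ p ≠ p) (hinj : Function.Injective b)
    (hsurj : ∀ c : Fin m → Bool, (∀ p, c (μ p) = c p) → ∃ i, b i = c)
    {φ : PinchedRibbonGraph → R} (hφ : ∀ G H : PinchedRibbonGraph, G.Iso H → φ G = φ H) :
    stateSum φ (chordDiagram m μ tw hμ htw hfix) =
      ∑ i, φ (cutDiagram μ tw hμ htw hfix (b i) (hb i)) := by
  classical
  set G := chordDiagram m μ tw hμ htw hfix
  let f : S → G.CutSet := fun i =>
    { carrier := {a : Fin m × Bool | b i a.1 = true}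
      arc_mem := fun a h => h
      side_mem := fun a h => (hb i _).trans h
      edge := fun a _ h => hne _ (congrArg Prod.fst h) }
  have hf : Function.Bijective f := by
    constructor
    · intro i j h
      refine hinj (funext fun p => ?_)
      have h1 : ((p, false) : Fin m × Bool) ∈ (f i).carrier ↔
        ((p, false) : Fin m × Bool) ∈ (f j).carrier := by rw [h]
      exact Bool.eq_iff_iff.2 h1
    · intro C
      obtain ⟨i, hi⟩ := hsurj (fun p => decide (((p, false) : Fin m × Bool) ∈ C.carrier)) (by
        intro p
        refine decide_eq_decide.2 ?_
        have h1 := C.side_mem_iff (a := ((p, false) : Fin m × Bool))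
        have h2 := C.arc_mem_iff (a := ((μ p, false) : Fin m × Bool))
        cases h : tw p
        · have h3 : G.side ((p, false) : Fin m × Bool) = ((μ p, true) : Fin m × Bool) := by
            change (_, _) = _; simp [h]
          rw [h3] at h1
          exact h2.symm.trans h1
        · have h3 : G.side ((p, false) : Fin m × Bool) = ((μ p, false) : Fin m × Bool) := by
            change (_, _) = _; simp [h]
          rw [h3] at h1
          exact h1)
      refine ⟨i, CutSet.ext (Set.ext ?_)⟩
      rintro ⟨p, c⟩
      have h1 : b i p = decide (((p, false) : Fin m × Bool) ∈ C.carrier) := congrFun hi p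
      have h2 : ((p, c) : Fin m × Bool) ∈ (f i).carrier ↔
          ((p, false) : Fin m × Bool) ∈ C.carrier := by
        change b i p = true ↔ _
        rw [h1, decide_eq_true_iff]
      refine h2.trans ?_
      cases c
      · rfl
      · exact (C.arc_mem_iff (a := ((p, false) : Fin m × Bool))).symm
  refine (Fintype.sum_bijective f hf _ _ fun i => hφ _ _ ?_).symm
  refine ⟨Equiv.refl _, fun _ => rfl, fun _ => rfl, ?_, rfl⟩
  intro (a : Fin m × Bool)
  change ((if b i a.1 then a.1 else μ a.1, if !b i a.1 && tw a.1 then a.2 else !a.2) : Fin m × Bool) =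
    if a ∈ (f i).carrier then (a.1, !a.2) else (μ a.1, if tw a.1 then a.2 else !a.2)
  by_cases h : b i a.1
  · rw [if_pos (show a ∈ (f i).carrier from h)]; simp [h]
  · rw [if_neg (show a ∉ (f i).carrier from h)]; simp [h]

end ChordDiagram

section Weight

variable {m : ℕ} [NeZero m] {μ : Fin m → Fin m} {tw : Fin m → Bool}
  {hμ : ∀ p, μ (μ p) = p} {htw : ∀ p, tw (μ p) = tw p} {hfix : ∀ p, μ p = p → tw p = false}
  {b : Fin m → Bool} {hb : ∀ p, b (μ p) = b p}

/-- `E`, `f` and `n` are the numbers of edges, half-ribbons and boundary circles. Everything to be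
verified about them is packed into the one decidable hypothesis `h`. -/
theorem weight_cutDiagram {E f n o : ℕ} (L : Fin m × Bool → Fin n)
    (rep : Fin n → Fin m × Bool) (x y z w t : R)
    (h : let c : Fin m × Bool → Fin m × Bool :=
          fun a => if a.2 then (a.1 + 1, false) else (a.1 - 1, true)
        let s : Fin m × Bool → Fin m × Bool :=
          fun a => (if b a.1 then a.1 else μ a.1, if !b a.1 && tw a.1 then a.2 else !a.2)
        Fintype.card {a // s a ≠ (a.1, !a.2)} = 4 * E ∧
        Fintype.card {a // s a = (a.1, !a.2)} = 2 * f ∧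
        (∀ a, L (c a) = L a) ∧ (∀ a, L (s a) = L a) ∧ (∀ i, L (rep i) = i) ∧
        ∀ a, ∃ k : Fin 8, (c ∘ s)^[k] a = rep (L a) ∨ (c ∘ s)^[k] (s a) = rep (L a))
    (ho : (cutDiagram μ tw hμ htw hfix b hb).orientParam = o) :
    weight x y z w t 0 (cutDiagram μ tw hμ htw hfix b hb) =
      (y - 1) ^ E * z ^ (1 + E - n) * w ^ o * t ^ f := by
  subst ho
  obtain ⟨h1, h2, h3, h4, h5, h6⟩ := h
  rw [← Nat.card_eq_fintype_card] at h1 h2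
  refine weight_of_isBouquet isBouquet_chordDiagram ?_ ?_ ?_ x y z w t
  · exact h1
  · exact congrArg (· + 0) (QuotCount.card_eq_of_label L rep h3 h4 h5 h6)
  · exact h2

end Weight

theorem orientParam_of_orientable {G : PinchedRibbonGraph} (h : G.Orientable) :
    G.orientParam = 0 := if_pos h

theorem orientParam_of_not_orientable {G : PinchedRibbonGraph} (h : ¬ G.Orientable) :
    G.orientParam = 1 := if_neg h

theorem orientParam_cutDiagram {m : ℕ} [NeZero m] {μ : Fin m → Fin m} {tw : Fin m → Bool}
    {hμ : ∀ p, μ (μ p) = p} {htw : ∀ p, tw (μ p) = tw p} {hfix : ∀ p, μ p = p → tw p = false}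
    {b : Fin m → Bool} {hb : ∀ p, b (μ p) = b p} (h : ∀ p, (!b p && tw p) = false) :
    (cutDiagram μ tw hμ htw hfix b hb).orientParam = 0 :=
  orientParam_of_orientable ⟨Prod.snd, fun (a : Fin m × Bool) => ⟨rfl, by
    change (if a.2 then ((a.1 + 1, false) : Fin m × Bool) else (a.1 - 1, true)).2 = _
    cases a.2 <;> rfl, by
    change (if !b a.1 && tw a.1 then a.2 else !a.2) = _; rw [h]; rfl⟩⟩

theorem not_orientable_D1010 (hb) :
    ¬ (cutDiagram (m := 2) (fun p => p + 1) (fun _ => true) (by decide) (by decide) (by decide)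
      (fun _ => false) hb).Orientable := by
  rintro ⟨o, ho⟩
  change Fin 2 × Bool → Bool at o
  have h1 : o (0, true) = !o (0, false) := (ho ((0, false) : Fin 2 × Bool)).1
  have h2 : o (1, false) = !o (0, true) := (ho ((0, true) : Fin 2 × Bool)).2.1
  have h3 : o (1, false) = !o (0, false) := (ho ((0, false) : Fin 2 × Bool)).2.2
  rw [h2, h1] at h3
  simp at h3

/-- The two states are a disc with two half-ribbons and an annulus, of Euler genus zero. -/
theorem polyR'_D1000 (x y z w t : R) : D1000.polyR' x y z w t = (y - 1) + t ^ 2 := by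
  rw [polyR'_eq_stateSum, D1000, isBouquet_chordDiagram.rank_eq,
    stateSum_chordDiagram (fun i _ => i) (fun _ _ => rfl) (by decide) (by decide) (by decide)
      (fun G H f => f.weight_eq ..), Fintype.sum_bool,
    weight_cutDiagram (n := 1) (E := 0) (f := 2) (fun _ => 0) (fun _ => (0, false))
      (h := by decide) (ho := orientParam_cutDiagram (by decide)),
    weight_cutDiagram (n := 2) (E := 1) (f := 0)
      (fun a => if (a.1 = 0 ↔ a.2 = false) then 0 else 1) ![(0, false), (1, false)]
      (h := by decide) (ho := orientParam_cutDiagram (by decide))]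
  ring

/-- The two states are a disc with two half-ribbons and a Möbius band, non-orientable of Euler genus
one. -/
theorem polyR'_D1010 (x y z w t : R) : D1010.polyR' x y z w t = (y - 1) * z * w + t ^ 2 := by
  rw [polyR'_eq_stateSum, D1010, isBouquet_chordDiagram.rank_eq,
    stateSum_chordDiagram (fun i _ => i) (fun _ _ => rfl) (by decide) (by decide) (by decide)
      (fun G H f => f.weight_eq ..), Fintype.sum_bool,
    weight_cutDiagram (n := 1) (E := 0) (f := 2) (fun _ => 0) (fun _ => (0, false))
      (h := by decide) (ho := orientParam_cutDiagram (by decide)),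
    weight_cutDiagram (n := 1) (E := 1) (f := 0) (fun _ => 0) (fun _ => (0, false))
      (h := by decide) (ho := orientParam_of_not_orientable (not_orientable_D1010 _))]
  ring

/-- With both chords kept the surface is a torus with one boundary circle, of Euler genus two. With
one chord kept it is an annulus carrying two half-ribbons, and with none a disc carrying four. -/
theorem polyR'_D2100 (x y z w t : R) :
    D2100.polyR' x y z w t = (y - 1) ^ 2 * z ^ 2 + 2 * ((y - 1) * t ^ 2) + t ^ 4 := by
  have hb : ∀ (i : Bool × Bool) (p : Fin 4),
      (if p + 2 = 0 ∨ p + 2 = 2 then i.1 else i.2) = if p = 0 ∨ p = 2 then i.1 else i.2 := by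
    decide
  rw [polyR'_eq_stateSum, D2100, isBouquet_chordDiagram.rank_eq,
    stateSum_chordDiagram
      (fun (i : Bool × Bool) (p : Fin 4) => if p = 0 ∨ p = 2 then i.1 else i.2) hb
      (by decide) (by decide) (by decide)
      (fun G H f => f.weight_eq ..), Fintype.sum_prod_type, Fintype.sum_bool, Fintype.sum_bool,
      Fintype.sum_bool,
    weight_cutDiagram (n := 1) (E := 0) (f := 4) (fun _ => 0) (fun _ => (0, false))
      (h := by decide) (ho := orientParam_cutDiagram (by decide)),
    weight_cutDiagram (n := 2) (E := 1) (f := 2)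
      (fun a => if a.1 = 0 ∨ a = (1, false) ∨ a = (3, true) then 0 else 1)
      ![(0, false), (2, false)]
      (h := by decide) (ho := orientParam_cutDiagram (by decide)),
    weight_cutDiagram (n := 2) (E := 1) (f := 2)
      (fun a => if a.1 = 1 ∨ a = (2, false) ∨ a = (0, true) then 0 else 1)
      ![(1, false), (3, false)]
      (h := by decide) (ho := orientParam_cutDiagram (by decide)),
    weight_cutDiagram (n := 1) (E := 2) (f := 0) (fun _ => 0) (fun _ => (0, false))
      (h := by decide) (ho := orientParam_cutDiagram (by decide))]
  ring

end PinchedRibbonGraph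


/-! ### The recursion rules, and their validity for the polynomial -/

namespace PinchedRibbonGraph

variable {R : Type*} [CommRing R]

/-- The recursion rules of the state-sum polynomial for a function on a class `M` of graphs. -/
structure Recursive (M : Set PinchedRibbonGraph) (α β t : R) (F : PinchedRibbonGraph → R) :
    Prop where
  iso : ∀ G ∈ M, ∀ H ∈ M, Nonempty (G.Iso H) → F G = F H
  regular : ∀ G ∈ M, ∀ e : G.Edge, G.IsRegularEdge e → F G = F (G.cut e) + F (G.contract e)
  bridge : ∀ G ∈ M, ∀ e : G.Edge, G.IsBridge e → F G = β * F (G.contract e)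
  union : ∀ G ∈ M, ∀ H ∈ M, G.disjointUnion H ∈ M → F (G.disjointUnion H) = F G * F H
  joint : ∀ G ∈ M, ∀ H ∈ M, G.IsBouquet → H.IsBouquet → ∀ (c : G.Flag) (d : H.Flag),
    G.joint H c d ∈ M → α * F (G.joint H c d) = F G * F H
  edgeless : ∀ E ∈ M, E.IsEdgeless → F E = α ^ E.numVertices * t ^ E.numHalfRibbons

theorem IsEdgeless.numComponents_eq {G : PinchedRibbonGraph} (h : G.IsEdgeless) :
    G.numComponents = G.numVertices := by
  have h1 := (isEdgeless_iff_numEdges G).1 h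
  have h2 := nullity_add G
  have h3 := rank_add G
  omega

/-- The power of `α` counts components, which neither contraction of a non-loop edge nor the cut of
a regular edge changes. For joints of bouquets, two components become one, whence the factor `α` in
that rule. -/
theorem recursive_polyR' (M : Set PinchedRibbonGraph) (α x y u : R) {v : R} (hv : v = v ^ 2)
    (t : R) : Recursive M α ((x - 1) * t ^ 2 + 1) t
      fun G => α ^ G.numComponents * G.polyR' x y u v t where
  iso := by
    rintro G - H - ⟨f⟩
    rw [f.numComponents_eq, f.polyR'_eq]
  regular := by
    rintro G - e ⟨h1, h2⟩
    obtain ⟨b, hb, rfl⟩ := exists_edgeOf e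
    rw [isLoop_edgeOf_iff] at h2
    have h3 := h1
    rw [isBridge_edgeOf_iff, not_not] at h3
    rw [polyR'_of_not_isBridge hb _ _ _ _ _ h2 h1, contract_numComponents h2,
      cut_numComponents_of_eq h3, mul_add]
  bridge := by
    rintro G - e h
    obtain ⟨b, hb, rfl⟩ := exists_edgeOf e
    have hnl := mt isLoop_edgeOf_iff.2 (not_isLoop_of_isBridge h)
    rw [polyR'_of_isBridge hb _ _ _ _ _ h, contract_numComponents hnl]
    ring
  union := by
    rintro G - H - -
    rw [polyR'_disjointUnion _ _ _ hv, disjointUnion_numComponents]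
    ring
  joint := by
    rintro G - H - hG hH c d -
    rw [polyR'_joint _ _ _ _ _ hv _ hG hH, (isBouquet_joint c d hG hH).numComponents_eq,
      hG.numComponents_eq, hH.numComponents_eq]
    ring
  edgeless := by
    rintro E - hE
    rw [polyR'_of_isEdgeless hE, hE.numComponents_eq]

theorem isEdgeless_D0001 : D0001.IsEdgeless :=
  (isEdgeless_iff _).2 fun _ => rfl

theorem numHalfRibbons_D0001 : D0001.numHalfRibbons = 1 := by
  have h := two_mul_numHalfRibbons D0001
  have h1 : Nat.card {a // D0001.side a = D0001.arc a} = Nat.card (Fin 1 × Bool) :=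
    Nat.card_congr (Equiv.subtypeUnivEquiv fun _ => rfl)
  have h2 : Nat.card (Fin 1 × Bool) = 2 := by simp
  omega

end PinchedRibbonGraph


/-! ### Handle slides as two contractions of one two-vertex graph -/

namespace PinchedRibbonGraph

variable {G H : PinchedRibbonGraph}

/-- The ribbons of `G`, glued along new vertex circles. -/
abbrev withCorner (G : PinchedRibbonGraph) (κ : G.Flag → G.Flag)
    (h : (∀ a, κ (κ a) = a) ∧ ∀ a, κ a ≠ a) : PinchedRibbonGraph :=
  { G with
    corner := κ
    corner_corner := h.1
    corner_ne := h.2 }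

theorem mem_edgeOf_iff {b x : G.Flag} {hb : G.side b ≠ G.arc b} :
    G.ribbonOf x = (G.edgeOf b hb).1 ↔ x = b ∨ x = G.arc b ∨ x = G.side b ∨ x = G.arc (G.side b) :=
  ribbonOf_eq_iff _

theorem next_of_notMem {e : G.Edge} {x y : G.Flag} (hx : G.corner x = y)
    (hy : G.ribbonOf y ≠ e.1) : G.next e x = y := by
  subst hx
  exact if_neg hy

theorem next_of_mem {e : G.Edge} {x y z : G.Flag} (hx : G.corner x = y)
    (hy : G.ribbonOf y = e.1) (hz : G.corner (G.side y) = z) (hz' : G.ribbonOf z ≠ e.1) :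
    G.next e x = z := by
  subst hx hz
  exact (if_pos hy).trans (if_neg hz')

/-- A contraction is recognised from an injection of flags whose image omits exactly the edge. `hI`
excludes the creation of an isolated vertex. -/
theorem contract_iso {b : G.Flag} {hb : G.side b ≠ G.arc b}
    (hnl : G.vertexOf b ≠ G.vertexOf (G.side b)) (g : H.Flag → G.Flag)
    (hinj : Function.Injective g) (hrange : ∀ x, x ∈ Set.range g ↔ G.ribbonOf x ≠ (G.edgeOf b hb).1)
    (harc : ∀ x, g (H.arc x) = G.arc (g x)) (hside : ∀ x, g (H.side x) = G.side (g x))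
    (hcorner : ∀ x, g (H.corner x) = G.next (G.edgeOf b hb) (g x))
    (hI : ¬ G.IsIsolatedEdge b) (hi : H.isolated = G.isolated) :
    Nonempty (H.Iso (G.contract (G.edgeOf b hb))) := by
  refine ⟨⟨Equiv.ofBijective (fun x => ⟨g x, (hrange _).1 ⟨x, rfl⟩⟩) ⟨?_, ?_⟩, ?_, ?_, ?_, ?_⟩⟩
  · intro x y h
    exact hinj (congrArg Subtype.val h)
  · rintro ⟨y, hy⟩
    obtain ⟨x, rfl⟩ := (hrange y).2 hy
    exact ⟨x, rfl⟩
  · exact fun x => Subtype.ext (harc x)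
  · exact fun x => Subtype.ext (hcorner x)
  · exact fun x => Subtype.ext (hside x)
  · classical rw [contract_isolated hnl, if_neg hI, hi]; rfl

/-- The end with flags `a` and `arc a` may be slid over the ribbon of `corner a`. -/
structure Slidable (G : PinchedRibbonGraph) (a : G.Flag) : Prop where
  edge : G.side (G.corner a) ≠ G.arc (G.corner a)
  off : G.ribbonOf a ≠ G.ribbonOf (G.corner a)
  ne_side : G.corner (G.arc a) ≠ G.side (G.corner a)
  ne_arc : G.corner (G.arc a) ≠ G.arc (G.corner a)
  corner_ne : G.corner (G.side (G.corner a)) ≠ G.arc (G.side (G.corner a))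

theorem Slidable.off' {a : G.Flag} (h : G.Slidable a) : a ≠ G.corner a ∧ a ≠ G.arc (G.corner a) ∧
    a ≠ G.side (G.corner a) ∧ a ≠ G.arc (G.side (G.corner a)) := by
  have := h.off
  rw [ne_eq, ribbonOf_eq_iff] at this
  tauto

open Classical in
/-- The corners after the end at `a` and the end at `corner a` have been moved to a new vertex that
also carries one end of a new edge. -/
noncomputable def expandCorner (G : PinchedRibbonGraph) (a : G.Flag) :
    G.Flag ⊕ Bool × Bool → G.Flag ⊕ Bool × Bool :=
  Sum.elim
    -- The new edge has the flags `(i, j)`: `j` is `false` at the new vertex and `true` at the old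
    -- one, and `i` is `true` on the side next to the end at `a` and `false` on the side next to the
    -- end at `corner a`.
    (fun x => if x = G.arc (G.corner a) then .inr (false, false)
      else if x = G.arc a then .inr (true, false)
      else if x = G.corner (G.arc a) then .inr (true, true)
      else if x = G.corner (G.arc (G.corner a)) then .inr (false, true)
      else .inl (G.corner x))
    (fun i => if i.2 then .inl (G.corner (G.arc (if i.1 then a else G.corner a)))
      else .inl (G.arc (if i.1 then a else G.corner a)))

theorem expandCorner_ff (a : G.Flag) :
    G.expandCorner a (.inr (false, false)) = .inl (G.arc (G.corner a)) := rfl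

theorem expandCorner_tf (a : G.Flag) :
    G.expandCorner a (.inr (true, false)) = .inl (G.arc a) := rfl

theorem expandCorner_ft (a : G.Flag) :
    G.expandCorner a (.inr (false, true)) = .inl (G.corner (G.arc (G.corner a))) := rfl

theorem expandCorner_inl {a x : G.Flag} (h1 : x ≠ G.arc (G.corner a)) (h2 : x ≠ G.arc a)
    (h3 : x ≠ G.corner (G.arc a)) (h4 : x ≠ G.corner (G.arc (G.corner a))) :
    G.expandCorner a (.inl x) = .inl (G.corner x) :=
  (if_neg h1).trans ((if_neg h2).trans ((if_neg h3).trans (if_neg h4)))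

theorem expandCorner_expandCorner {a : G.Flag} (h : G.Slidable a) (x : G.Flag ⊕ Bool × Bool) :
    G.expandCorner a (G.expandCorner a x) = x := by
  have cc := G.corner_corner; have cn := G.corner_ne; have aa := G.arc_arc
  have an := G.arc_ne
  have h1 := h.ne_arc
  have h2 := h.off'
  rcases x with (x | ⟨_ | _, _ | _⟩) <;> simp only [expandCorner, Sum.elim_inl, Sum.elim_inr]
  · split_ifs <;> simp only [Sum.elim_inl, Sum.elim_inr] <;> grind
  all_goals grind

/-- The graph with the end at `a` and the end at `corner a` moved to a new vertex, joined to the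
old one by a new edge. -/
noncomputable abbrev expand (G : PinchedRibbonGraph) (a : G.Flag) (h : G.Slidable a) :
    PinchedRibbonGraph where
  Flag := G.Flag ⊕ Bool × Bool
  finite := by have := G.finite; infer_instance
  isolated := G.isolated
  arc := Sum.map G.arc fun i => (!i.1, i.2)
  side := Sum.map G.side fun i => (i.1, !i.2)
  corner := G.expandCorner a
  arc_arc := by rintro (x | x) <;> simp [G.arc_arc]
  side_side := by rintro (x | x) <;> simp [G.side_side]
  arc_side := by rintro (x | x) <;> simp [G.arc_side]
  arc_ne := by rintro (x | ⟨_ | _, _ | _⟩) <;> simp [G.arc_ne]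
  side_ne := by rintro (x | ⟨_ | _, _ | _⟩) <;> simp [G.side_ne]
  corner_ne := by
    have := G.corner_ne
    rintro (x | ⟨_ | _, _ | _⟩) <;> simp only [expandCorner, Sum.elim_inl, Sum.elim_inr]
    · split_ifs <;> simp [this]
    all_goals simp
  corner_corner := expandCorner_expandCorner h

section Expand

variable {a : G.Flag}

theorem expandCorner_inl_arc (h : G.Slidable a) :
    G.expandCorner a (.inl (G.arc (G.corner a))) = .inr (false, false) :=
  expandCorner_expandCorner h (.inr (false, false))

theorem expandCorner_inl_arc' (h : G.Slidable a) : G.expandCorner a (.inl (G.arc a)) = .inr (true, false) :=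
  expandCorner_expandCorner h (.inr (true, false))

theorem expandCorner_inl_corner (h : G.Slidable a) :
    G.expandCorner a (.inl (G.corner (G.arc a))) = .inr (true, true) :=
  expandCorner_expandCorner h (.inr (true, true))

theorem expandCorner_inl_corner' (h : G.Slidable a) :
    G.expandCorner a (.inl (G.corner (G.arc (G.corner a)))) = .inr (false, true) :=
  expandCorner_expandCorner h (.inr (false, true))

/-- The new vertex. -/
def expandVertex (a : G.Flag) : Set (G.Flag ⊕ Bool × Bool) :=
  {.inl a, .inl (G.arc a), .inl (G.corner a), .inl (G.arc (G.corner a)),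
    .inr (false, false), .inr (true, false)}

theorem expandVertex_closed (h : G.Slidable a) (x : G.Flag ⊕ Bool × Bool) (hx : x ∈ expandVertex a) :
    Sum.map G.arc (fun i => (!i.1, i.2)) x ∈ expandVertex a ∧ G.expandCorner a x ∈ expandVertex a := by
  have cc := G.corner_corner; have cn := G.corner_ne; have aa := G.arc_arc
  have an := G.arc_ne
  have o := h.off'
  have n1 := h.ne_arc
  have n2 := h.ne_side
  have c1 : G.expandCorner a (.inl a) = .inl (G.corner a) := by
    apply expandCorner_inl <;> grind
  have c2 : G.expandCorner a (.inl (G.corner a)) = .inl a := by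
    rw [← c1, expandCorner_expandCorner h]
  simp only [expandVertex, Set.mem_insert_iff, Set.mem_singleton_iff] at hx ⊢
  rcases hx with rfl | rfl | rfl | rfl | rfl | rfl
  · rw [c1]; exact ⟨by simp, by simp⟩
  · rw [expandCorner_inl_arc' h]; exact ⟨by simp [aa], by simp⟩
  · rw [c2]; exact ⟨by simp, by simp⟩
  · rw [expandCorner_inl_arc h]; exact ⟨by simp [aa], by simp⟩
  · exact ⟨by simp, by simp [expandCorner_ff]⟩
  · exact ⟨by simp, by simp [expandCorner_tf]⟩

variable (h : G.Slidable a)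

theorem expand_vertexOf_ne {x y : G.Flag ⊕ Bool × Bool} (hx : x ∈ expandVertex a)
    (hy : y ∉ expandVertex a) : (G.expand a h).vertexOf x ≠ (G.expand a h).vertexOf y := by
  intro e
  have hcl := expandVertex_closed h
  let f : (G.expand a h).AttachedVertex → Prop := Quot.lift (fun x => x ∈ expandVertex a) (by
    rintro x _ (rfl | rfl)
    · exact propext ⟨fun hx => (hcl x hx).1, fun hx =>
        (congrArg (· ∈ expandVertex a) ((G.expand a h).arc_arc x)).mp (hcl _ hx).1⟩
    · exact propext ⟨fun hx => (hcl x hx).2, fun hx => by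
        have := (hcl _ hx).2; rwa [expandCorner_expandCorner h] at this⟩)
  have h1 : f ((G.expand a h).vertexOf x) = f ((G.expand a h).vertexOf y) := congrArg f e
  exact hy (h1.mp hx)

theorem side_notMem_expandVertex {a : G.Flag} (h : G.Slidable a) : .inl (G.side (G.corner a)) ∉ expandVertex a := by
  have o := h.off'
  have aa := G.arc_arc; have ss := G.side_side; have as := G.arc_side
  have e := h.edge
  have sn := G.side_ne
  simp only [expandVertex, Set.mem_insert_iff, Set.mem_singleton_iff, Sum.inl.injEq]
  grind

theorem inr_notMem_expandVertex (i : Bool) : .inr (i, true) ∉ expandVertex a := by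
  simp [expandVertex]

theorem expand_edge : (G.expand a h).side (.inr (false, false)) ≠
    (G.expand a h).arc (.inr (false, false)) := by
  simp [expand]

theorem expand_edge' : (G.expand a h).side (.inl (G.corner a)) ≠
    (G.expand a h).arc (.inl (G.corner a)) := by
  intro e
  exact h.edge (Sum.inl_injective e)

theorem expand_nonloop : (G.expand a h).vertexOf (.inr (false, false)) ≠
    (G.expand a h).vertexOf ((G.expand a h).side (.inr (false, false))) :=
  expand_vertexOf_ne h (by simp [expandVertex]) (inr_notMem_expandVertex false)

theorem expand_nonloop' : (G.expand a h).vertexOf (.inl (G.corner a)) ≠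
    (G.expand a h).vertexOf ((G.expand a h).side (.inl (G.corner a))) :=
  expand_vertexOf_ne h (by simp [expandVertex]) (side_notMem_expandVertex h)

theorem expand_mem_iff (x : G.Flag ⊕ Bool × Bool) :
    (G.expand a h).ribbonOf x = ((G.expand a h).edgeOf _ (expand_edge h)).1 ↔ ∃ i, x = .inr i := by
  rw [mem_edgeOf_iff]
  constructor
  · rintro (rfl | rfl | rfl | rfl) <;> exact ⟨_, rfl⟩
  · rintro ⟨⟨_ | _, _ | _⟩, rfl⟩
    exacts [.inl rfl, .inr (.inr (.inl rfl)), .inr (.inl rfl), .inr (.inr (.inr rfl))]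

/-- Walking around the new edge leads from each end moved away straight to its former neighbour, so
contracting that edge undoes the expansion. -/
theorem expand_contract :
    Nonempty (G.Iso ((G.expand a h).contract ((G.expand a h).edgeOf _ (expand_edge h)))) := by
  have cc := G.corner_corner
  have hr : ∀ i, (G.expand a h).ribbonOf (.inr i) =
    ((G.expand a h).edgeOf _ (expand_edge h)).1 := fun i => (expand_mem_iff h _).2 ⟨i, rfl⟩
  have hl : ∀ x, (G.expand a h).ribbonOf (.inl x) ≠
    ((G.expand a h).edgeOf _ (expand_edge h)).1 := fun x e => by
      obtain ⟨_, e⟩ := (expand_mem_iff h _).1 e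
      cases e
  have key : ∀ x : G.Flag, (Sum.inl (G.corner x) : G.Flag ⊕ Bool × Bool) =
      (G.expand a h).next ((G.expand a h).edgeOf _ (expand_edge h)) (.inl x) := by
    intro x
    symm
    by_cases h1 : x = G.arc (G.corner a)
    · subst h1
      exact next_of_mem (expandCorner_inl_arc h) (hr _) rfl (hl _)
    by_cases h2 : x = G.arc a
    · subst h2
      exact next_of_mem (expandCorner_inl_arc' h) (hr _) rfl (hl _)
    by_cases h3 : x = G.corner (G.arc a)
    · subst h3
      exact next_of_mem (expandCorner_inl_corner h) (hr _) (congrArg _ (cc _).symm) (hl _)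
    by_cases h4 : x = G.corner (G.arc (G.corner a))
    · subst h4
      exact next_of_mem (expandCorner_inl_corner' h) (hr _) (congrArg _ (cc _).symm) (hl _)
    exact next_of_notMem (expandCorner_inl h1 h2 h3 h4) (hl _)
  refine contract_iso (expand_nonloop h) Sum.inl Sum.inl_injective ?_ (fun _ => rfl)
    (fun _ => rfl) key ?_ rfl
  · rintro (x | x)
    · exact ⟨fun _ => hl x, fun _ => ⟨x, rfl⟩⟩
    · exact ⟨by rintro ⟨y, ⟨⟩⟩, fun hx => absurd (hr x) hx⟩
  · rintro ⟨h1, -⟩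
    cases h1

open Classical in
/-- The corners after the end at `a` has been slid along the ribbon of `corner a`. -/
noncomputable def slideCorner (G : PinchedRibbonGraph) (a x : G.Flag) : G.Flag :=
  if x = G.corner a then G.corner (G.arc a)
  else if x = G.corner (G.arc a) then G.corner a
  else if x = G.side (G.corner a) then G.arc a
  else if x = G.arc a then G.side (G.corner a)
  else if x = a then G.corner (G.side (G.corner a))
  else if x = G.corner (G.side (G.corner a)) then a
  else G.corner x

theorem slideCorner_corner (a : G.Flag) : G.slideCorner a (G.corner a) = G.corner (G.arc a) := if_pos rfl

theorem slideCorner_corner_arc (h : G.Slidable a) : G.slideCorner a (G.corner (G.arc a)) = G.corner a := by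
  have cc := G.corner_corner; have cn := G.corner_ne; have aa := G.arc_arc
  have an := G.arc_ne; have sn := G.side_ne
  have o := h.off'
  have n2 := h.ne_side
  unfold slideCorner
  grind

theorem slideCorner_side (h : G.Slidable a) : G.slideCorner a (G.side (G.corner a)) = G.arc a := by
  have cc := G.corner_corner; have cn := G.corner_ne; have aa := G.arc_arc
  have an := G.arc_ne; have sn := G.side_ne
  have o := h.off'
  have n2 := h.ne_side
  unfold slideCorner
  grind

theorem slideCorner_arc (h : G.Slidable a) : G.slideCorner a (G.arc a) = G.side (G.corner a) := by
  have cc := G.corner_corner; have cn := G.corner_ne; have aa := G.arc_arc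
  have an := G.arc_ne; have sn := G.side_ne
  have o := h.off'
  have n2 := h.ne_side
  unfold slideCorner
  grind

theorem slideCorner_self (h : G.Slidable a) : G.slideCorner a (a) = G.corner (G.side (G.corner a)) := by
  have cc := G.corner_corner; have cn := G.corner_ne; have aa := G.arc_arc
  have an := G.arc_ne; have sn := G.side_ne
  have o := h.off'
  have n2 := h.ne_side
  unfold slideCorner
  grind

theorem slideCorner_corner_side (h : G.Slidable a) : G.slideCorner a (G.corner (G.side (G.corner a))) = a := by
  have cc := G.corner_corner; have cn := G.corner_ne; have aa := G.arc_arc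
  have an := G.arc_ne; have sn := G.side_ne
  have o := h.off'
  have n2 := h.ne_side
  unfold slideCorner
  grind

theorem slideCorner_of_ne {x : G.Flag} (h1 : x ≠ G.corner a) (h2 : x ≠ G.corner (G.arc a))
    (h3 : x ≠ G.side (G.corner a)) (h4 : x ≠ G.arc a) (h5 : x ≠ a)
    (h6 : x ≠ G.corner (G.side (G.corner a))) : G.slideCorner a x = G.corner x :=
  (if_neg h1).trans <| (if_neg h2).trans <| (if_neg h3).trans <| (if_neg h4).trans <|
    (if_neg h5).trans (if_neg h6)

theorem slideCorner_involutive (h : G.Slidable a) :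
    (∀ x, G.slideCorner a (G.slideCorner a x) = x) ∧ ∀ x, G.slideCorner a x ≠ x := by
  have cc := G.corner_corner; have cn := G.corner_ne; have aa := G.arc_arc
  have an := G.arc_ne; have sn := G.side_ne
  have o := h.off'
  have n2 := h.ne_side
  have s1 := slideCorner_corner a
  have s2 := slideCorner_corner_arc h
  have s3 := slideCorner_side h
  have s4 := slideCorner_arc h
  have s5 := slideCorner_self h
  have s6 := slideCorner_corner_side h
  have s7 := fun x => slideCorner_of_ne (G := G) (a := a) (x := x)
  have key : ∀ x, G.slideCorner a (G.slideCorner a x) = x ∧ G.slideCorner a x ≠ x := by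
    intro x
    by_cases h1 : x = G.corner a
    · subst h1; grind
    by_cases h2 : x = G.corner (G.arc a)
    · subst h2; grind
    by_cases h3 : x = G.side (G.corner a)
    · subst h3; grind
    by_cases h4 : x = G.arc a
    · subst h4; grind
    by_cases h5 : x = a
    · subst h5; grind
    by_cases h6 : x = G.corner (G.side (G.corner a))
    · subst h6; grind
    rw [s7 x h1 h2 h3 h4 h5 h6]
    refine ⟨?_, cn x⟩
    rw [s7, cc] <;> grind
  exact ⟨fun x => (key x).1, fun x => (key x).2⟩

theorem expand_mem_iff' (x : G.Flag ⊕ Bool × Bool) :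
    (G.expand a h).ribbonOf x = ((G.expand a h).edgeOf _ (expand_edge' h)).1 ↔
      ∃ y, x = .inl y ∧ G.ribbonOf y = G.ribbonOf (G.corner a) := by
  rw [mem_edgeOf_iff]
  constructor
  · rintro (rfl | rfl | rfl | rfl)
    exacts [⟨_, rfl, rfl⟩, ⟨_, rfl, G.ribbonOf_arc _⟩, ⟨_, rfl, G.ribbonOf_side _⟩,
      ⟨_, rfl, (G.ribbonOf_arc _).trans (G.ribbonOf_side _)⟩]
  · rintro ⟨y, rfl, hy⟩
    rcases G.ribbonOf_eq_iff.1 hy with rfl | rfl | rfl | rfl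
    exacts [.inl rfl, .inr (.inl rfl), .inr (.inr (.inl rfl)), .inr (.inr (.inr rfl))]

open Classical in
/-- The new edge of `expand` takes the place of the edge at `corner a`. -/
noncomputable def slideMap (G : PinchedRibbonGraph) (a x : G.Flag) : G.Flag ⊕ Bool × Bool :=
  if x = G.corner a then .inr (true, true)
  else if x = G.arc (G.corner a) then .inr (false, true)
  else if x = G.side (G.corner a) then .inr (true, false)
  else if x = G.arc (G.side (G.corner a)) then .inr (false, false)
  else .inl x

theorem slideMap_corner (a : G.Flag) : G.slideMap a (G.corner a) = .inr (true, true) := if_pos rfl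

theorem slideMap_arc (a : G.Flag) : G.slideMap a (G.arc (G.corner a)) = .inr (false, true) :=
  (if_neg (G.arc_ne _)).trans (if_pos rfl)

theorem slideMap_side (h : G.Slidable a) :
    G.slideMap a (G.side (G.corner a)) = .inr (true, false) :=
  (if_neg (G.side_ne _)).trans ((if_neg h.edge).trans (if_pos rfl))

theorem slideMap_arc_side (h : G.Slidable a) :
    G.slideMap a (G.arc (G.side (G.corner a))) = .inr (false, false) :=
  (if_neg fun e => h.edge (by rw [← e, G.arc_arc, e])).trans
    ((if_neg fun e => G.side_ne (G.corner a) (by rw [← G.arc_arc (G.side _), e, G.arc_arc])).trans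
      ((if_neg (G.arc_ne _)).trans (if_pos rfl)))

theorem slideMap_of_ne {x : G.Flag} (hx : G.ribbonOf x ≠ G.ribbonOf (G.corner a)) :
    G.slideMap a x = .inl x := by
  rw [ne_eq, ribbonOf_eq_iff, not_or, not_or, not_or] at hx
  exact (if_neg hx.1).trans ((if_neg hx.2.1).trans ((if_neg hx.2.2.1).trans (if_neg hx.2.2.2)))

/-- Contracting the edge at `corner a` merges the new vertex with the vertex at the far end of that
edge. The end at `a` is thereby carried to the far end, and the new edge occupies the place of the
contracted one. The cases are the six flags whose corners the slide changes, the other flags of the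
replaced edge, and the flags adjacent to it. The subcases arise when one end of the replaced edge is
a direct neighbour of the other or of the slid end. -/
theorem next_slideMap (x : G.Flag) : G.slideMap a (G.slideCorner a x) =
    (G.expand a h).next ((G.expand a h).edgeOf _ (expand_edge' h)) (G.slideMap a x) := by
  have cc := G.corner_corner; have cn := G.corner_ne; have aa := G.arc_arc
  have an := G.arc_ne; have ss := G.side_side; have sn := G.side_ne; have as := G.arc_side
  have o := h.off'
  have n1 := h.ne_arc
  have n2 := h.ne_side
  have n3 := h.corner_ne
  have ne := h.edge
  have hin : ∀ y, G.ribbonOf y = G.ribbonOf (G.corner a) → (G.expand a h).ribbonOf (.inl y) =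
      ((G.expand a h).edgeOf _ (expand_edge' h)).1 := fun y hy => (expand_mem_iff' h _).2 ⟨y, rfl, hy⟩
  have hout : ∀ y, G.ribbonOf y ≠ G.ribbonOf (G.corner a) → (G.expand a h).ribbonOf (.inl y) ≠
      ((G.expand a h).edgeOf _ (expand_edge' h)).1 := fun y hy e => by
    obtain ⟨_, ⟨⟩, h⟩ := (expand_mem_iff' h _).1 e
    exact hy h
  have hnew : ∀ i, (G.expand a h).ribbonOf (.inr i) ≠
      ((G.expand a h).edgeOf _ (expand_edge' h)).1 := fun i e => by
    obtain ⟨_, ⟨⟩, _⟩ := (expand_mem_iff' h _).1 e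
  have r0 : G.ribbonOf (G.arc (G.corner a)) = G.ribbonOf (G.corner a) := G.ribbonOf_arc _
  have r1 : G.ribbonOf (G.side (G.corner a)) = G.ribbonOf (G.corner a) := G.ribbonOf_side _
  have r2 : G.ribbonOf (G.arc (G.side (G.corner a))) = G.ribbonOf (G.corner a) :=
    (G.ribbonOf_arc _).trans r1
  have m1 := slideMap_corner (G := G) a
  have m2 := slideMap_arc (G := G) a
  have m3 := slideMap_side h
  have m4 := slideMap_arc_side h
  have m5 := fun x => slideMap_of_ne (G := G) (a := a) (x := x)
  have k1 := expandCorner_inl_arc h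
  have k2 := expandCorner_inl_arc' h
  have k3 := expandCorner_inl_corner h
  have k4 := expandCorner_inl_corner' h
  have k5 := fun x => expandCorner_inl (G := G) (a := a) (x := x)
  have ra : G.ribbonOf a ≠ G.ribbonOf (G.corner a) := h.off
  have raa : G.ribbonOf (G.arc a) ≠ G.ribbonOf (G.corner a) := by rwa [G.ribbonOf_arc]
  have rc : G.ribbonOf (G.corner (G.arc a)) = G.ribbonOf (G.corner a) →
      G.corner (G.arc a) = G.arc (G.side (G.corner a)) := by
    rw [ribbonOf_eq_iff]; grind
  have rd : G.ribbonOf (G.corner (G.side (G.corner a))) = G.ribbonOf (G.corner a) →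
      G.corner (G.side (G.corner a)) = G.arc (G.corner a) := by
    rw [ribbonOf_eq_iff]; grind
  have kb' : G.corner (G.side (G.corner a)) ≠ G.arc (G.corner a) →
      G.expandCorner a (.inl (G.side (G.corner a))) = .inl (G.corner (G.side (G.corner a))) := by
    intro hd; apply k5 <;> grind
  have ka : G.expandCorner a (.inl a) = .inl (G.corner a) := by apply k5 <;> grind
  have sl : G.side (G.arc (G.corner a)) = G.arc (G.side (G.corner a)) := (as _).symm
  have sl' : G.side (G.arc (G.side (G.corner a))) = G.arc (G.corner a) := by rw [← as, ss]
  have s1 := slideCorner_corner a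
  have s2 := slideCorner_corner_arc h
  have s3 := slideCorner_side h
  have s4 := slideCorner_arc h
  have s5 := slideCorner_self h
  have s6 := slideCorner_corner_side h
  have s7 := fun x => slideCorner_of_ne (G := G) (a := a) (x := x)
  symm
  by_cases x1 : x = G.corner a
  · subst x1
    rw [m1, s1]
    by_cases hc : G.corner (G.arc a) = G.arc (G.side (G.corner a))
    · rw [hc, m4]
      refine next_of_mem (y := Sum.inl (G.arc (G.side (G.corner a)))) ?_ (hin _ r2) ?_ (hnew _)
      · exact congrArg _ hc
      · exact (congrArg (fun y => G.expandCorner a (.inl y)) sl').trans k1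
    · rw [m5 _ (mt rc hc)]
      exact next_of_notMem rfl (hout _ (mt rc hc))
  by_cases x2 : x = G.corner (G.arc a)
  · subst x2
    rw [s2, m1]
    by_cases hc : G.corner (G.arc a) = G.arc (G.side (G.corner a))
    · rw [hc, m4]
      refine next_of_mem (expandCorner_ff a) (hin _ r0) ?_ (hnew _)
      exact (congrArg (fun y => G.expandCorner a (.inl y)) (sl.trans hc.symm)).trans k3
    · rw [m5 _ (mt rc hc)]
      exact next_of_notMem k3 (hnew _)
  by_cases x3 : x = G.side (G.corner a)
  · subst x3
    rw [s3, m3, m5 _ raa]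
    exact next_of_notMem rfl (hout _ raa)
  by_cases x4 : x = G.arc a
  · subst x4
    rw [s4, m3, m5 _ raa]
    exact next_of_notMem k2 (hnew _)
  by_cases x5 : x = a
  · subst x5
    rw [s5, m5 _ ra]
    by_cases hd : G.corner (G.side (G.corner x)) = G.arc (G.corner x)
    · rw [hd, m2]
      refine next_of_mem ka (hin _ rfl) ?_ (hnew _)
      rw [← k4, ← hd, cc]
      rfl
    · rw [m5 _ (mt rd hd)]
      exact next_of_mem ka (hin _ rfl) (kb' hd) (hout _ (mt rd hd))
  by_cases x6 : x = G.corner (G.side (G.corner a))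
  · subst x6
    rw [s6, m5 _ ra]
    have kb : G.expandCorner a (.inl (G.side (G.side (G.corner a)))) = .inl a := by
      rw [ss, ← ka]; exact expandCorner_expandCorner h _
    by_cases hd : G.corner (G.side (G.corner a)) = G.arc (G.corner a)
    · rw [hd, m2]
      refine next_of_mem (y := Sum.inl (G.side (G.corner a))) ?_ (hin _ r1) ?_ (hout _ ra)
      · exact (expandCorner_ft a).trans (congrArg Sum.inl (by rw [← hd, cc]))
      · exact kb
    · rw [m5 _ (mt rd hd)]
      refine next_of_mem (y := Sum.inl (G.side (G.corner a))) ?_ (hin _ r1) ?_ (hout _ ra)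
      · rw [← kb' hd]
        exact expandCorner_expandCorner h _
      · exact kb
  rw [s7 x x1 x2 x3 x4 x5 x6]
  by_cases y1 : x = G.arc (G.corner a)
  · subst y1
    rw [m2]
    by_cases hy : G.corner (G.arc (G.corner a)) = G.arc (G.side (G.corner a))
    · rw [hy, m4]
      refine next_of_mem (y := Sum.inl (G.arc (G.side (G.corner a)))) (congrArg _ hy) (hin _ r2) ?_
        (hnew _)
      exact (congrArg (fun y => G.expandCorner a (.inl y)) sl').trans k1
    · have : G.ribbonOf (G.corner (G.arc (G.corner a))) ≠ G.ribbonOf (G.corner a) := by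
        rw [ne_eq, ribbonOf_eq_iff]; grind
      rw [m5 _ this]
      exact next_of_notMem rfl (hout _ this)
  by_cases y2 : x = G.arc (G.side (G.corner a))
  · subst y2
    rw [m4]
    by_cases hy : G.corner (G.arc (G.side (G.corner a))) = G.arc (G.corner a)
    · rw [hy, m2]
      refine next_of_mem (expandCorner_ff a) (hin _ r0) ?_ (hnew _)
      refine (congrArg (fun y => G.expandCorner a (.inl y)) (sl.trans ?_)).trans k4
      rw [← hy, cc]
    · have : G.ribbonOf (G.corner (G.arc (G.side (G.corner a)))) ≠ G.ribbonOf (G.corner a) := by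
        rw [ne_eq, ribbonOf_eq_iff]; grind
      rw [m5 _ this]
      refine next_of_mem (expandCorner_ff a) (hin _ r0) ?_ (hout _ this)
      refine (congrArg (fun y => G.expandCorner a (.inl y)) sl).trans ?_
      apply k5 <;> grind
  have hx : G.ribbonOf x ≠ G.ribbonOf (G.corner a) := by
    rw [ne_eq, ribbonOf_eq_iff]; grind
  rw [m5 x hx]
  by_cases z1 : x = G.corner (G.arc (G.corner a))
  · subst z1
    rw [cc, m2]
    exact next_of_notMem k4 (hnew _)
  have kx : G.expandCorner a (.inl x) = .inl (G.corner x) := k5 x y1 x4 x2 z1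
  by_cases z2 : G.corner x = G.arc (G.side (G.corner a))
  · rw [z2, m4]
    refine next_of_mem kx (hin _ (by rw [z2, r2])) ?_ (hnew _)
    exact (congrArg (fun y => G.expandCorner a (.inl y)) (by rw [z2, sl'])).trans k1
  · have : G.ribbonOf (G.corner x) ≠ G.ribbonOf (G.corner a) := by
      rw [ne_eq, ribbonOf_eq_iff]; grind
    rw [m5 _ this]
    exact next_of_notMem kx (hout _ this)

/-- The counterpart of `expand_contract`: the same expanded graph contracts to `G` along the new
edge and to the slid graph along the edge at `corner a`. -/
theorem expand_contract' :
    Nonempty ((G.withCorner (G.slideCorner a) (slideCorner_involutive h)).Iso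
      ((G.expand a h).contract ((G.expand a h).edgeOf _ (expand_edge' h)))) := by
  have aa := G.arc_arc; have an := G.arc_ne
  have ss := G.side_side; have sn := G.side_ne; have as := G.arc_side
  have ne := h.edge
  have hm1 := slideMap_corner (G := G) a
  have hm2 := slideMap_arc (G := G) a
  have hm3 := slideMap_side h
  have hm4 := slideMap_arc_side h
  have hm5 := fun x => slideMap_of_ne (G := G) (a := a) (x := x)
  refine contract_iso (expand_nonloop' h) (G.slideMap a) ?_ ?_ ?_ ?_ (next_slideMap h) ?_ rfl
  · intro (x : G.Flag) (y : G.Flag) e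
    unfold slideMap at e
    grind
  · have hnew : ∀ i, (G.expand a h).ribbonOf (.inr i) ≠
        ((G.expand a h).edgeOf _ (expand_edge' h)).1 := fun i e => by
      obtain ⟨_, ⟨⟩, _⟩ := (expand_mem_iff' h _).1 e
    rintro (x | ⟨_ | _, _ | _⟩)
    · rw [ne_eq, expand_mem_iff']
      constructor
      · rintro ⟨y, hy⟩ ⟨_, ⟨⟩, e⟩
        rcases G.ribbonOf_eq_iff.1 e with rfl | rfl | rfl | rfl <;> unfold slideMap at hy <;> grind
      · intro hx
        exact ⟨x, hm5 x fun e => hx ⟨x, rfl, e⟩⟩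
    · exact iff_of_true ⟨_, hm4⟩ (hnew _)
    · exact iff_of_true ⟨_, hm2⟩ (hnew _)
    · exact iff_of_true ⟨_, hm3⟩ (hnew _)
    · exact iff_of_true ⟨_, hm1⟩ (hnew _)
  · intro (x : G.Flag)
    change G.slideMap a (G.arc x) = Sum.map _ _ (G.slideMap a x)
    by_cases hx : G.ribbonOf x = G.ribbonOf (G.corner a)
    · rcases G.ribbonOf_eq_iff.1 hx with rfl | rfl | rfl | rfl
      · rw [hm1, hm2]; rfl
      · rw [aa, hm1, hm2]; rfl
      · rw [hm3, hm4]; rfl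
      · rw [aa, hm3, hm4]; rfl
    · rw [hm5 x hx, hm5 _ (by rwa [G.ribbonOf_arc])]; rfl
  · intro (x : G.Flag)
    change G.slideMap a (G.side x) = Sum.map _ _ (G.slideMap a x)
    by_cases hx : G.ribbonOf x = G.ribbonOf (G.corner a)
    · rcases G.ribbonOf_eq_iff.1 hx with rfl | rfl | rfl | rfl
      · rw [hm1, hm3]; rfl
      · rw [← as, hm2, hm4]; rfl
      · rw [ss, hm1, hm3]; rfl
      · rw [← as, ss, hm2, hm4]; rfl
    · rw [hm5 x hx, hm5 _ (by rwa [G.ribbonOf_side])]; rfl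
  · rintro ⟨h1, -⟩
    have h2 : G.expandCorner a (.inl (G.arc (G.corner a))) = .inl (G.corner a) :=
      (congrArg _ h1.symm).trans ((G.expand a h).corner_corner _)
    rw [expandCorner_inl_arc h] at h2
    cases h2

end Expand

end PinchedRibbonGraph


/-! ### Agreement of two recursive functions along non-loop edges and handle slides -/

namespace PinchedRibbonGraph

variable {R : Type*} [CommRing R] {G H : PinchedRibbonGraph}

theorem vertexOf_eq_of_numVertices_le (h : G.numVertices ≤ 2) {a b c : G.Flag}
    (hab : G.vertexOf a ≠ G.vertexOf b) (hac : G.vertexOf a ≠ G.vertexOf c) :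
    G.vertexOf b = G.vertexOf c := by
  by_contra hbc
  have : Nat.card (Fin 3) ≤ Nat.card G.AttachedVertex := by
    refine Nat.card_le_card_of_injective ![G.vertexOf a, G.vertexOf b, G.vertexOf c] ?_
    intro i j
    fin_cases i <;> fin_cases j <;> simp [hab, hac, hbc, Ne.symm hab, Ne.symm hac, Ne.symm hbc]
  rw [Nat.card_fin] at this
  unfold numVertices at h
  omega

/-- With an isolated disc added, the bouquet has two vertices and belongs to `M`; the disc may then
be deleted. -/
theorem isBouquet_mem {M : Set PinchedRibbonGraph} (hM : MinorClosed M)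
    (hM2 : ∀ G : PinchedRibbonGraph, G.numVertices = 2 → G ∈ M) (hG : G.IsBouquet) : G ∈ M := by
  let V : PinchedRibbonGraph :=
    { Flag := Empty
      finite := inferInstance
      isolated := 1
      arc := id
      corner := id
      side := id
      arc_arc := fun a => a.elim
      corner_corner := fun a => a.elim
      side_side := fun a => a.elim
      arc_ne := fun a => a.elim
      corner_ne := fun a => a.elim
      side_ne := fun a => a.elim
      arc_side := fun a => a.elim }
  have hV : V.numVertices = 1 := by
    have : IsEmpty V.AttachedVertex := ⟨by rintro ⟨⟨⟩⟩⟩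
    unfold numVertices
    rw [Nat.card_of_isEmpty, Nat.zero_add]
  refine hM.deleteVertex hV ((isEdgeless_iff _).2 fun a => a.elim) (hM2 _ ?_)
  rw [disjointUnion_numVertices, hG, hV]

variable {M : Set PinchedRibbonGraph} {α β t : R} {F F' : PinchedRibbonGraph → R}

/-- A non-loop edge is a bridge or regular, and either rule expresses the value through graphs with
one edge less. -/
theorem Recursive.eq_of_nonloop (hM : MinorClosed M) (hF : Recursive M α β t F)
    (hF' : Recursive M α β t F') {n : ℕ} (hG : G ∈ M) (hn : G.numEdges ≤ n)
    (IH : ∀ H ∈ M, H.numEdges < n → F H = F' H) {b : G.Flag} (hb : G.side b ≠ G.arc b)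
    (hnl : G.vertexOf b ≠ G.vertexOf (G.side b)) : F G = F' G := by
  have h1 := cut_numEdges (hb := hb)
  have h2 := contract_numEdges (hb := hb)
  have h3 := IH _ (hM.cut hG (G.edgeOf b hb)) (by omega)
  have h4 := IH _ (hM.contract hG (G.edgeOf b hb)) (by omega)
  by_cases h : G.IsBridge (G.edgeOf b hb)
  · rw [hF.bridge G hG _ h, hF'.bridge G hG _ h, h4]
  · have hr : G.IsRegularEdge (G.edgeOf b hb) := ⟨h, fun h' => hnl (isLoop_edgeOf_iff.1 h')⟩
    rw [hF.regular G hG _ hr, hF'.regular G hG _ hr, h3, h4]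

section Expand

variable {a : G.Flag} (h : G.Slidable a)

theorem expand_numVertices (hG : G.IsBouquet) : (G.expand a h).numVertices = 2 := by
  obtain ⟨f⟩ := expand_contract h
  have h1 := contract_numVertices (hb := expand_edge h) (expand_nonloop h)
  have h2 : G.numVertices = 1 := hG
  rw [← f.numVertices_eq, h2] at h1
  exact h1.symm

theorem expand_numEdges : (G.expand a h).numEdges = G.numEdges + 1 := by
  obtain ⟨f⟩ := expand_contract h
  rw [f.numEdges_eq]
  exact contract_numEdges.symm

/-- The expanded graph has exactly two vertices, and both the new edge and the edge at `corner a`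
join them. Cutting the new edge therefore leaves a connection along the other one;
`expand_not_isBridge'` exchanges the roles. -/
theorem expand_not_isBridge (hG : G.IsBouquet) :
    ¬ (G.expand a h).IsBridge ((G.expand a h).edgeOf _ (expand_edge h)) := by
  rw [isBridge_edgeOf_iff, not_not]
  have hv := expand_numVertices h hG
  have hne : (G.expand a h).ribbonOf (.inl (G.arc (G.corner a))) ≠
      (G.expand a h).ribbonOf (.inr (false, false)) := fun e => by
    obtain ⟨_, ⟨⟩⟩ := (expand_mem_iff h _).1 e
  set X := G.expand a h
  set Y := X.cut (X.edgeOf _ (expand_edge h))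
  have h1 : X.vertexOf (.inr (false, true)) = X.vertexOf (.inl (G.side (G.arc (G.corner a)))) := by
    refine vertexOf_eq_of_numVertices_le hv.le (a := .inr (false, false))
      (expand_vertexOf_ne h (by simp [expandVertex]) (inr_notMem_expandVertex false))
      (expand_vertexOf_ne h (by simp [expandVertex]) ?_)
    intro hm
    have := (expandVertex_closed h _ hm).1
    rw [Sum.map_inl, G.arc_side, G.arc_arc] at this
    exact side_notMem_expandVertex h this
  have h2 : Y.componentOf (.inr (false, true)) =
    Y.componentOf (.inl (G.side (G.arc (G.corner a)))) := componentOf_eq_of_vertexOf (G := Y) h1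
  have h3 : Y.componentOf (.inl (G.side (G.arc (G.corner a)))) =
      Y.componentOf (.inl (G.arc (G.corner a))) := by
    have := componentOf_side (G := Y) (.inl (G.arc (G.corner a)))
    rwa [cut_side_of_ne (G := X) (expand_edge h) hne] at this
  have h4 : Y.componentOf (.inl (G.arc (G.corner a))) = Y.componentOf (.inr (false, false)) :=
    componentOf_corner (G := Y) (.inr (false, false))
  exact (h2.trans (h3.trans h4)).symm

theorem expand_not_isBridge' (hG : G.IsBouquet) :
    ¬ (G.expand a h).IsBridge ((G.expand a h).edgeOf _ (expand_edge' h)) := by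
  rw [isBridge_edgeOf_iff, not_not]
  have hv := expand_numVertices h hG
  have hne : (G.expand a h).ribbonOf (.inr (false, false)) ≠
      (G.expand a h).ribbonOf (.inl (G.corner a)) := fun e => by
    obtain ⟨_, ⟨⟩, _⟩ := (expand_mem_iff' h _).1 e
  set X := G.expand a h
  set Y := X.cut (X.edgeOf _ (expand_edge' h))
  have h1 : X.vertexOf (.inr (false, true)) = X.vertexOf (.inl (G.side (G.corner a))) :=
    vertexOf_eq_of_numVertices_le hv.le (a := .inr (false, false))
      (expand_vertexOf_ne h (by simp [expandVertex]) (inr_notMem_expandVertex false))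
      (expand_vertexOf_ne h (by simp [expandVertex]) (side_notMem_expandVertex h))
  have h2 : Y.componentOf (.inr (false, true)) =
    Y.componentOf (.inl (G.side (G.corner a))) := componentOf_eq_of_vertexOf (G := Y) h1
  have h3 : Y.componentOf (.inr (false, true)) = Y.componentOf (.inr (false, false)) := by
    have := componentOf_side (G := Y) (.inr (false, false))
    rwa [cut_side_of_ne (G := X) (expand_edge' h) hne] at this
  have h4 : Y.componentOf (.inl (G.arc (G.corner a))) = Y.componentOf (.inr (false, false)) :=
    componentOf_corner (G := Y) (.inr (false, false))
  have h5 : Y.componentOf (.inl (G.arc (G.corner a))) = Y.componentOf (.inl (G.corner a)) :=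
    componentOf_arc (G := Y) (.inl (G.corner a))
  exact h5.symm.trans (h4.trans (h3.symm.trans h2))

end Expand

/-- The value at the expanded graph is computed along each of its two parallel edges. Both cut
graphs have no more than `n` edges and still contain a non-loop edge, so they are settled by `IH`.
This leaves the discrepancy `F - F'` the same at `G` and at its slide. -/
theorem Recursive.eq_of_slide (hM : MinorClosed M)
    (hM2 : ∀ G : PinchedRibbonGraph, G.numVertices = 2 → G ∈ M) (hF : Recursive M α β t F)
    (hF' : Recursive M α β t F') {n : ℕ} (hG : G.IsBouquet) (hn : G.numEdges ≤ n)
    (IH : ∀ H ∈ M, H.numEdges < n → F H = F' H) {a : G.Flag} (h : G.Slidable a)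
    (hs : F (G.withCorner _ (slideCorner_involutive h)) =
      F' (G.withCorner _ (slideCorner_involutive h))) : F G = F' G := by
  obtain ⟨f⟩ := expand_contract h
  obtain ⟨g⟩ := expand_contract' h
  have hv := expand_numVertices h hG
  have hE := expand_numEdges h
  have b1 := expand_not_isBridge h hG
  have b2 := expand_not_isBridge' h hG
  have hX := hM2 _ hv
  have c1 := hM.cut hX ((G.expand a h).edgeOf _ (expand_edge h))
  have c2 := hM.cut hX ((G.expand a h).edgeOf _ (expand_edge' h))
  have d1 := hM.contract hX ((G.expand a h).edgeOf _ (expand_edge h))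
  have d2 := hM.contract hX ((G.expand a h).edgeOf _ (expand_edge' h))
  have e1 := cut_numEdges (hb := expand_edge h)
  have e2 := cut_numEdges (hb := expand_edge' h)
  have hGM := isBouquet_mem hM hM2 hG
  have hSM := hM.iso ⟨g.symm⟩ d2
  have hne : (G.expand a h).ribbonOf (.inr (false, false)) ≠
      (G.expand a h).ribbonOf (.inl (G.corner a)) := fun e => by
    obtain ⟨_, ⟨⟩, _⟩ := (expand_mem_iff' h _).1 e
  have u1 : F ((G.expand a h).cut ((G.expand a h).edgeOf _ (expand_edge h))) =
      F' ((G.expand a h).cut ((G.expand a h).edgeOf _ (expand_edge h))) := by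
    have hs := cut_side_of_ne (G := G.expand a h) (expand_edge h) hne.symm
    refine hF.eq_of_nonloop hM hF' c1 (by omega) IH (b := .inl (G.corner a)) ?_ ?_
    · rw [hs]; exact expand_edge' h
    · rw [hs]; exact expand_nonloop' h
  have u2 : F ((G.expand a h).cut ((G.expand a h).edgeOf _ (expand_edge' h))) =
      F' ((G.expand a h).cut ((G.expand a h).edgeOf _ (expand_edge' h))) := by
    have hs := cut_side_of_ne (G := G.expand a h) (expand_edge' h) hne
    refine hF.eq_of_nonloop hM hF' c2 (by omega) IH (b := .inr (false, false)) ?_ ?_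
    · rw [hs]; exact expand_edge h
    · rw [hs]; exact expand_nonloop h
  have r1 : (G.expand a h).IsRegularEdge ((G.expand a h).edgeOf _ (expand_edge h)) :=
    ⟨b1, fun l => expand_nonloop h (isLoop_edgeOf_iff.1 l)⟩
  have r2 : (G.expand a h).IsRegularEdge ((G.expand a h).edgeOf _ (expand_edge' h)) :=
    ⟨b2, fun l => expand_nonloop' h (isLoop_edgeOf_iff.1 l)⟩
  have p1 := hF.regular _ hX _ r1
  have p2 := hF.regular _ hX _ r2
  have p1' := hF'.regular _ hX _ r1
  have p2' := hF'.regular _ hX _ r2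
  rw [← hF.iso _ hGM _ d1 ⟨f⟩] at p1
  rw [← hF'.iso _ hGM _ d1 ⟨f⟩] at p1'
  rw [← hF.iso _ hSM _ d2 ⟨g⟩] at p2
  rw [← hF'.iso _ hSM _ d2 ⟨g⟩] at p2'
  -- The values at the expanded graph cancel between `p1` and `p2`, and likewise for `F'`.
  linear_combination p1' - p1 + p2 - p2' - u1 + u2 + hs

end PinchedRibbonGraph


/-! ### Cyclic words of ribbon ends, and the effect of a slide on them -/

namespace PinchedRibbonGraph

variable {G : PinchedRibbonGraph} {κ κ' : G.Flag → G.Flag}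

/-- The corners `κ` lead from the flag `b` through the ribbon ends entered at the members of `L`
to the flag `c`. -/
def Seg (G : PinchedRibbonGraph) (κ : G.Flag → G.Flag) : G.Flag → List G.Flag → G.Flag → Prop
  | b, [], c => κ b = c
  | b, a :: L, c => κ b = a ∧ G.Seg κ (G.arc a) L c

theorem seg_nil {b c : G.Flag} : G.Seg κ b [] c ↔ κ b = c := Iff.rfl

theorem seg_cons {a b c : G.Flag} {L : List G.Flag} :
    G.Seg κ b (a :: L) c ↔ κ b = a ∧ G.Seg κ (G.arc a) L c := Iff.rfl

theorem seg_append {b c q : G.Flag} {L₁ L₂ : List G.Flag} :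
    G.Seg κ b (L₁ ++ q :: L₂) c ↔ G.Seg κ b L₁ q ∧ G.Seg κ (G.arc q) L₂ c := by
  induction L₁ generalizing b with
  | nil => rfl
  | cons a L₁ ih => rw [List.cons_append, seg_cons, seg_cons, ih, and_assoc]

/-- A segment survives new corners if they agree with the old ones along its interior. The
conditions on memberships restrict the comparison to steps actually taken, and the two end points
may be replaced. -/
theorem Seg.change {b b' c c' : G.Flag} {L : List G.Flag} (h : G.Seg κ b L c)
    (h1 : κ b ∈ L → κ' b' = κ b) (h2 : κ b = c → κ' b' = c')
    (h3 : ∀ u ∈ L, κ (G.arc u) ∈ L → κ' (G.arc u) = κ (G.arc u))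
    (h4 : ∀ u ∈ L, κ (G.arc u) = c → κ' (G.arc u) = c') : G.Seg κ' b' L c' := by
  induction L generalizing b b' with
  | nil => exact h2 h
  | cons a L ih =>
    obtain ⟨rfl, h⟩ := h
    refine ⟨h1 (List.mem_cons_self ..), ih h ?_ ?_ ?_ ?_⟩
    · exact fun hL => h3 _ (List.mem_cons_self ..) (List.mem_cons_of_mem _ hL)
    · exact h4 _ (List.mem_cons_self ..)
    · exact fun u hu hL => h3 u (List.mem_cons_of_mem _ hu) (List.mem_cons_of_mem _ hL)
    · exact fun u hu => h4 u (List.mem_cons_of_mem _ hu)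

theorem Seg.apply_mem {b c : G.Flag} {L : List G.Flag} (h : G.Seg κ b L c) :
    (κ b ∈ L ∨ κ b = c) ∧ ∀ u ∈ L, κ (G.arc u) ∈ L ∨ κ (G.arc u) = c := by
  induction L generalizing b with
  | nil => exact ⟨.inr h, fun u hu => by simp at hu⟩
  | cons a L ih =>
    obtain ⟨h1, h2⟩ := ih h.2
    refine ⟨.inl (h.1 ▸ List.mem_cons_self ..), fun u hu => ?_⟩
    rcases List.mem_cons.1 hu with rfl | hu
    · exact h1.imp_left (List.mem_cons_of_mem _)
    · exact (h2 u hu).imp_left (List.mem_cons_of_mem _)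

/-- The ribbon ends entered at `p :: L` make up one vertex circle of the corners `κ`, which carries
all the ribbon ends. -/
structure Round (G : PinchedRibbonGraph) (κ : G.Flag → G.Flag) (p : G.Flag) (L : List G.Flag) :
    Prop where
  seg : G.Seg κ (G.arc p) L p
  nodup : (p :: L).Nodup
  arc_notMem : ∀ x ∈ p :: L, G.arc x ∉ p :: L
  cover : ∀ x, x ∈ p :: L ∨ G.arc x ∈ p :: L

theorem Round.rotate {p q : G.Flag} {L₁ L₂ : List G.Flag} (h : G.Round κ p (L₁ ++ q :: L₂)) :
    G.Round κ q (L₂ ++ p :: L₁) := by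
  have hp : (q :: (L₂ ++ p :: L₁)).Perm (p :: (L₁ ++ q :: L₂)) :=
    List.perm_append_comm (l₁ := q :: L₂) (l₂ := p :: L₁)
  have hmem : ∀ x, x ∈ q :: (L₂ ++ p :: L₁) ↔ x ∈ p :: (L₁ ++ q :: L₂) := fun x => hp.mem_iff
  refine ⟨seg_append.2 (seg_append.1 h.seg).symm, hp.nodup_iff.2 h.nodup, ?_, ?_⟩
  · simpa only [hmem] using h.arc_notMem
  · simpa only [hmem] using h.cover

section Slide

variable {p q z : G.Flag} {Y Q : List G.Flag} (hκ : (∀ a, κ (κ a) = a) ∧ ∀ a, κ a ≠ a)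

/-- The entry `y` between `z` and `q` is essential: with `z` directly before `q`, the slide over the
ribbon of `p` would lead nowhere. -/
theorem Round.slidable (hq : q = G.arc (G.side p)) {y : G.Flag}
    (h : G.Round κ p (z :: (y :: Y) ++ q :: Q)) : (G.withCorner κ hκ).Slidable z := by
  have aa := G.arc_arc; have ss := G.side_side; have as := G.arc_side
  have an := G.arc_ne; have sn := G.side_ne
  have h1 := h.nodup
  have h2 := h.arc_notMem
  have h3 := h.seg
  rw [seg_append] at h3
  obtain ⟨⟨h3, h4, h5⟩, h6⟩ := h3
  simp only [List.nodup_cons, List.mem_cons, List.cons_append, List.mem_append, not_or] at h1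
  simp only [List.mem_cons, List.cons_append, List.mem_append, not_or] at h2
  have hz : κ z = G.arc p := by rw [← h3, hκ.1]
  have h7 := h5.apply_mem
  refine ⟨?_, ?_, ?_, ?_, ?_⟩
  · change G.side (κ z) ≠ G.arc (κ z)
    grind
  · change ¬ G.ribbonOf z = G.ribbonOf (κ z)
    rw [ribbonOf_eq_iff]
    grind
  · change κ (G.arc z) ≠ G.side (κ z)
    grind
  · change κ (G.arc z) ≠ G.arc (κ z)
    grind
  · change κ (G.side (κ z)) ≠ G.arc (G.side (κ z))
    have := h6.apply_mem.1
    grind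

/-- Over an untwisted ribbon with ends `p` and `q`, the end just after `p` travels to the place just
before `q`, with its direction of passage preserved. -/
theorem Round.slide (hq : q = G.arc (G.side p)) {y : G.Flag}
    (h : G.Round κ p (z :: (y :: Y) ++ q :: Q)) :
    G.Round ((G.withCorner κ hκ).slideCorner z) p ((y :: Y) ++ z :: q :: Q) := by
  have hS := h.slidable hκ hq
  have hp : (p :: ((y :: Y) ++ z :: q :: Q)).Perm (p :: (z :: (y :: Y) ++ q :: Q)) :=
    List.Perm.cons _ List.perm_middle
  have hmem := fun x => hp.mem_iff (a := x)
  refine ⟨?_, hp.nodup_iff.2 h.nodup, ?_, ?_⟩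
  rotate_left
  · simpa only [hmem] using h.arc_notMem
  · simpa only [hmem] using h.cover
  have s1 : (G.withCorner κ hκ).slideCorner z (κ z) = κ (G.arc z) := slideCorner_corner _
  have s3 : (G.withCorner κ hκ).slideCorner z (G.side (κ z)) = G.arc z := slideCorner_side hS
  have s4 : (G.withCorner κ hκ).slideCorner z (G.arc z) = G.side (κ z) := slideCorner_arc hS
  have s6 : (G.withCorner κ hκ).slideCorner z (κ (G.side (κ z))) = z := slideCorner_corner_side hS
  have s7 : ∀ x, x ≠ κ z → x ≠ κ (G.arc z) → x ≠ G.side (κ z) → x ≠ G.arc z → x ≠ z →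
    x ≠ κ (G.side (κ z)) → (G.withCorner κ hκ).slideCorner z x = κ x :=
    fun x => slideCorner_of_ne (G := G.withCorner κ hκ)
  obtain ⟨κ', hκ'⟩ : ∃ k : G.Flag → G.Flag, k = (G.withCorner κ hκ).slideCorner z := ⟨_, rfl⟩
  rw [← hκ'] at s1 s3 s4 s6 s7 ⊢
  clear hκ'
  clear hS hp hmem
  have h1 := h.nodup
  have h2 := h.arc_notMem
  have h3 := h.seg
  rw [seg_append] at h3
  obtain ⟨⟨h3, h4, h5⟩, h6⟩ := h3
  simp only [List.nodup_cons, List.mem_cons, List.cons_append, List.mem_append, not_or] at h1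
  simp only [List.mem_cons, List.cons_append, List.mem_append, not_or] at h2
  have kk := hκ.1
  have hz : κ z = G.arc p := by rw [← h3, kk]
  have hs : G.side (G.arc p) = q := by rw [hq, G.arc_side]
  have aa := G.arc_arc
  rw [hz] at s1 s3 s4 s6 s7
  rw [hs] at s3 s4 s6 s7
  rw [seg_append]
  obtain ⟨hqY, hqQ⟩ : q ∉ Y ∧ q ∉ Q := by
    have := h1.2.2.2
    simp only [List.nodup_append, List.nodup_cons, List.mem_cons] at this
    exact ⟨fun hm => this.2.2 q hm q (.inl rfl) rfl, this.2.1.1⟩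
  have key : ∀ u, (u = y ∨ u ∈ Y) ∨ u = q ∨ u ∈ Q → κ (G.arc u) ≠ q →
      κ' (G.arc u) = κ (G.arc u) := by
    intro u hu hc
    have hm := h2 u (by tauto)
    have hinj : ∀ v, G.arc u = G.arc v → u = v := fun v e => by rw [← aa u, e, aa]
    refine s7 _ ?_ ?_ hm.2.2.2.2.1 ?_ hm.2.1 ?_
    · intro e
      cases hinj _ e
      tauto
    · rw [h4]
      exact hm.2.2.1
    · intro e
      cases hinj _ e
      tauto
    · intro e
      exact hc (by rw [e, kk])
  have ne : ∀ x, (x ∈ Y ∨ x ∈ Q ∨ x = p) → x ≠ q := by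
    rintro x hx rfl
    tauto
  have end' : ∀ x, κ x = q → κ' x = z := by
    rintro x e
    rw [← s6, ← e, kk]
  refine ⟨⟨s1.trans h4, h5.change ?_ (end' _) ?_ fun u _ => end' _⟩, s4, h6.change ?_ ?_ ?_ ?_⟩
  · exact fun hm => key y (.inl (.inl rfl)) (ne _ (.inl hm))
  · exact fun u hu hm => key u (.inl (.inr hu)) (ne _ (.inl hm))
  · exact fun hm => key q (.inr (.inl rfl)) (ne _ (.inr (.inl hm)))
  · exact fun hm => (key q (.inr (.inl rfl)) (ne _ (.inr (.inr hm)))).trans hm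
  · exact fun u hu hm => key u (.inr (.inr hu)) (ne _ (.inr (.inl hm)))
  · exact fun u hu hm => (key u (.inr (.inr hu)) (ne _ (.inr (.inr hm)))).trans hm

theorem Round.slidable_twisted (hq : q = G.side p) 
    (h : G.Round κ p (z :: Y ++ q :: Q)) : (G.withCorner κ hκ).Slidable z := by
  have aa := G.arc_arc; have ss := G.side_side; have as := G.arc_side
  have an := G.arc_ne; have sn := G.side_ne
  have h1 := h.nodup
  have h2 := h.arc_notMem
  have h3 := h.seg
  rw [seg_append] at h3
  obtain ⟨⟨h3, h5⟩, h6⟩ := h3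
  simp only [List.nodup_cons, List.mem_cons, List.cons_append, List.mem_append, not_or] at h1
  simp only [List.mem_cons, List.cons_append, List.mem_append, not_or] at h2
  have hz : κ z = G.arc p := by rw [← h3, hκ.1]
  have h7 := h5.apply_mem
  have h8 := h6.apply_mem
  refine ⟨?_, ?_, ?_, ?_, ?_⟩
  · change G.side (κ z) ≠ G.arc (κ z)
    grind
  · change ¬ G.ribbonOf z = G.ribbonOf (κ z)
    rw [ribbonOf_eq_iff]
    grind
  · change κ (G.arc z) ≠ G.side (κ z)
    grind
  · change κ (G.arc z) ≠ G.arc (κ z)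
    grind
  · change κ (G.side (κ z)) ≠ G.arc (G.side (κ z))
    grind

/-- Over a twisted ribbon the end comes out on the other side of `q` and reversed. This is why `arc
z` replaces `z` in the word. -/
theorem Round.slide_twisted (hq : q = G.side p) 
    (h : G.Round κ p (z :: Y ++ q :: Q)) :
    G.Round ((G.withCorner κ hκ).slideCorner z) p (Y ++ q :: G.arc z :: Q) := by
  have hS := h.slidable_twisted hκ hq
  have aa := G.arc_arc
  have h1 := h.nodup
  have h2 := h.arc_notMem
  have h3 := h.seg
  have h9 := h.cover
  rw [seg_append] at h3
  obtain ⟨⟨h3, h5⟩, h6⟩ := h3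
  clear h
  have s1 : (G.withCorner κ hκ).slideCorner z (κ z) = κ (G.arc z) := slideCorner_corner _
  have s3 : (G.withCorner κ hκ).slideCorner z (G.side (κ z)) = G.arc z := slideCorner_side hS
  have s5 : (G.withCorner κ hκ).slideCorner z z = κ (G.side (κ z)) := slideCorner_self hS
  have s7 : ∀ x, x ≠ κ z → x ≠ κ (G.arc z) → x ≠ G.side (κ z) → x ≠ G.arc z → x ≠ z →
    x ≠ κ (G.side (κ z)) → (G.withCorner κ hκ).slideCorner z x = κ x :=
    fun x => slideCorner_of_ne (G := G.withCorner κ hκ)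
  obtain ⟨κ', hκ'⟩ : ∃ k : G.Flag → G.Flag, k = (G.withCorner κ hκ).slideCorner z := ⟨_, rfl⟩
  rw [← hκ'] at s1 s3 s5 s7 ⊢
  clear hκ'
  clear hS
  have kk := hκ.1
  have hz : κ z = G.arc p := by rw [← h3, kk]
  have hs : G.side (G.arc p) = G.arc q := by rw [hq, G.arc_side]
  rw [hz] at s1 s3 s5 s7
  rw [hs] at s3 s5 s7
  simp only [List.nodup_cons, List.nodup_append, List.mem_cons, List.cons_append, List.mem_append, not_or] at h1
  simp only [List.mem_cons, List.cons_append, List.mem_append, not_or] at h2 h9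
  have h7 := h5.apply_mem.1
  have h8 := h6.apply_mem.1
  have key : ∀ u, u ∈ Y ∨ u ∈ Q → κ' (G.arc u) = κ (G.arc u) := by
    intro u hu
    have hm := h2 u (by tauto)
    have hinj : ∀ v, G.arc u = G.arc v → u = v := fun v e => by rw [← aa u, e, aa]
    refine s7 _ ?_ ?_ ?_ ?_ (by tauto) ?_
    · intro e
      cases hinj _ e
      tauto
    · intro e
      rw [← e] at h7
      tauto
    · intro e
      cases hinj _ e
      rcases hu with hu | hu
      · exact h1.2.2.2.2 _ hu _ (.inl rfl) rfl
      · exact h1.2.2.2.1.1 hu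
    · intro e
      cases hinj _ e
      tauto
    · intro e
      rw [← e] at h8
      tauto
  refine ⟨?_, ?_, ?_, ?_⟩
  · rw [seg_append, seg_cons, aa]
    exact ⟨h5.change (fun _ => s1) s1.trans (fun u hu _ => key u (.inl hu))
      fun u hu => (key u (.inl hu)).trans, s3, h6.change (fun _ => s5) s5.trans
      (fun u hu _ => key u (.inr hu)) fun u hu => (key u (.inr hu)).trans⟩
  · simp only [List.nodup_cons, List.nodup_append, List.mem_cons, List.mem_append, not_or]
    grind
  · simp only [List.mem_cons, List.mem_append, not_or]
    grind
  · simp only [List.mem_cons, List.mem_append]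
    grind

end Slide

end PinchedRibbonGraph


/-! ### Decomposing a graph into a disjoint union or a one-point joint -/

namespace PinchedRibbonGraph

variable {G : PinchedRibbonGraph}

/-- `S` is a union of ribbons and vertex circles. -/
def IsClosed (G : PinchedRibbonGraph) (S : Set G.Flag) : Prop :=
  ∀ a ∈ S, G.arc a ∈ S ∧ G.corner a ∈ S ∧ G.side a ∈ S

theorem IsClosed.compl {S : Set G.Flag} (h : G.IsClosed S) : G.IsClosed Sᶜ := by
  refine fun a ha => ⟨fun h' => ha ?_, fun h' => ha ?_, fun h' => ha ?_⟩
  · rw [← G.arc_arc a]; exact (h _ h').1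
  · rw [← G.corner_corner a]; exact (h _ h').2.1
  · rw [← G.side_side a]; exact (h _ h').2.2

/-- The part of `G` with flags `S` and `n` isolated vertices. -/
abbrev restrict (G : PinchedRibbonGraph) {S : Set G.Flag} (h : G.IsClosed S) (n : ℕ) :
    PinchedRibbonGraph where
  Flag := {a : G.Flag // a ∈ S}
  finite := by have := G.finite; infer_instance
  isolated := n
  arc a := ⟨G.arc a.1, (h _ a.2).1⟩
  corner a := ⟨G.corner a.1, (h _ a.2).2.1⟩
  side a := ⟨G.side a.1, (h _ a.2).2.2⟩
  arc_arc a := Subtype.ext (G.arc_arc _)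
  corner_corner a := Subtype.ext (G.corner_corner _)
  side_side a := Subtype.ext (G.side_side _)
  arc_ne a e := G.arc_ne _ (congrArg Subtype.val e)
  corner_ne a e := G.corner_ne _ (congrArg Subtype.val e)
  side_ne a e := G.side_ne _ (congrArg Subtype.val e)
  arc_side a := Subtype.ext (G.arc_side _)

theorem bijective_sumElim_val {X : Type*} (S : Set X) : Function.Bijective
    (Sum.elim Subtype.val Subtype.val : {a // a ∈ S} ⊕ {a // a ∈ Sᶜ} → X) := by
  constructor
  · rintro (⟨a, ha⟩ | ⟨a, ha⟩) (⟨b, hb⟩ | ⟨b, hb⟩) (rfl : a = b)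
    exacts [rfl, absurd ha hb, absurd hb ha, rfl]
  · intro a
    by_cases ha : a ∈ S
    exacts [⟨.inl ⟨a, ha⟩, rfl⟩, ⟨.inr ⟨a, ha⟩, rfl⟩]

theorem iso_disjointUnion_restrict {S : Set G.Flag} (h : G.IsClosed S) {n m : ℕ}
    (hnm : n + m = G.isolated) :
    Nonempty (((G.restrict h n).disjointUnion (G.restrict h.compl m)).Iso G) := by
  refine ⟨⟨Equiv.ofBijective _ (bijective_sumElim_val S), ?_, ?_, ?_, hnm⟩⟩ <;>
    rintro (a | a) <;> rfl

section Joint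

variable {S : Set G.Flag} {p q : G.Flag}

/-- `S` is a union of ribbons, and the vertex circle through `p` leaves `S` only at the corners of
`p` and `q`. -/
structure Splits (G : PinchedRibbonGraph) (S : Set G.Flag) (p q : G.Flag) : Prop where
  arc : ∀ a ∈ S, G.arc a ∈ S
  side : ∀ a ∈ S, G.side a ∈ S
  corner : ∀ a ∈ S, a ≠ p → a ≠ G.corner q → G.corner a ∈ S
  mem : p ∈ S
  corner_notMem : G.corner p ∉ S
  notMem : q ∉ S
  corner_mem : G.corner q ∈ S
  ne : q ≠ G.corner p

open Classical in
/-- The vertex circle cut at the corners of `p` and `q` and closed up to two circles. -/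
noncomputable def splitCorner (G : PinchedRibbonGraph) (p q a : G.Flag) : G.Flag :=
  if a = p then G.corner q else if a = G.corner q then p
  else if a = q then G.corner p else if a = G.corner p then q else G.corner a

theorem Splits.involutive (h : G.Splits S p q) :
    (∀ a, G.splitCorner p q (G.splitCorner p q a) = a) ∧ ∀ a, G.splitCorner p q a ≠ a := by
  have cc := G.corner_corner; have cn := G.corner_ne
  have h1 := h.mem; have h2 := h.corner_notMem; have h3 := h.notMem; have h4 := h.corner_mem
  have h5 := h.ne
  have n1 : p ≠ G.corner q := fun e => h5 (by rw [e, cc])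
  have n2 : p ≠ q := fun e => h3 (e ▸ h1)
  clear h1 h2 h3 h4 h
  have key : ∀ a, G.splitCorner p q (G.splitCorner p q a) = a ∧ G.splitCorner p q a ≠ a := by
    intro a
    unfold splitCorner
    by_cases h1 : a = p
    · subst h1; grind
    by_cases h2 : a = G.corner q
    · subst h2; grind
    by_cases h3 : a = q
    · subst h3; grind
    by_cases h4 : a = G.corner p
    · subst h4; grind
    grind
  exact ⟨fun a => (key a).1, fun a => (key a).2⟩

theorem Splits.isClosed (h : G.Splits S p q) :
    (G.withCorner (G.splitCorner p q) h.involutive).IsClosed S := by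
  intro (a : G.Flag) ha
  refine ⟨h.arc a ha, ?_, h.side a ha⟩
  change G.splitCorner p q a ∈ S
  unfold splitCorner
  have h1 := h.mem; have h2 := h.corner_notMem; have h3 := h.notMem; have h4 := h.corner_mem
  have h5 := h.corner a ha
  split_ifs <;> grind

/-- Cutting the disc along a chord turns the corners `{p, corner p}` and `{q, corner q}` into `{p,
corner q}` and `{corner p, q}`, one in each part; the joint glues along precisely these two. -/
theorem Splits.iso_joint (h : G.Splits S p q) {n m : ℕ} (hnm : n + m = G.isolated) :
    Nonempty ((((G.withCorner _ h.involutive).restrict h.isClosed n).joint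
      ((G.withCorner _ h.involutive).restrict h.isClosed.compl m)
      ⟨p, h.mem⟩ ⟨G.corner p, h.corner_notMem⟩).Iso G) := by
  classical
  have hn1 : p ≠ G.corner q := fun e => h.ne (by rw [e, G.corner_corner])
  have hn2 : p ≠ q := fun e => h.notMem (e ▸ h.mem)
  have e1 : G.splitCorner p q p = G.corner q := if_pos rfl
  have e2 : G.splitCorner p q (G.corner p) = q := by
    refine (if_neg (G.corner_ne p)).trans ((if_neg ?_).trans ((if_neg h.ne.symm).trans (if_pos rfl)))
    exact fun e => hn2 (by rw [← G.corner_corner p, e, G.corner_corner])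
  refine ⟨⟨Equiv.ofBijective _ (bijective_sumElim_val S), ?_, ?_, ?_, hnm⟩⟩
  · rintro (a | a) <;> rfl
  · rintro (⟨(a : G.Flag), ha⟩ | ⟨(a : G.Flag), ha⟩)
    · by_cases h1 : a = p
      · subst h1
        exact congrArg (Sum.elim Subtype.val Subtype.val) (if_pos rfl)
      by_cases h2 : a = G.corner q
      · subst h2
        refine (congrArg (Sum.elim Subtype.val Subtype.val) ((if_neg ?_).trans (if_pos ?_))).trans ?_
        · exact fun e => h1 (congrArg Subtype.val e)
        · exact Subtype.ext e1.symm
        · exact e2.trans (G.corner_corner q).symm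
      refine (congrArg (Sum.elim Subtype.val Subtype.val) ((if_neg ?_).trans (if_neg ?_))).trans ?_
      · exact fun e => h1 (congrArg Subtype.val e)
      · exact fun e => h2 ((congrArg Subtype.val e).trans e1)
      · refine (if_neg h1).trans ((if_neg h2).trans ((if_neg ?_).trans (if_neg ?_)))
        · exact fun e : a = q => h.notMem (e ▸ ha)
        · exact fun e : a = G.corner p => h.corner_notMem (e ▸ ha)
    · by_cases h1 : a = G.corner p
      · subst h1
        exact (congrArg (Sum.elim Subtype.val Subtype.val) (if_pos rfl)).trans
          (G.corner_corner p).symm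
      by_cases h2 : a = q
      · subst h2
        refine (congrArg (Sum.elim Subtype.val Subtype.val) ((if_neg ?_).trans (if_pos ?_))).trans ?_
        · exact fun e => h1 (congrArg Subtype.val e)
        · exact Subtype.ext e2.symm
        · exact e1
      refine (congrArg (Sum.elim Subtype.val Subtype.val) ((if_neg ?_).trans (if_neg ?_))).trans ?_
      · exact fun e => h1 (congrArg Subtype.val e)
      · exact fun e => h2 ((congrArg Subtype.val e).trans e2)
      · refine (if_neg ?_).trans ((if_neg ?_).trans ((if_neg h2).trans (if_neg h1)))
        · exact fun e : a = p => ha (e ▸ h.mem)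
        · exact fun e : a = G.corner q => ha (e ▸ h.corner_mem)
  · rintro (a | a) <;> rfl

end Joint

end PinchedRibbonGraph


/-! ### Reading splittings, cyclic words and chord diagrams off a bouquet -/

namespace PinchedRibbonGraph

variable {G : PinchedRibbonGraph} {κ : G.Flag → G.Flag}

theorem Seg.apply_prev (kk : ∀ a, κ (κ a) = a) {b c : G.Flag} {L : List G.Flag}
    (h : G.Seg κ b L c) :
    ∀ u, u ∈ L ∨ u = c → κ u = b ∨ ∃ v ∈ L, κ u = G.arc v := by
  induction L generalizing b with
  | nil =>
    rintro u (hu | rfl)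
    · simp at hu
    · left; rw [← seg_nil.1 h, kk]
  | cons a L ih =>
    obtain ⟨h1, h2⟩ := h
    rintro u hu
    by_cases hua : u = a
    · left; rw [hua, ← h1, kk]
    · right
      rcases ih h2 u (hu.imp_left fun hu => (List.mem_cons.1 hu).resolve_left hua) with h | ⟨v, hv, h⟩
      exacts [⟨a, List.mem_cons_self .., h⟩, ⟨v, List.mem_cons_of_mem _ hv, h⟩]

/-- A stretch of consecutive ribbon ends closed under passing to the other end of the ribbon can be
separated by a chord of the disc. The chord runs from the corner before `p` to the corner before
`r`, the first end after the stretch. -/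
theorem Round.splits {p r : G.Flag} {L₁ L₂ : List G.Flag} (hκ : (∀ a, κ (κ a) = a) ∧ ∀ a, κ a ≠ a)
    (h : G.Round κ p (L₁ ++ r :: L₂))
    (hcl : ∀ x ∈ p :: L₁, G.side x ∈ p :: L₁ ∨ G.arc (G.side x) ∈ p :: L₁) :
    (G.withCorner κ hκ).Splits {x | x ∈ p :: L₁ ∨ G.arc x ∈ p :: L₁} p r := by
  obtain ⟨s1, s2⟩ := seg_append.1 h.seg
  have kk := hκ.1
  have aa := G.arc_arc
  have m1 : ∀ x ∈ p :: L₁, x ∈ p :: (L₁ ++ r :: L₂) := fun x hx => by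
    simp only [List.mem_cons, List.mem_append] at hx ⊢; tauto
  have m2 : ∀ x ∈ r :: L₂, x ∈ p :: (L₁ ++ r :: L₂) := fun x hx => by
    simp only [List.mem_cons, List.mem_append] at hx ⊢; tauto
  have hdis : ∀ x ∈ r :: L₂, x ∉ p :: L₁ := by
    have hn : ((p :: L₁) ++ r :: L₂).Nodup := h.nodup
    exact fun x hx hx' => (List.nodup_append.1 hn).2.2 x hx' x hx rfl
  have next : ∀ u ∈ p :: L₁, κ (G.arc u) ∈ L₁ ∨ κ (G.arc u) = r := by
    intro u hu
    rcases List.mem_cons.1 hu with rfl | hu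
    exacts [s1.apply_mem.1, s1.apply_mem.2 u hu]
  have prev₁ : ∀ u, u ∈ L₁ ∨ u = r → ∃ v ∈ p :: L₁, κ u = G.arc v := by
    intro u hu
    rcases s1.apply_prev kk u hu with h | ⟨v, hv, h⟩
    exacts [⟨p, List.mem_cons_self .., h⟩, ⟨v, List.mem_cons_of_mem _ hv, h⟩]
  obtain ⟨v, hv, hpv⟩ : ∃ v ∈ r :: L₂, κ p = G.arc v := by
    rcases s2.apply_prev kk p (.inr rfl) with h | ⟨v, hv, h⟩
    exacts [⟨r, List.mem_cons_self .., h⟩, ⟨v, List.mem_cons_of_mem _ hv, h⟩]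
  refine ⟨?_, ?_, ?_, .inl (List.mem_cons_self ..), ?_, ?_, ?_, ?_⟩
  · rintro a (ha | ha)
    · exact .inr (by rwa [aa])
    · exact .inl ha
  · rintro a (ha | ha)
    · exact hcl a ha
    · rcases hcl _ ha with h | h
      · exact .inr (by rwa [G.arc_side])
      · exact .inl (by rwa [← G.arc_side, aa] at h)
  · rintro a (ha | ha) hap har
    · obtain ⟨v, hv, e⟩ := prev₁ a (.inl ((List.mem_cons.1 ha).resolve_left hap))
      exact .inr (by
        change G.arc (κ a) ∈ _
        rwa [e, aa])
    · have := next _ ha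
      rw [aa] at this
      rcases this with h | h
      · exact .inl (List.mem_cons_of_mem _ h)
      · exact absurd ((kk a).symm.trans (congrArg κ h)) har
  · rintro (h' | h')
    · exact h.arc_notMem v (m2 v hv) (m1 _ (hpv ▸ h'))
    · have h' : G.arc (κ p) ∈ p :: L₁ := h'
      exact hdis v hv (by rwa [hpv, aa] at h')
  · rintro (h' | h')
    · exact hdis r (List.mem_cons_self ..) h'
    · exact h.arc_notMem r (m2 r (List.mem_cons_self ..)) (m1 _ h')
  · obtain ⟨u, hu, e⟩ := prev₁ r (.inr rfl)
    exact .inr (by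
      change G.arc (κ r) ∈ _
      rwa [e, aa])
  · intro (e : r = κ p)
    exact h.arc_notMem v (m2 v hv) (by rw [← hpv, ← e]; exact m2 r (List.mem_cons_self ..))

theorem Seg.vertexOf_eq (hκ : (∀ a, κ (κ a) = a) ∧ ∀ a, κ a ≠ a) {b c : G.Flag} {L : List G.Flag}
    (h : G.Seg κ b L c) :
    ∀ u ∈ L, (G.withCorner κ hκ).vertexOf u = (G.withCorner κ hκ).vertexOf b := by
  induction L generalizing b with
  | nil => intro u hu; simp at hu
  | cons a L ih =>
    obtain ⟨rfl, h2⟩ := h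
    have h3 : (G.withCorner κ hκ).vertexOf (κ b) = (G.withCorner κ hκ).vertexOf b :=
      vertexOf_corner (G := G.withCorner κ hκ) b
    intro u hu
    rcases List.mem_cons.1 hu with rfl | hu
    · exact h3
    · exact (ih h2 u hu).trans ((vertexOf_arc (G := G.withCorner κ hκ) (κ b)).trans h3)

theorem Round.isBouquet (hκ : (∀ a, κ (κ a) = a) ∧ ∀ a, κ a ≠ a) {p : G.Flag} {L : List G.Flag}
    (h : G.Round κ p L) (hG : G.isolated = 0) : (G.withCorner κ hκ).IsBouquet := by
  have h1 : ∀ u ∈ p :: L, (G.withCorner κ hκ).vertexOf u = (G.withCorner κ hκ).vertexOf p := by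
    intro u hu
    rcases List.mem_cons.1 hu with rfl | hu
    · rfl
    · exact (h.seg.vertexOf_eq hκ u hu).trans (vertexOf_arc (G := G.withCorner κ hκ) p)
  have h2 : Nat.card (G.withCorner κ hκ).AttachedVertex = 1 := by
    refine Nat.card_eq_one_iff_exists.2 ⟨(G.withCorner κ hκ).vertexOf p, ?_⟩
    rintro ⟨x⟩
    rcases h.cover x with hx | hx
    · exact h1 x hx
    · exact (vertexOf_arc (G := G.withCorner κ hκ) x).symm.trans (h1 _ hx)
  exact congrArg₂ (· + ·) h2 hG

/-- The word is the orbit of `p` under `corner ∘ arc`, which passes once around the vertex disc. An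
alternating colouring is constant on this orbit, so it never meets both flags of an end; that there
is only one vertex makes it meet every end. -/
theorem exists_round (hG : G.IsBouquet) (p : G.Flag) : ∃ L, G.Round G.corner p L := by
  have := G.finite
  have aa := G.arc_arc; have cc := G.corner_corner
  obtain ⟨o, ho⟩ := QuotCount.exists_alternating G.arc_arc G.arc_ne G.corner_corner G.corner_ne
  set f : G.Flag → G.Flag := fun x => G.corner (G.arc x) with hf
  have hinj : Function.Injective f := fun x y e => by
    have : G.arc x = G.arc y := by rw [← cc (G.arc x), ← cc (G.arc y)]; exact congrArg _ e
    rw [← aa x, this, aa]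
  have hper : p ∈ Function.periodicPts f := hinj.mem_periodicPts p
  obtain ⟨k, hk⟩ : ∃ k, Function.minimalPeriod f p = k + 1 :=
    Nat.exists_eq_succ_of_ne_zero (Function.minimalPeriod_pos_of_mem_periodicPts hper).ne'
  have hfp : f^[k + 1] p = p := hk ▸ Function.isPeriodicPt_minimalPeriod f p
  have seg : ∀ j i, G.Seg G.corner (G.arc (f^[i] p)) ((List.range' (i + 1) j).map (f^[·] p))
      (f^[i + j + 1] p) := by
    intro j
    induction j with
    | zero => intro i; exact (Function.iterate_succ_apply' f i p).symm
    | succ j ih =>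
      intro i
      refine ⟨(Function.iterate_succ_apply' f i p).symm, ?_⟩
      have := ih (i + 1)
      rwa [show i + 1 + j + 1 = i + (j + 1) + 1 by ring] at this
  have hL : p :: (List.range' 1 k).map (f^[·] p) = (List.range' 0 (k + 1)).map (f^[·] p) := rfl
  have hmem : ∀ x, x ∈ p :: (List.range' 1 k).map (f^[·] p) ↔ ∃ i, f^[i] p = x := by
    intro x
    rw [hL, List.mem_map]
    constructor
    · rintro ⟨i, -, h⟩
      exact ⟨i, h⟩
    · rintro ⟨i, rfl⟩
      refine ⟨i % (k + 1), ?_, ?_⟩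
      · rw [List.mem_range'_1]
        exact ⟨Nat.zero_le _, by rw [Nat.zero_add]; exact Nat.mod_lt _ k.succ_pos⟩
      · rw [← hk]
        exact Function.iterate_mod_minimalPeriod_eq
  have hoi : ∀ i, o (f^[i] p) = o p := by
    intro i
    induction i with
    | zero => rfl
    | succ i ih => rw [Function.iterate_succ_apply', hf, (ho _).2, (ho _).1, Bool.not_not, ih]
  refine ⟨(List.range' 1 k).map (f^[·] p), ?_, ?_, ?_, ?_⟩
  · have := seg k 0
    rw [Nat.zero_add k, hfp] at this
    exact this
  · rw [hL]
    refine List.Nodup.map_on ?_ List.nodup_range'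
    intro i hi j hj e
    rw [List.mem_range'_1, Nat.zero_add, ← hk] at hi hj
    exact Function.iterate_injOn_Iio_minimalPeriod hi.2 hj.2 e
  · intro x hx hx'
    obtain ⟨i, rfl⟩ := (hmem _).1 hx
    obtain ⟨j, hj⟩ := (hmem _).1 hx'
    have := (ho (f^[i] p)).1
    rw [← hj, hoi, hoi] at this
    simp at this
  · intro x
    simp only [hmem]
    have hprev : ∀ i, ∃ j, f^[j] p = G.arc (G.corner (f^[i] p)) := by
      intro i
      refine ⟨i + k, ?_⟩
      have h1 : f (f^[i + k] p) = f^[i] p := by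
        rw [← Function.iterate_succ_apply' f, Nat.succ_eq_add_one, Nat.add_assoc, Function.iterate_add_apply, hfp]
      rw [← h1, hf]
      simp only
      rw [cc, aa]
    have hnext : ∀ i, ∃ j, f^[j] p = G.corner (G.arc (f^[i] p)) := fun i =>
      ⟨i + 1, Function.iterate_succ_apply' f i p⟩
    -- The orbit together with its image under `arc` is closed under arcs and corners, hence
    -- descends to vertices.
    let T : G.Flag → Prop := fun x => (∃ i, f^[i] p = x) ∨ ∃ i, f^[i] p = G.arc x
    have hT1 : ∀ x, T x → T (G.arc x) := by
      rintro x (h | h)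
      · exact .inr (by rwa [aa])
      · exact .inl h
    have hT2 : ∀ x, T x → T (G.corner x) := by
      rintro x (⟨i, rfl⟩ | ⟨i, h⟩)
      · exact .inr (hprev i)
      · left
        rw [← aa x, ← h]
        exact hnext i
    let g : G.AttachedVertex → Prop := Quot.lift T (by
      rintro x _ (rfl | rfl)
      · exact propext ⟨hT1 x, fun h => by have := hT1 _ h; rwa [aa] at this⟩
      · exact propext ⟨hT2 x, fun h => by have := hT2 _ h; rwa [cc] at this⟩)
    have hv : G.vertexOf p = G.vertexOf x := by
      have h1 : Nat.card G.AttachedVertex ≤ 1 := by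
        have : G.numVertices = 1 := hG
        unfold numVertices at this
        omega
      have := Finite.card_le_one_iff_subsingleton.1 h1
      exact Subsingleton.elim _ _
    exact (congrArg g hv).mp (.inl ⟨0, rfl⟩)

/-- It suffices to list one flag `e i` of every ribbon end in cyclic order. The twist says whether
the side of `e i` leads to the listed flag of the partner or to its arc. -/
theorem iso_chordDiagram {m : ℕ} [NeZero m] {μ : Fin m → Fin m} {tw : Fin m → Bool}
    {hμ : ∀ p, μ (μ p) = p} {htw : ∀ p, tw (μ p) = tw p} {hfix : ∀ p, μ p = p → tw p = false}
    (e : Fin m → G.Flag) (hinj : Function.Injective e) (harc : ∀ i j, G.arc (e i) ≠ e j)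
    (hcover : ∀ x, ∃ i, x = e i ∨ x = G.arc (e i))
    (hcorner : ∀ i, G.corner (G.arc (e i)) = e (i + 1))
    (hside : ∀ i, G.side (e i) = if tw i then e (μ i) else G.arc (e (μ i)))
    (hG : G.isolated = 0) : Nonempty ((chordDiagram m μ tw hμ htw hfix).Iso G) := by
  have aa := G.arc_arc
  let g : Fin m × Bool → G.Flag := fun a => if a.2 then G.arc (e a.1) else e a.1
  have hg : Function.Bijective g := by
    constructor
    · rintro ⟨i, _ | _⟩ ⟨j, _ | _⟩ h
      · exact congrArg (·, false) (hinj h)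
      · exact absurd h.symm (harc j i)
      · exact absurd h (harc i j)
      · have : G.arc (e i) = G.arc (e j) := h
        exact congrArg (·, true) (hinj (by rw [← aa (e i), this, aa]))
    · intro x
      obtain ⟨i, rfl | rfl⟩ := hcover x
      exacts [⟨(i, false), rfl⟩, ⟨(i, true), rfl⟩]
  refine ⟨⟨Equiv.ofBijective g hg, ?_, ?_, ?_, hG.symm⟩⟩
  · rintro ⟨i, _ | _⟩
    · rfl
    · exact (aa _).symm
  · rintro ⟨i, _ | _⟩
    · change G.arc (e (i - 1)) = G.corner (e i)
      rw [← G.corner_corner (G.arc _), hcorner, sub_add_cancel]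
    · exact (hcorner i).symm
  · have hs : ∀ i, g (μ i, if tw i then false else !false) = G.side (e i) := by
      intro i
      rw [hside]
      by_cases h : tw i <;> simp [g, h]
    rintro ⟨i, _ | _⟩
    · exact hs i
    · change g (μ i, if tw i then true else !true) = G.side (G.arc (e i))
      rw [← G.arc_side, ← hs]
      by_cases h : tw i <;> simp [g, h, aa]

end PinchedRibbonGraph


/-! ### Reduction of bouquets to joints and three chord diagrams by handle slides -/

namespace PinchedRibbonGraph

variable {G : PinchedRibbonGraph} {P : PinchedRibbonGraph → Prop}

theorem Round.iso_of_singleton {κ : G.Flag → G.Flag} (hκ : (∀ a, κ (κ a) = a) ∧ ∀ a, κ a ≠ a)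
    {p q : G.Flag} (h : G.Round κ p [q]) (tw : Bool) (hs : G.side p = if tw then q else G.arc q)
    (hG : G.isolated = 0) :
    Nonempty ((chordDiagram 2 (fun p => p + 1) (fun _ => tw) (by decide) (fun _ => rfl)
      (fun p hp => absurd hp (by revert p; decide))).Iso (G.withCorner κ hκ)) := by
  have hn := h.nodup; have ha := h.arc_notMem; have hc := h.cover
  have s1 : κ (G.arc p) = q := h.seg.1
  have s2 : κ (G.arc q) = p := h.seg.2
  have aa := G.arc_arc; have ss := G.side_side; have as := G.arc_side
  simp only [List.nodup_cons, List.mem_cons, List.not_mem_nil, or_false] at hn ha hc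
  have hs' : G.side q = if tw then p else G.arc p := by
    cases tw <;> grind
  refine iso_chordDiagram (G := G.withCorner κ hκ) ![p, q] ?_ ?_ ?_ ?_ ?_ hG
  · intro i j
    fin_cases i <;> fin_cases j <;> simp <;> grind
  · intro i j
    fin_cases i <;> fin_cases j <;> simp <;> grind
  · intro x
    rcases hc x with (h | h) | (h | h)
    exacts [⟨0, .inl h⟩, ⟨1, .inl h⟩, ⟨0, .inr (by rw [← aa x, h]; rfl)⟩,
      ⟨1, .inr (by rw [← aa x, h]; rfl)⟩]
  · intro i
    fin_cases i
    exacts [s1, s2]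
  · intro i
    fin_cases i
    exacts [hs, hs']

theorem Round.iso_of_interlaced {κ : G.Flag → G.Flag} (hκ : (∀ a, κ (κ a) = a) ∧ ∀ a, κ a ≠ a)
    {p q g g' : G.Flag} (h : G.Round κ p [g, q, g']) (hq : q = G.arc (G.side p))
    (hg : g' = G.arc (G.side g)) (hG : G.isolated = 0) :
    Nonempty (D2100.Iso (G.withCorner κ hκ)) := by
  have hn := h.nodup; have ha := h.arc_notMem; have hc := h.cover
  obtain ⟨s1, s2, s3, s4⟩ := h.seg
  have s4 : κ (G.arc g') = p := s4
  have aa := G.arc_arc; have ss := G.side_side; have as := G.arc_side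
  simp only [List.nodup_cons, List.mem_cons, List.not_mem_nil, or_false] at hn ha hc
  refine iso_chordDiagram (G := G.withCorner κ hκ) ![p, g, q, g'] ?_ ?_ ?_ ?_ ?_ hG
  · intro i j
    fin_cases i <;> fin_cases j <;> simp <;> grind
  · intro i j
    fin_cases i <;> fin_cases j <;> simp <;> grind
  · intro x
    rcases hc x with (h | h | h | h) | (h | h | h | h)
    exacts [⟨0, .inl h⟩, ⟨1, .inl h⟩, ⟨2, .inl h⟩, ⟨3, .inl h⟩,
      ⟨0, .inr (by rw [← aa x, h]; rfl)⟩, ⟨1, .inr (by rw [← aa x, h]; rfl)⟩,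
      ⟨2, .inr (by rw [← aa x, h]; rfl)⟩, ⟨3, .inr (by rw [← aa x, h]; rfl)⟩]
  · intro i
    fin_cases i
    exacts [s1, s2, s3, s4]
  · have e1 : G.side p = G.arc q := by rw [hq, aa]
    have e2 : G.side g = G.arc g' := by rw [hg, aa]
    have e3 : G.side q = G.arc p := by rw [hq, ← as, ss]
    have e4 : G.side g' = G.arc g := by rw [hg, ← as, ss]
    intro i
    fin_cases i
    exacts [e1, e2, e3, e4]

/-- The property `P` of the bouquets with the ribbons of `G` is inherited under handle slides,
holds for one-point joints and for the three special chord diagrams. -/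
structure Reduction (P : PinchedRibbonGraph → Prop) (G : PinchedRibbonGraph) : Prop where
  isolated : G.isolated = 0
  slide : ∀ κ hκ z (hz : (G.withCorner κ hκ).Slidable z), (G.withCorner κ hκ).IsBouquet →
    P ((G.withCorner κ hκ).withCorner _ (slideCorner_involutive hz)) → P (G.withCorner κ hκ)
  split : ∀ κ hκ S p q, (G.withCorner κ hκ).IsBouquet → (G.withCorner κ hκ).Splits S p q →
    P (G.withCorner κ hκ)
  iso : ∀ κ hκ D, D = D1000 ∨ D = D1010 ∨ D = D2100 → Nonempty (D.Iso (G.withCorner κ hκ)) →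
    P (G.withCorner κ hκ)

/-- All bouquets with the cyclic order `p :: L` of ribbon ends have the property `P`. -/
def Settled (P : PinchedRibbonGraph → Prop) (G : PinchedRibbonGraph) (p : G.Flag)
    (L : List G.Flag) : Prop :=
  ∀ κ hκ, G.Round κ p L → P (G.withCorner κ hκ)

namespace Reduction

variable {p q z r g g' : G.Flag} {A B C Y Q L₁ L₂ : List G.Flag}

theorem settled_rotate (hs : Settled P G q (L₂ ++ p :: L₁)) : Settled P G p (L₁ ++ q :: L₂) :=
  fun κ hκ hr => hs κ hκ hr.rotate

theorem settled_slide (h : Reduction P G) (hq : q = G.arc (G.side p)) (hs : Settled P G p (Y ++ z :: q :: Q)) :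
    Settled P G p (z :: Y ++ q :: Q) := by
  cases Y with
  | nil => exact hs
  | cons y Y =>
    intro κ hκ hr
    exact h.slide κ hκ z (hr.slidable hκ hq) (hr.isBouquet hκ h.isolated)
      (hs _ (slideCorner_involutive (G := G.withCorner κ hκ) (hr.slidable hκ hq)) (hr.slide hκ hq))

/-- Sliding the entries of `A` one by one, in order, exchanges the two blocks enclosed between the
ends of an untwisted chord. -/
theorem settled_slide_append (h : Reduction P G) (hq : q = G.arc (G.side p))
    (hs : Settled P G p (Y ++ A ++ q :: Q)) : Settled P G p (A ++ Y ++ q :: Q) := by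
  induction A generalizing Y Q with
  | nil => simpa using hs
  | cons z A ih =>
    refine h.settled_slide hq (Y := A ++ Y) ?_
    have := ih (Y := Y ++ [z]) (Q := Q) (by simpa using hs)
    simpa using this

theorem settled_split (h : Reduction P G) (hcl : ∀ x ∈ p :: L₁, G.side x ∈ p :: L₁ ∨ G.arc (G.side x) ∈ p :: L₁) :
    Settled P G p (L₁ ++ r :: L₂) :=
  fun κ hκ hr => h.split κ hκ _ p r (hr.isBouquet hκ h.isolated) (hr.splits hκ hcl)

/-- Everything between the two ends of a twisted chord is slid out. The chord then occupies two
consecutive places and is either a factor of a joint or the whole diagram `D1010`. -/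
theorem settled_twisted (h : Reduction P G) (hq : q = G.side p) : Settled P G p (Y ++ q :: Q) := by
  have ss := G.side_side
  induction Y generalizing Q with
  | cons z Y ih =>
    intro κ hκ hr
    exact h.slide κ hκ z (hr.slidable_twisted hκ hq) (hr.isBouquet hκ h.isolated)
      (ih _ (slideCorner_involutive (G := G.withCorner κ hκ) (hr.slidable_twisted hκ hq)) (hr.slide_twisted hκ hq))
  | nil =>
    cases Q with
    | cons r Q =>
      refine h.settled_split (L₁ := [q]) ?_
      subst hq
      simp [ss]
    | nil =>
      intro κ hκ hr
      refine h.iso κ hκ D1010 (.inr (.inl rfl)) ?_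
      exact hr.iso_of_singleton hκ true hq.symm h.isolated

theorem settled_one (h : Reduction P G) (hq : q = G.arc (G.side p)) : Settled P G p [q] :=
  fun κ hκ hr => h.iso κ hκ D1000 (.inl rfl) <|
    hr.iso_of_singleton hκ false (by rw [hq, G.arc_arc]; rfl) h.isolated

/-- Four consecutive places form a closed stretch: it splits off if anything follows, and otherwise
the diagram is `D2100`. -/
theorem settled_interlaced (h : Reduction P G) (hq : q = G.arc (G.side p)) (hg : g' = G.arc (G.side g)) :
    Settled P G p (g :: q :: g' :: Q) := by
  have aa := G.arc_arc; have ss := G.side_side; have as := G.arc_side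
  cases Q with
  | cons r Q =>
    refine h.settled_split (L₁ := [g, q, g']) ?_
    subst hq hg
    simp [← as, aa, ss]
  | nil =>
    intro κ hκ hr
    exact h.iso κ hκ D2100 (.inr (.inr rfl)) (hr.iso_of_interlaced hκ hq hg h.isolated)

/-- The handle normalisation of the classification of surfaces. Three exchanges of blocks, within
the chords at `p`, at `g` and at `q`, transform the cyclic word `p A g B q C g' Q` into `p g q g'`
followed by the rest. -/
theorem settled_crossing (h : Reduction P G) (hq : q = G.arc (G.side p)) (hg : g' = G.arc (G.side g)) :
    Settled P G p ((A ++ g :: B) ++ q :: (C ++ g' :: Q)) := by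
  have aa := G.arc_arc; have ss := G.side_side; have as := G.arc_side
  have hp : p = G.arc (G.side q) := by rw [hq, ← as, aa, ss]
  refine h.settled_slide_append hq ?_
  have e1 : g :: B ++ A ++ q :: (C ++ g' :: Q) = [] ++ g :: ((B ++ A) ++ q :: (C ++ g' :: Q)) := by
    simp
  rw [e1]
  refine settled_rotate ?_
  have e2 : B ++ A ++ q :: (C ++ g' :: Q) ++ [p] =
      (B ++ A) ++ (q :: C) ++ g' :: (Q ++ [p]) := by simp
  rw [e2]
  refine h.settled_slide_append hg ?_
  have e3 : q :: C ++ (B ++ A) ++ g' :: (Q ++ [p]) =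
      [] ++ q :: (C ++ (B ++ A) ++ g' :: (Q ++ [p])) := by simp
  rw [e3]
  refine settled_rotate ?_
  have e4 : C ++ (B ++ A) ++ g' :: (Q ++ [p]) ++ [g] =
      (C ++ (B ++ A)) ++ (g' :: Q) ++ p :: [g] := by simp
  rw [e4]
  refine h.settled_slide_append hp ?_
  refine settled_rotate ?_
  exact h.settled_interlaced hq hg

/-- A twisted chord is dealt with first. If there is none, the chord at `p` either crosses another
one, and the crossing is normalised, or crosses none, and then its ends enclose a closed stretch. -/
theorem of_isBouquet (h : Reduction P G) (hG : G.IsBouquet) (hp : G.side p ≠ G.arc p) : P G := by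
  have aa := G.arc_arc; have ss := G.side_side; have as := G.arc_side
  obtain ⟨L, hL⟩ := exists_round hG p
  have hκ : (∀ a, G.corner (G.corner a) = a) ∧ ∀ a, G.corner a ≠ a :=
    ⟨G.corner_corner, G.corner_ne⟩
  by_cases htw : ∃ x ∈ p :: L, G.side x ≠ G.arc x ∧ G.side x ∈ p :: L
  · obtain ⟨x, hx, -, hx'⟩ := htw
    obtain ⟨L', hL', hm⟩ : ∃ L', G.Round G.corner x L' ∧ G.side x ∈ x :: L' := by
      rcases List.mem_cons.1 hx with rfl | hx
      · exact ⟨L, hL, hx'⟩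
      · obtain ⟨L₁, L₂, rfl⟩ := List.append_of_mem hx
        refine ⟨_, hL.rotate, ?_⟩
        simp only [List.mem_cons, List.mem_append] at hx' ⊢
        tauto
    obtain ⟨Y, Q, rfl⟩ := List.append_of_mem ((List.mem_cons.1 hm).resolve_left (G.side_ne x))
    exact h.settled_twisted rfl G.corner hκ hL'
  -- Without twisted chords, each ribbon has both its ends entered in the sense `x`, `arc (side x)`;
  -- for a half-ribbon the two entries coincide.
  have hun : ∀ x ∈ p :: L, G.arc (G.side x) ∈ p :: L := by
    intro x hx
    by_cases hxe : G.side x = G.arc x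
    · rwa [hxe, aa]
    · exact (hL.cover _).resolve_left fun h' => htw ⟨x, hx, hxe, h'⟩
  obtain ⟨q, hq⟩ : ∃ q, q = G.arc (G.side p) := ⟨_, rfl⟩
  have hpq : p = G.arc (G.side q) := by rw [hq, ← as, aa, ss]
  have hqL : q ∈ L := by
    have := hun p (List.mem_cons_self ..)
    rw [← hq] at this
    refine (List.mem_cons.1 this).resolve_left fun e => hp ?_
    rw [← aa (G.side p), ← hq, e]
  obtain ⟨L₁, L₂, rfl⟩ := List.append_of_mem hqL
  suffices Settled P G p (L₁ ++ q :: L₂) from this G.corner hκ hL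
  by_cases hcr : ∃ g ∈ L₁, G.arc (G.side g) ∈ L₂
  · obtain ⟨g, hg, hg'⟩ := hcr
    obtain ⟨A, B, rfl⟩ := List.append_of_mem hg
    obtain ⟨C, D, rfl⟩ := List.append_of_mem hg'
    exact h.settled_crossing hq rfl
  have hcl : ∀ x, x = p ∨ x ∈ L₁ ∨ x = q →
      G.arc (G.side x) = p ∨ G.arc (G.side x) ∈ L₁ ∨ G.arc (G.side x) = q := by
    rintro x (rfl | hx | rfl)
    · exact .inr (.inr hq.symm)
    · have h1 := hun x (by simp [hx])
      have h2 : G.arc (G.side x) ∉ L₂ := fun h' => hcr ⟨x, hx, h'⟩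
      simp only [List.mem_cons, List.mem_append] at h1
      tauto
    · exact .inl hpq.symm
  cases L₂ with
  | cons r L₂ =>
    have e : L₁ ++ q :: r :: L₂ = (L₁ ++ [q]) ++ r :: L₂ := by simp
    rw [e]
    refine h.settled_split fun x hx => .inr ?_
    simpa using hcl x (by simpa using hx)
  -- Nothing follows `q`, so `q` and `p` are neighbours in the cyclic word. Either they are all of
  -- it, or the word starting at `q` has the closed stretch `q, p`.
  | nil =>
    cases L₁ with
    | nil => exact h.settled_one hq
    | cons r L₁ =>
      refine settled_rotate (h.settled_split (L₁ := [p]) fun x hx => .inr ?_)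
      simp only [List.mem_cons, List.not_mem_nil, or_false] at hx ⊢
      rcases hx with rfl | rfl
      · exact .inr hpq.symm
      · exact .inl hq.symm

end Reduction

end PinchedRibbonGraph


/-! ### Uniqueness of functions satisfying the recursion rules -/

namespace PinchedRibbonGraph

variable {R : Type*} [CommRing R] {G H : PinchedRibbonGraph}

theorem numVertices_pos (a : G.Flag) : 0 < G.numVertices := by
  have : Nonempty G.AttachedVertex := ⟨G.vertexOf a⟩
  have : 0 < Nat.card G.AttachedVertex := Nat.card_pos
  unfold numVertices
  omega

theorem IsBouquet.isolated_eq (hG : G.IsBouquet) (a : G.Flag) : G.isolated = 0 := by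
  have : Nonempty G.AttachedVertex := ⟨G.vertexOf a⟩
  have : 0 < Nat.card G.AttachedVertex := Nat.card_pos
  have : G.numVertices = 1 := hG
  unfold numVertices at this
  omega

theorem withCorner_numEdges (κ : G.Flag → G.Flag) (hκ) :
    (G.withCorner κ hκ).numEdges = G.numEdges := by
  have h1 := four_mul_numEdges (G.withCorner κ hκ)
  have h2 := four_mul_numEdges G
  have h3 := h1.trans h2.symm
  omega

theorem disjointUnion_cut {b : H.Flag} (hb : H.side b ≠ H.arc b)
    (hb' : (G.disjointUnion H).side (.inr b) ≠ (G.disjointUnion H).arc (.inr b)) :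
    Nonempty (((G.disjointUnion H).cut ((G.disjointUnion H).edgeOf (.inr b) hb')).Iso
      (G.disjointUnion (H.cut (H.edgeOf b hb)))) := by
  refine ⟨⟨Equiv.refl _, fun _ => rfl, fun _ => rfl, ?_, rfl⟩⟩
  rintro (a | a)
  · refine cut_side_of_ne (G := G.disjointUnion H) hb' fun e => ?_
    rcases (G.disjointUnion H).ribbonOf_eq_iff.1 e with h | h | h | h <;> cases h
  · by_cases h : H.ribbonOf a = H.ribbonOf b
    · refine (cut_side_of_eq (G := G.disjointUnion H) hb' ?_).trans ?_
      · rw [ribbonOf_eq_iff] at h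
        exact (G.disjointUnion H).ribbonOf_eq_iff.2 <| h.imp (congrArg Sum.inr) (Or.imp (congrArg Sum.inr)
          (Or.imp (congrArg Sum.inr) (congrArg Sum.inr)))
      · exact congrArg Sum.inr (cut_side_of_eq hb h).symm
    · refine (cut_side_of_ne (G := G.disjointUnion H) hb' fun e => h ?_).trans ?_
      · refine H.ribbonOf_eq_iff.2 (((G.disjointUnion H).ribbonOf_eq_iff.1 e).imp ?_
          (Or.imp ?_ (Or.imp ?_ ?_))) <;> exact fun h => Sum.inr_injective h
      · exact congrArg Sum.inr (cut_side_of_ne hb h).symm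

/-- The edges of the bouquet are cut one after the other until its vertex may be deleted. -/
theorem MinorClosed.of_disjointUnion {M : Set PinchedRibbonGraph} (hM : MinorClosed M)
    (hH : H.IsBouquet) (h : G.disjointUnion H ∈ M) : G ∈ M := by
  obtain ⟨n, hn⟩ : ∃ n, n = H.numEdges := ⟨_, rfl⟩
  induction n generalizing H with
  | zero => exact hM.deleteVertex hH ((isEdgeless_iff_numEdges H).2 hn.symm) h
  | succ n ih =>
    obtain ⟨b, hb⟩ : ∃ b, H.side b ≠ H.arc b := by
      by_contra hcon
      push Not at hcon
      have := (isEdgeless_iff_numEdges H).1 ((isEdgeless_iff H).2 hcon)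
      omega
    have hb' : (G.disjointUnion H).side (.inr b) ≠ (G.disjointUnion H).arc (.inr b) :=
      fun e => hb (Sum.inr_injective e)
    refine ih (H := H.cut (H.edgeOf b hb)) hH
      (hM.iso (disjointUnion_cut hb hb') (hM.cut h _)) ?_
    have := cut_numEdges (hb := hb)
    omega

theorem isBouquet_restrict {S : Set G.Flag} (h : G.IsClosed S) {b : G.Flag} (hb : b ∈ S)
    (hS : ∀ a ∈ S, G.vertexOf a = G.vertexOf b) : (G.restrict h 0).IsBouquet := by
  classical
  have aa := G.arc_arc; have cc := G.corner_corner
  -- Flags outside `S` get the value `none`; extended in this way, the vertex map of the part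
  -- descends to the vertices of `G`.
  let f : G.Flag → Option (G.restrict h 0).AttachedVertex := fun a =>
    if ha : a ∈ S then some ((G.restrict h 0).vertexOf ⟨a, ha⟩) else none
  have hf : ∀ (σ : G.Flag → G.Flag) (hσ : ∀ a ∈ S, σ a ∈ S), (∀ a, σ (σ a) = a) →
      (∀ a ha, (G.restrict h 0).vertexOf ⟨σ a, hσ a ha⟩ = (G.restrict h 0).vertexOf ⟨a, ha⟩) →
      ∀ a, f a = f (σ a) := by
    intro σ hσ hi hv a
    by_cases ha : a ∈ S
    · simp only [f, dif_pos ha, dif_pos (hσ a ha), hv a ha]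
    · have ha' : σ a ∉ S := fun h' => ha (hi a ▸ hσ _ h')
      simp only [f, dif_neg ha, dif_neg ha']
  let g : G.AttachedVertex → Option (G.restrict h 0).AttachedVertex := Quot.lift f (by
    rintro a _ (rfl | rfl)
    · exact hf G.arc (fun a ha => (h a ha).1) aa
        (fun a ha => vertexOf_arc (G := G.restrict h 0) ⟨a, ha⟩) a
    · exact hf G.corner (fun a ha => (h a ha).2.1) cc
        (fun a ha => vertexOf_corner (G := G.restrict h 0) ⟨a, ha⟩) a)
  have key : Nat.card (G.restrict h 0).AttachedVertex = 1 := by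
    refine Nat.card_eq_one_iff_exists.2 ⟨(G.restrict h 0).vertexOf ⟨b, hb⟩, ?_⟩
    rintro ⟨a, ha⟩
    have h1 : f a = f b := congrArg g (hS a ha)
    simp only [f, dif_pos ha, dif_pos hb] at h1
    exact Option.some_injective _ h1
  exact congrArg (· + 0) key

section Unique

variable {M : Set PinchedRibbonGraph} {α β t : R} {F F' : PinchedRibbonGraph → R}

/-- Both factors have strictly fewer flags, though possibly no fewer edges, since a factor may carry
half-ribbons only. This is why flags serve as the measure. The unit `α` is cancelled from the joint
rule. -/
theorem Recursive.eq_of_joint (hα : IsUnit α) (hM : MinorClosed M)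
    (hM2 : ∀ G : PinchedRibbonGraph, G.numVertices = 2 → G ∈ M) (hF : Recursive M α β t F)
    (hF' : Recursive M α β t F') {S : Set G.Flag} {p q : G.Flag} (hG : G.IsBouquet)
    (hS : G.Splits S p q)
    (IH : ∀ H : PinchedRibbonGraph, H.IsBouquet → H.numEdges ≤ G.numEdges →
      Nat.card H.Flag < Nat.card G.Flag → F H = F' H) : F G = F' G := by
  have := G.finite
  obtain ⟨f⟩ := hS.iso_joint (n := 0) (m := 0) (hG.isolated_eq p).symm
  set A := (G.withCorner _ hS.involutive).restrict hS.isClosed 0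
  set B := (G.withCorner _ hS.involutive).restrict hS.isClosed.compl 0
  have hv := joint_numVertices (G := A) (H := B) ⟨p, hS.mem⟩ ⟨G.corner p, hS.corner_notMem⟩
  have hv0 : G.numVertices = 1 := hG
  rw [f.numVertices_eq, hv0] at hv
  have hA0 := numVertices_pos (G := A) ⟨p, hS.mem⟩
  have hB0 := numVertices_pos (G := B) ⟨q, hS.notMem⟩
  have hA : A.IsBouquet := by unfold IsBouquet; omega
  have hB : B.IsBouquet := by unfold IsBouquet; omega
  have hE := joint_numEdges (G := A) (H := B) ⟨p, hS.mem⟩ ⟨G.corner p, hS.corner_notMem⟩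
  rw [f.numEdges_eq] at hE
  have hAc : Nat.card A.Flag < Nat.card G.Flag :=
    Finite.card_subtype_lt (x := q) hS.notMem
  have hBc : Nat.card B.Flag < Nat.card G.Flag :=
    Finite.card_subtype_lt (x := p) fun h => h hS.mem
  have hAM := isBouquet_mem hM hM2 hA
  have hBM := isBouquet_mem hM hM2 hB
  have hGM := isBouquet_mem hM hM2 hG
  have hJ := isBouquet_mem hM hM2
    (isBouquet_joint (G := A) (H := B) ⟨p, hS.mem⟩ ⟨G.corner p, hS.corner_notMem⟩ hA hB)
  have h1 := hF.joint A hAM B hBM hA hB _ _ hJ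
  have h2 := hF'.joint A hAM B hBM hA hB _ _ hJ
  rw [IH A hA (by omega) hAc, IH B hB (by omega) hBc, ← h2] at h1
  rw [← hF.iso _ hJ _ hGM ⟨f⟩, ← hF'.iso _ hJ _ hGM ⟨f⟩]
  exact hα.mul_left_cancel h1

/-- Strong induction on flags, run within a fixed bound on edges. Slides change neither number, so
`Reduction` can be applied to the property `F H = F' H`; only joints use the induction. -/
theorem Recursive.eq_of_isBouquet (hα : IsUnit α) (hM : MinorClosed M)
    (hM2 : ∀ G : PinchedRibbonGraph, G.numVertices = 2 → G ∈ M) (hF : Recursive M α β t F)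
    (hF' : Recursive M α β t F')
    (hD : ∀ D, D = D1000 ∨ D = D1010 ∨ D = D2100 → F D = F' D) {n : ℕ}
    (IH : ∀ H ∈ M, H.numEdges < n → F H = F' H) (hG : G.IsBouquet) (hn : G.numEdges ≤ n) :
    F G = F' G := by
  obtain ⟨N, hN⟩ : ∃ N, Nat.card G.Flag = N := ⟨_, rfl⟩
  induction N using Nat.strong_induction_on generalizing G with
  | _ N ih =>
    have hGM := isBouquet_mem hM hM2 hG
    by_cases hE : ∀ a, G.side a = G.arc a
    · have hE := (isEdgeless_iff G).2 hE
      rw [hF.edgeless G hGM hE, hF'.edgeless G hGM hE]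
    push Not at hE
    obtain ⟨p, hp⟩ := hE
    refine Reduction.of_isBouquet (P := fun H => F H = F' H) ?_ hG hp
    refine ⟨hG.isolated_eq p, ?_, ?_, ?_⟩
    · intro κ hκ z hz hB hP
      exact hF.eq_of_slide hM hM2 hF' hB (by rwa [withCorner_numEdges]) IH hz hP
    · intro κ hκ S p q hB hS
      refine hF.eq_of_joint hα hM hM2 hF' hB hS fun H hH h1 h2 => ?_
      rw [withCorner_numEdges κ hκ] at h1
      exact ih _ (hN ▸ h2) hH (h1.trans hn) rfl
    · rintro κ hκ D hD' ⟨f⟩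
      have hDB : D.IsBouquet := by
        rcases hD' with rfl | rfl | rfl <;> exact isBouquet_chordDiagram
      have hDM := isBouquet_mem hM hM2 hDB
      have hKM := hM.iso ⟨f⟩ hDM
      rw [← hF.iso _ hDM _ hKM ⟨f⟩, ← hF'.iso _ hDM _ hKM ⟨f⟩]
      exact hD D hD'

/-- Outer induction on edges, inner induction on vertices. When every edge is a loop, the vertex of
one edge is a whole component and is split off as a bouquet. -/
theorem Recursive.eq_of_eq (hα : IsUnit α) (hM : MinorClosed M)
    (hM2 : ∀ G : PinchedRibbonGraph, G.numVertices = 2 → G ∈ M) (hF : Recursive M α β t F)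
    (hF' : Recursive M α β t F') (h1 : F D1000 = F' D1000) (h2 : F D1010 = F' D1010)
    (h3 : F D2100 = F' D2100) : ∀ G ∈ M, F G = F' G := by
  have hD : ∀ D, D = D1000 ∨ D = D1010 ∨ D = D2100 → F D = F' D := by
    rintro D (rfl | rfl | rfl) <;> assumption
  suffices ∀ n, ∀ G ∈ M, G.numEdges ≤ n → F G = F' G from fun G hG => this _ G hG le_rfl
  intro n
  induction n using Nat.strong_induction_on with
  | _ n ih =>
    have IH : ∀ H ∈ M, H.numEdges < n → F H = F' H := fun H hH hn => ih _ hn H hH le_rfl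
    intro G
    obtain ⟨v, hv⟩ : ∃ v, G.numVertices = v := ⟨_, rfl⟩
    induction v using Nat.strong_induction_on generalizing G with
    | _ v ihv =>
      intro hG hn
      by_cases hE : ∀ a, G.side a = G.arc a
      · have hE := (isEdgeless_iff G).2 hE
        rw [hF.edgeless G hG hE, hF'.edgeless G hG hE]
      by_cases hnl : ∃ b, G.side b ≠ G.arc b ∧ G.vertexOf b ≠ G.vertexOf (G.side b)
      · obtain ⟨b, hb, hnl⟩ := hnl
        exact hF.eq_of_nonloop hM hF' hG hn IH hb hnl
      push Not at hE hnl
      obtain ⟨b, hb⟩ := hE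
      have hside : ∀ a, G.vertexOf (G.side a) = G.vertexOf a := by
        intro a
        by_cases ha : G.side a = G.arc a
        · rw [ha, vertexOf_arc]
        · exact (hnl a ha).symm
      have hT : G.IsClosed {a | G.vertexOf a ≠ G.vertexOf b} := fun a ha =>
        ⟨by rwa [Set.mem_ofPred_eq, vertexOf_arc], by rwa [Set.mem_ofPred_eq, vertexOf_corner],
          by rwa [Set.mem_ofPred_eq, hside]⟩
      -- The isolated vertices all go to the remainder, so that the part at `b` is exactly one
      -- vertex.
      obtain ⟨f⟩ := iso_disjointUnion_restrict hT (n := G.isolated) (m := 0) rfl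
      have hV : (G.restrict hT.compl 0).IsBouquet :=
        isBouquet_restrict hT.compl (b := b) (fun h => h rfl) fun a ha => not_not.1 ha
      set A := G.restrict hT G.isolated
      set V := G.restrict hT.compl 0
      have hU := hM.iso ⟨f.symm⟩ hG
      have hAM := hM.of_disjointUnion hV hU
      have hVM := isBouquet_mem hM hM2 hV
      have hv' := disjointUnion_numVertices A V
      have hE' := disjointUnion_numEdges A V
      rw [f.numVertices_eq, hV] at hv'
      rw [f.numEdges_eq] at hE'
      rw [← hF.iso _ hU _ hG ⟨f⟩, ← hF'.iso _ hU _ hG ⟨f⟩, hF.union A hAM V hVM hU,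
        hF'.union A hAM V hVM hU, ihv A.numVertices (by omega) A rfl hAM (by omega),
        hF.eq_of_isBouquet hα hM hM2 hF' hD IH hV (by omega)]

end Unique

end PinchedRibbonGraph

/-! ### Comparison of initial values and conclusion -/

theorem mainTheorem8 {R : Type*} [CommRing R]
    (M : Set PinchedRibbonGraph) (hM : PinchedRibbonGraph.MinorClosed M)
    (hM2 : ∀ G : PinchedRibbonGraph, G.numVertices = 2 → G ∈ M)
    (F : PinchedRibbonGraph → R)
    (hF : ∀ G H : PinchedRibbonGraph, G ∈ M → H ∈ M → Nonempty (G.Iso H) → F G = F H)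
    (α : Rˣ) (x u v t s q r s₁ : R)
    (hs : s = F PinchedRibbonGraph.D2100) (hq : q = F PinchedRibbonGraph.D1000)
    (hr : r = F PinchedRibbonGraph.D1010) (hs₁ : s₁ = F PinchedRibbonGraph.D0001)
    (hregular : ∀ G ∈ M, ∀ e : G.Edge, G.IsRegularEdge e →
      F G = F (G.cut e) + F (G.contract e))
    (hbridge : ∀ G ∈ M, ∀ e : G.Edge, G.IsBridge e →
      F G = ((x - 1) * (((α⁻¹ : Rˣ) : R) * s₁) ^ 2 + 1) * F (G.contract e))
    (hunion : ∀ G ∈ M, ∀ H ∈ M, G.disjointUnion H ∈ M → F (G.disjointUnion H) = F G * F H)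
    (hjoint : ∀ G ∈ M, ∀ H ∈ M, G.IsBouquet → H.IsBouquet →
      ∀ (c : G.Flag) (d : H.Flag), G.joint H c d ∈ M → (α : R) * F (G.joint H c d) = F G * F H)
    (hedgeless : ∀ E ∈ M, E.IsEdgeless →
      F E = (α : R) ^ E.numVertices * t ^ E.numHalfRibbons)
    (h_s : (q - ((α⁻¹ : Rˣ) : R) * s₁ ^ 2) ^ 2 * u ^ 2 =
      (α : R) * (s - 2 * ((α⁻¹ : Rˣ) : R) ^ 2 * (q - ((α⁻¹ : Rˣ) : R) * s₁ ^ 2) * s₁ ^ 2 -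
        ((α⁻¹ : Rˣ) : R) ^ 3 * s₁ ^ 4))
    (h_r : (q - ((α⁻¹ : Rˣ) : R) * s₁ ^ 2) * u * v = r - ((α⁻¹ : Rˣ) : R) * s₁ ^ 2)
    (h_v : v = v ^ 2) :
    ∀ G ∈ M, F G = (α : R) ^ G.numComponents *
      G.polyR' x (((α⁻¹ : Rˣ) : R) * (q - ((α⁻¹ : Rˣ) : R) * s₁ ^ 2 + (α : R))) u v
        (((α⁻¹ : Rˣ) : R) * s₁) := by
  open PinchedRibbonGraph in
  have hαα : (α : R) * ((α⁻¹ : Rˣ) : R) = 1 := α.mul_inv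
  have hD : D0001.IsBouquet := isBouquet_chordDiagram
  -- The edgeless rule at `D0001` reads `s₁ = α t`, so the last argument of the polynomial is `t`
  -- itself.
  have ht : ((α⁻¹ : Rˣ) : R) * s₁ = t := by
    rw [hs₁, hedgeless _ (isBouquet_mem hM hM2 hD) isEdgeless_D0001, hD, numHalfRibbons_D0001,
      pow_one, pow_one, ← mul_assoc, α.inv_mul, one_mul]
  have hs₁' : s₁ = α * t := by rw [← ht, ← mul_assoc, hαα, one_mul]
  rw [ht] at hbridge ⊢
  generalize ((α⁻¹ : Rˣ) : R) = a at *
  have e1 : a * s₁ ^ 2 = α * t ^ 2 := by rw [hs₁']; linear_combination α * t ^ 2 * hαα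
  have e2 : a ^ 2 * s₁ ^ 2 = t ^ 2 := by
    linear_combination a * e1 + t ^ 2 * hαα
  have e3 : a ^ 3 * s₁ ^ 4 = α * t ^ 4 := by
    linear_combination a * s₁ ^ 2 * e2 + t ^ 2 * e1
  -- This is `y - 1` for the second argument of the polynomial, so `α (y - 1) = q - α t²`.
  have e4 : a * (q - a * s₁ ^ 2 + α) - 1 = a * (q - α * t ^ 2) := by
    rw [e1]; linear_combination hαα
  -- The condition on `u²`, rewritten in terms of `t`.
  have e5 : (q - α * t ^ 2) ^ 2 * u ^ 2 = α * (s - 2 * (q - α * t ^ 2) * t ^ 2 - α * t ^ 4) := by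
    rw [← e1, h_s, ← e3]; linear_combination -2 * α * (q - a * s₁ ^ 2) * e2
  rw [e1] at h_r
  refine Recursive.eq_of_eq α.isUnit hM hM2
    ⟨fun G hG H hH => hF G H hG hH, hregular, hbridge, hunion, hjoint, hedgeless⟩
    (recursive_polyR' M (α : R) x (a * (q - a * s₁ ^ 2 + α)) u h_v t) ?_ ?_ ?_
  -- The value `α ((y - 1) + t²)` equals `q` by the choice of `y`. The next two cases need the
  -- conditions on `u v` and on `u²` respectively.
  · rw [polyR'_D1000, D1000, isBouquet_chordDiagram.numComponents_eq, ← D1000, ← hq, e4]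
    linear_combination -(q - α * t ^ 2) * hαα
  · rw [polyR'_D1010, D1010, isBouquet_chordDiagram.numComponents_eq, ← D1010, ← hr, e4]
    linear_combination -(q - α * t ^ 2) * u * v * hαα - h_r
  · rw [polyR'_D2100, D2100, isBouquet_chordDiagram.numComponents_eq, ← D2100, ← hs, e4]
    linear_combination -α * a ^ 2 * e5 - (α * a + 1) *
      (s - 2 * (q - α * t ^ 2) * t ^ 2 - α * t ^ 4) * hαα - 2 * (q - α * t ^ 2) * t ^ 2 * hαα
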